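/- Let $\mathbb K$ be $\mathbb R$ or $\mathbb C$, let $0<p<\infty$, let $\ell_p=\ell_p(\mathbb N,\mathbb K)$ and let $\ell_p^0$ be its subspace of finitely supported sequences. A \emph{centralizer} on $\ell_p$ is a homogeneous map $\Phi:\ell_p^0\to\ell_p$ (that is, $\Phi(\lambda x)=\lambda\Phi(x)$ for all scalars $\lambda$) for which there is a constant $C$ with $\|\Phi(ax)-a\Phi(x)\|_p\le C\|a\|_\infty\|x\|_p$ for all $a\in\ell_\infty$ and $x\in\ell_p^0$. Every centralizer $\Phi$ is quasilinear, i.e. $\|\Phi(x+y)-\Phi(x)-\Phi(y)\|_p\le Q(\|x\|_p+\|y\|_p)$ for some constant $Q$, and so it induces a short exact sequence of quasi Banach spaces $0\to\ell_p\to Z(\Phi)\to\ell_p\to0$, where $Z(\Phi)$ is the completion of $\ell_p\times\ell_p^0$ in the quasinorm $\|(y,x)\|_\Phi=\|y-\Phi(x)\|_p+\|x\|_p$ and the arrows extend $y\mapsto(y,0)$ and $(y,x)\mapsto x$. For centralizers $\Phi,\Psi$ on $\ell_p$, let $\Phi\,\Psi$ denote the four-term exact sequence $0\to\ell_p\to Z(\Phi)\to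 Z(\Psi)\to\ell_p\to0$ obtained by splicing the sequences induced by $\Phi$ and $\Psi$ through $\ell_p$. Write $\sim$ for equivalence in $\operatorname{Ext}^2(\ell_p,\ell_p)$ in the category of quasi Banach spaces and bounded linear operators, i.e. the equivalence relation on four-term exact sequences $0\to\ell_p\to E_1\to E_2\to\ell_p\to0$ generated by the commutative diagrams of operators that are the identity on both end spaces. Write $\Phi\,\Psi\sim0$ if $\Phi\,\Psi$ is equivalent to $0\to\ell_p\xrightarrow{\ \mathrm{id}\ }\ell_p\xrightarrow{\ 0\ }\ell_p\xrightarrow{\ \mathrm{id}\ }\ell_p\to0$, and say that $\Phi$ and $\Psi$ commute if $\Phi\,\Psi\sim\Psi\,\Phi$. Then: (1) $\Phi\,\Psi\sim-\Psi\,\Phi$, where $-\Psi\,\Phi$ may be read either as the additive inverse of $\Psi\,\Phi$ in $\operatorname{Ext}^2(\ell_p,\ell_p)$ (the push-out of the sequence $\Psi\,\Phi$ along $-\mathrm{id}_{\ell_p}$) or as the concatenation $(-\Psi)\,\Phi$. (2) $\Phi\,\Psi\sim0$ if and only if $\Psi\,\Phi\sim0$, if and only if $\Phi$ and $\Psi$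 commute. (3) $\Phi\,\Psi\sim0$ if and only if $(\Phi+\Psi)\,(\Phi-\Psi)\sim0$, where $\Phi\pm\Psi$ are the pointwise sum and difference. -/

import Mathlib

open scoped ENNReal Topology
open Filter

set_option linter.unusedSectionVars false

universe u

noncomputable section

namespace TwistedSum

/-! ## Quasi Banach spaces and bounded operators -/

/-- `‖·‖` is a quasinorm on the linear space `E`. -/
class QuasinormedSpace (𝕜 : Type u) (E : Type u) [RCLike 𝕜] [AddCommGroup E] [Module 𝕜 E]
    [Norm E] : Prop where
  nonneg : ∀ x : E, 0 ≤ ‖x‖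
  smul : ∀ (c : 𝕜) (x : E), ‖c • x‖ = ‖c‖ * ‖x‖
  eq_zero : ∀ x : E, ‖x‖ = 0 → x = 0
  add_le : ∃ C : ℝ, ∀ x y : E, ‖x + y‖ ≤ C * (‖x‖ + ‖y‖)

/-- Cauchy sequences with respect to a quasinorm. -/
def IsCauchy {E : Type u} [AddCommGroup E] [Norm E] (v : ℕ → E) : Prop :=
  ∀ ε : ℝ, 0 < ε → ∃ N, ∀ m ≥ N, ∀ n ≥ N, ‖v m - v n‖ < ε

/-- Convergence of a sequence to `x` with respect to a quasinorm. -/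
def ConvergesTo {E : Type u} [AddCommGroup E] [Norm E] (v : ℕ → E) (x : E) : Prop :=
  Tendsto (fun n => ‖v n - x‖) atTop (𝓝 0)

/-- A quasi Banach space: a complete quasinormed space (the topology of a quasinorm is metrizable,
so that completeness is convergence of all Cauchy sequences). -/
class QuasiBanachSpace (𝕜 : Type u) (E : Type u) [RCLike 𝕜] [AddCommGroup E] [Module 𝕜 E]
    [Norm E] : Prop extends QuasinormedSpace 𝕜 E where
  complete : ∀ v : ℕ → E, IsCauchy v → ∃ x : E, ConvergesTo v x

/-- Boundedness of a linear map between quasinormed spaces; the bounded linear maps are the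
operators (morphisms) of the category of quasi Banach spaces. -/
def IsBdd {𝕜 E F : Type u} [RCLike 𝕜] [AddCommGroup E] [Module 𝕜 E] [Norm E]
    [AddCommGroup F] [Module 𝕜 F] [Norm F] (T : E →ₗ[𝕜] F) : Prop :=
  ∃ C : ℝ, ∀ x, ‖T x‖ ≤ C * ‖x‖

theorem qnorm_nonneg (𝕜 : Type u) {E : Type u} [RCLike 𝕜] [AddCommGroup E] [Module 𝕜 E]
    [Norm E] [QuasinormedSpace 𝕜 E] (x : E) : 0 ≤ ‖x‖ := QuasinormedSpace.nonneg (𝕜 := 𝕜) x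

theorem qnorm_smul (𝕜 : Type u) {E : Type u} [RCLike 𝕜] [AddCommGroup E] [Module 𝕜 E]
    [Norm E] [QuasinormedSpace 𝕜 E] (c : 𝕜) (x : E) : ‖c • x‖ = ‖c‖ * ‖x‖ := QuasinormedSpace.smul c x

theorem qnorm_zero (𝕜 : Type u) {E : Type u} [RCLike 𝕜] [AddCommGroup E] [Module 𝕜 E]
    [Norm E] [QuasinormedSpace 𝕜 E] : ‖(0 : E)‖ = 0 := by
  have := qnorm_smul 𝕜 (0 : 𝕜) (0 : E)
  simpa using this

theorem qnorm_neg (𝕜 : Type u) {E : Type u} [RCLike 𝕜] [AddCommGroup E] [Module 𝕜 E]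
    [Norm E] [QuasinormedSpace 𝕜 E] (x : E) : ‖-x‖ = ‖x‖ := by
  have := qnorm_smul 𝕜 (-1 : 𝕜) x
  simpa using this

theorem qnorm_sub_comm (𝕜 : Type u) {E : Type u} [RCLike 𝕜] [AddCommGroup E] [Module 𝕜 E]
    [Norm E] [QuasinormedSpace 𝕜 E] (x y : E) : ‖x - y‖ = ‖y - x‖ := by
  rw [← qnorm_neg 𝕜 (x - y), neg_sub]

theorem exists_modulus (𝕜 : Type u) [RCLike 𝕜] (E : Type u) [AddCommGroup E] [Module 𝕜 E] [Norm E]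
    [QuasinormedSpace 𝕜 E] :
    ∃ C : ℝ, 1 ≤ C ∧ ∀ x y : E, ‖x + y‖ ≤ C * (‖x‖ + ‖y‖) := by
  obtain ⟨C, hC⟩ := QuasinormedSpace.add_le (𝕜 := 𝕜) (E := E)
  refine ⟨max C 1, le_max_right _ _, fun x y => (hC x y).trans ?_⟩
  have h1 := qnorm_nonneg 𝕜 x
  have h2 := qnorm_nonneg 𝕜 y
  gcongr
  exact le_max_left _ _

theorem qnorm_sub_le (𝕜 : Type u) {E : Type u} [RCLike 𝕜] [AddCommGroup E] [Module 𝕜 E]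
    [Norm E] [QuasinormedSpace 𝕜 E] {C : ℝ} (hC : ∀ x y : E, ‖x + y‖ ≤ C * (‖x‖ + ‖y‖)) (x y : E) :
    ‖x - y‖ ≤ C * (‖x‖ + ‖y‖) := by
  have := hC x (-y)
  rwa [qnorm_neg 𝕜, ← sub_eq_add_neg] at this

section Basic

variable (𝕜 : Type u) {E : Type u} [RCLike 𝕜] [AddCommGroup E] [Module 𝕜 E] [Norm E]
  [QuasinormedSpace 𝕜 E]

/-- The linear space of Cauchy sequences. -/
def cauchySeq (E : Type u) [AddCommGroup E] [Module 𝕜 E] [Norm E] [QuasinormedSpace 𝕜 E] :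
    Submodule 𝕜 (ℕ → E) where
  carrier := {v | IsCauchy v}
  zero_mem' := by
    intro ε hε
    exact ⟨0, fun m _ n _ => by simpa [qnorm_zero 𝕜] using hε⟩
  add_mem' := by
    intro a b ha hb ε hε
    obtain ⟨C, hC1, hC⟩ := exists_modulus 𝕜 E
    have hδ : 0 < ε / (2 * C) := by positivity
    obtain ⟨N, hN⟩ := ha _ hδ
    obtain ⟨M, hM⟩ := hb _ hδ
    refine ⟨max N M, fun m hm n hn => ?_⟩
    have h1 := hN m (le_trans (le_max_left _ _) hm) n (le_trans (le_max_left _ _) hn)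
    have h2 := hM m (le_trans (le_max_right _ _) hm) n (le_trans (le_max_right _ _) hn)
    have h3 : (a + b) m - (a + b) n = (a m - a n) + (b m - b n) := by
      simp only [Pi.add_apply]; abel
    rw [h3]
    calc _ ≤ C * (‖a m - a n‖ + ‖b m - b n‖) := hC _ _
      _ < C * (ε / (2 * C) + ε / (2 * C)) := by gcongr
      _ = ε := by field_simp; norm_num
  smul_mem' := by
    intro c a ha ε hε
    have hδ : 0 < ε / (‖c‖ + 1) := by positivity
    obtain ⟨N, hN⟩ := ha _ hδ
    refine ⟨N, fun m hm n hn => ?_⟩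
    have h1 := hN m hm n hn
    simp only [Pi.smul_apply, ← smul_sub, qnorm_smul 𝕜]
    have h0 := qnorm_nonneg 𝕜 (a m - a n)
    calc _ ≤ (‖c‖ + 1) * ‖a m - a n‖ := by nlinarith
      _ < (‖c‖ + 1) * (ε / (‖c‖ + 1)) := by gcongr
      _ = ε := by field_simp

/-- The null sequences, as a subspace of the space of Cauchy sequences. -/
def nullSeq (E : Type u) [AddCommGroup E] [Module 𝕜 E] [Norm E] [QuasinormedSpace 𝕜 E] :
    Submodule 𝕜 (cauchySeq 𝕜 E) where
  carrier := {v | Tendsto (fun n => ‖v.1 n‖) atTop (𝓝 0)}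
  zero_mem' := by
    simp [qnorm_zero 𝕜]
  add_mem' := by
    intro a b ha hb
    obtain ⟨C, hC1, hC⟩ := exists_modulus 𝕜 E
    have h : Tendsto (fun n => C * (‖a.1 n‖ + ‖b.1 n‖)) atTop (𝓝 (C * (0 + 0))) :=
      (ha.add hb).const_mul C
    rw [add_zero, mul_zero] at h
    exact squeeze_zero (fun n => qnorm_nonneg 𝕜 _) (fun n => hC _ _) h
  smul_mem' := by
    intro c a ha
    have h := Tendsto.const_mul ‖c‖ ha
    rw [mul_zero] at h
    refine h.congr fun n => ?_
    exact (qnorm_smul 𝕜 c _).symm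

/-- The completion of a quasinormed space: Cauchy sequences modulo null sequences. -/
def Completion (E : Type u) [AddCommGroup E] [Module 𝕜 E] [Norm E] [QuasinormedSpace 𝕜 E] :
    Type u := cauchySeq 𝕜 E ⧸ nullSeq 𝕜 E

instance (E : Type u) [AddCommGroup E] [Module 𝕜 E] [Norm E] [QuasinormedSpace 𝕜 E] :
    AddCommGroup (Completion 𝕜 E) :=
  inferInstanceAs (AddCommGroup (cauchySeq 𝕜 E ⧸ nullSeq 𝕜 E))

instance (E : Type u) [AddCommGroup E] [Module 𝕜 E] [Norm E] [QuasinormedSpace 𝕜 E] :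
    Module 𝕜 (Completion 𝕜 E) :=
  inferInstanceAs (Module 𝕜 (cauchySeq 𝕜 E ⧸ nullSeq 𝕜 E))

/-- The class of a Cauchy sequence in the completion. -/
def Completion.mk (E : Type u) [AddCommGroup E] [Module 𝕜 E] [Norm E] [QuasinormedSpace 𝕜 E] :
    cauchySeq 𝕜 E →ₗ[𝕜] Completion 𝕜 E := (nullSeq 𝕜 E).mkQ

/-- The quasinorm of the completion: `‖z‖ = inf sup ‖v n‖`, the infimum being taken over all
Cauchy sequences `v` that represent `z`. (A quasinorm need not be continuous, so that a limit of
`‖v n‖` need not exist.) It is equivalent to the original quasinorm on the original space. -/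
instance (E : Type u) [AddCommGroup E] [Module 𝕜 E] [Norm E] [QuasinormedSpace 𝕜 E] :
    Norm (Completion 𝕜 E) where
  norm z := sInf {r : ℝ | ∃ v : cauchySeq 𝕜 E, Completion.mk 𝕜 E v = z ∧ ∀ n, ‖v.1 n‖ ≤ r}

theorem mk_eq_iff (v w : cauchySeq 𝕜 E) : Completion.mk 𝕜 E v = Completion.mk 𝕜 E w ↔
    Tendsto (fun n => ‖v.1 n - w.1 n‖) atTop (𝓝 0) :=
  Submodule.Quotient.eq (nullSeq 𝕜 E)

theorem mk_surj (z : Completion 𝕜 E) : ∃ v, Completion.mk 𝕜 E v = z :=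
  Submodule.mkQ_surjective _ z

theorem cauchy_bdd (v : cauchySeq 𝕜 E) : ∃ r : ℝ, ∀ n, ‖v.1 n‖ ≤ r := by
  obtain ⟨C, hC1, hC⟩ := exists_modulus 𝕜 E
  obtain ⟨N, hN⟩ := v.2 1 one_pos
  have : IsBoundedUnder (· ≤ ·) atTop (fun n => ‖v.1 n‖) := by
    refine ⟨C * (1 + ‖v.1 N‖), ?_⟩
    rw [eventually_map]
    filter_upwards [eventually_ge_atTop N] with n hn
    have h := hC (v.1 n - v.1 N) (v.1 N)
    rw [sub_add_cancel] at h
    refine h.trans ?_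
    gcongr
    exact (hN n hn N le_rfl).le
  obtain ⟨r, hr⟩ := this.bddAbove_range
  exact ⟨r, fun n => hr ⟨n, rfl⟩⟩

theorem norm_mk_le {v : cauchySeq 𝕜 E} {r : ℝ} (h : ∀ n, ‖v.1 n‖ ≤ r) :
    ‖Completion.mk 𝕜 E v‖ ≤ r := by
  refine csInf_le ⟨0, ?_⟩ ⟨v, rfl, h⟩
  rintro s ⟨w, -, hw⟩
  exact (qnorm_nonneg 𝕜 _).trans (hw 0)

theorem exists_rep {z : Completion 𝕜 E} {r : ℝ} (h : ‖z‖ < r) :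
    ∃ v, Completion.mk 𝕜 E v = z ∧ ∀ n, ‖v.1 n‖ ≤ r := by
  have hne : {r : ℝ | ∃ v : cauchySeq 𝕜 E, Completion.mk 𝕜 E v = z ∧ ∀ n, ‖v.1 n‖ ≤ r}.Nonempty := by
    obtain ⟨v, hv⟩ := mk_surj 𝕜 z
    obtain ⟨r, hr⟩ := cauchy_bdd 𝕜 v
    exact ⟨r, v, hv, hr⟩
  obtain ⟨s, ⟨v, hv, hs⟩, hsr⟩ := exists_lt_of_csInf_lt hne h
  exact ⟨v, hv, fun n => (hs n).trans hsr.le⟩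

theorem completion_nonneg (z : Completion 𝕜 E) : 0 ≤ ‖z‖ := by
  refine Real.sInf_nonneg ?_
  rintro s ⟨w, -, hw⟩
  exact (qnorm_nonneg 𝕜 _).trans (hw 0)

theorem eventually_le_of_norm_mk_lt {C : ℝ} (hC1 : 1 ≤ C)
    (hC : ∀ x y : E, ‖x + y‖ ≤ C * (‖x‖ + ‖y‖)) {v : cauchySeq 𝕜 E} {r : ℝ}
    (h : ‖Completion.mk 𝕜 E v‖ < r) : ∀ᶠ n in atTop, ‖v.1 n‖ ≤ 2 * C * r := by
  obtain ⟨w, hw, hb⟩ := exists_rep 𝕜 h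
  have hr : 0 < r := (completion_nonneg 𝕜 _).trans_lt h
  have ht := (mk_eq_iff 𝕜 v w).1 hw.symm
  filter_upwards [ht.eventually (gt_mem_nhds hr)] with n hn
  have h1 := hC (v.1 n - w.1 n) (w.1 n)
  rw [sub_add_cancel] at h1
  calc _ ≤ _ := h1
    _ ≤ C * (r + r) := by
      have := hb n
      gcongr
    _ = _ := by ring

theorem norm_mk_le_of_eventually {v : cauchySeq 𝕜 E} {r : ℝ} (h : ∀ᶠ n in atTop, ‖v.1 n‖ ≤ r) :
    ‖Completion.mk 𝕜 E v‖ ≤ r := by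
  obtain ⟨N, hN⟩ := eventually_atTop.1 h
  let w : cauchySeq 𝕜 E := ⟨fun n => v.1 (N + n), by
    intro ε hε
    obtain ⟨M, hM⟩ := v.2 ε hε
    exact ⟨M, fun m hm n hn => hM _ (by omega) _ (by omega)⟩⟩
  have hw : Completion.mk 𝕜 E v = Completion.mk 𝕜 E w := by
    rw [mk_eq_iff, Metric.tendsto_atTop]
    intro ε hε
    obtain ⟨M, hM⟩ := v.2 ε hε
    refine ⟨M, fun n hn => ?_⟩
    rw [Real.dist_eq, sub_zero, abs_of_nonneg (qnorm_nonneg 𝕜 _)]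
    exact hM _ hn _ (by omega)
  rw [hw]
  exact norm_mk_le 𝕜 fun n => hN _ (by omega)

theorem completion_smul_le (c : 𝕜) (z : Completion 𝕜 E) : ‖c • z‖ ≤ ‖c‖ * ‖z‖ := by
  refine le_of_forall_pos_le_add fun ε hε => ?_
  have hδ : 0 < ε / (‖c‖ + 1) := by positivity
  obtain ⟨v, hv, hb⟩ := exists_rep 𝕜 (lt_add_of_pos_right ‖z‖ hδ)
  rw [← hv, ← map_smul, hv]
  refine (norm_mk_le 𝕜 (r := ‖c‖ * (‖z‖ + ε / (‖c‖ + 1))) fun n => ?_).trans ?_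
  · have : (c • v).1 n = c • v.1 n := rfl
    rw [this, qnorm_smul 𝕜]
    have := hb n
    gcongr
  · rw [mul_add]
    gcongr
    rw [mul_div_assoc', div_le_iff₀ (by positivity)]
    nlinarith [norm_nonneg c]

instance (E : Type u) [AddCommGroup E] [Module 𝕜 E] [Norm E] [QuasinormedSpace 𝕜 E] :
    QuasinormedSpace 𝕜 (Completion 𝕜 E) where
  nonneg := completion_nonneg 𝕜
  smul c z := by
    refine le_antisymm (completion_smul_le 𝕜 c z) ?_
    rcases eq_or_ne c 0 with rfl | hc
    · simpa using completion_nonneg 𝕜 ((0 : 𝕜) • z)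
    · have h := completion_smul_le 𝕜 c⁻¹ (c • z)
      rw [inv_smul_smul₀ hc, norm_inv] at h
      have hc' : 0 < ‖c‖ := norm_pos_iff.2 hc
      rwa [inv_mul_eq_div, le_div_iff₀ hc', mul_comm] at h
  eq_zero z hz := by
    obtain ⟨C, hC1, hC⟩ := exists_modulus 𝕜 E
    obtain ⟨v, rfl⟩ := mk_surj 𝕜 z
    rw [← map_zero (Completion.mk 𝕜 E), mk_eq_iff, Metric.tendsto_atTop]
    intro ε hε
    have hr : ‖Completion.mk 𝕜 E v‖ < ε / (4 * C) := by rw [hz]; positivity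
    obtain ⟨N, hN⟩ := eventually_atTop.1 (eventually_le_of_norm_mk_lt 𝕜 hC1 hC hr)
    refine ⟨N, fun n hn => ?_⟩
    have h0 : (0 : cauchySeq 𝕜 E).1 n = 0 := rfl
    rw [Real.dist_eq, sub_zero, abs_of_nonneg (qnorm_nonneg 𝕜 _), h0, sub_zero]
    calc _ ≤ _ := hN n hn
      _ = ε / 2 := by field_simp; norm_num
      _ < ε := by linarith
  add_le := by
    obtain ⟨C, hC1, hC⟩ := exists_modulus 𝕜 E
    refine ⟨C, fun x y => le_of_forall_pos_le_add fun ε hε => ?_⟩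
    have hδ : 0 < ε / (2 * C) := by positivity
    obtain ⟨v, hv, hvb⟩ := exists_rep 𝕜 (lt_add_of_pos_right ‖x‖ hδ)
    obtain ⟨w, hw, hwb⟩ := exists_rep 𝕜 (lt_add_of_pos_right ‖y‖ hδ)
    have h : ‖Completion.mk 𝕜 E (v + w)‖ ≤
        C * ((‖x‖ + ε / (2 * C)) + (‖y‖ + ε / (2 * C))) := by
      refine norm_mk_le 𝕜 fun n => (hC (v.1 n) (w.1 n)).trans ?_
      have h1 := hvb n
      have h2 := hwb n
      gcongr
    rw [map_add, hv, hw] at h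
    refine h.trans (le_of_eq ?_)
    field_simp
    ring

/-- The canonical map of a quasinormed space into its completion. -/
def Completion.of (E : Type u) [AddCommGroup E] [Module 𝕜 E] [Norm E] [QuasinormedSpace 𝕜 E] :
    E →ₗ[𝕜] Completion 𝕜 E where
  toFun e := Completion.mk 𝕜 E ⟨fun _ => e, fun ε hε =>
    ⟨0, fun m _ n _ => by simpa [qnorm_zero 𝕜] using hε⟩⟩
  map_add' x y := by rw [← map_add]; rfl
  map_smul' c x := by rw [RingHom.id_apply, ← map_smul]; rfl

theorem norm_of_le (e : E) : ‖Completion.of 𝕜 E e‖ ≤ ‖e‖ :=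
  norm_mk_le 𝕜 fun _ => le_rfl

theorem le_norm_of {C : ℝ} (hC1 : 1 ≤ C) (hC : ∀ x y : E, ‖x + y‖ ≤ C * (‖x‖ + ‖y‖)) (e : E) :
    ‖e‖ ≤ 2 * C * ‖Completion.of 𝕜 E e‖ := by
  refine le_of_forall_pos_le_add fun ε hε => ?_
  have hδ : 0 < ε / (2 * C) := by positivity
  obtain ⟨n, hn⟩ := (eventually_le_of_norm_mk_lt 𝕜 hC1 hC
    (lt_add_of_pos_right ‖Completion.of 𝕜 E e‖ hδ)).exists
  refine le_trans hn (le_of_eq ?_)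
  field_simp

instance (E : Type u) [AddCommGroup E] [Module 𝕜 E] [Norm E] [QuasinormedSpace 𝕜 E] :
    QuasiBanachSpace 𝕜 (Completion 𝕜 E) where
  complete z hz := by
    obtain ⟨C, hC1, hC⟩ := exists_modulus 𝕜 E
    obtain ⟨D, hD1, hD⟩ := exists_modulus 𝕜 (Completion 𝕜 E)
    have key : ∀ k : ℕ, ∃ e : E, ‖z k - Completion.of 𝕜 E e‖ ≤ 1 / ((k : ℝ) + 1) := by
      intro k
      obtain ⟨v, hv⟩ := mk_surj 𝕜 (z k)
      obtain ⟨N, hN⟩ := v.2 (1 / ((k : ℝ) + 1)) (by positivity)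
      refine ⟨v.1 N, ?_⟩
      rw [← hv]
      change ‖Completion.mk 𝕜 E v - Completion.mk 𝕜 E _‖ ≤ _
      rw [← map_sub]
      refine norm_mk_le_of_eventually 𝕜 ?_
      filter_upwards [eventually_ge_atTop N] with n hn
      exact (hN n hn N le_rfl).le
    choose e he using key
    have hsmall : ∀ ε : ℝ, 0 < ε → ∃ N : ℕ, ∀ n ≥ N, 1 / ((n : ℝ) + 1) < ε := by
      intro ε hε
      exact eventually_atTop.1 (tendsto_one_div_add_atTop_nhds_zero_nat.eventually (gt_mem_nhds hε))
    have hc : IsCauchy e := by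
      intro ε hε
      have hδ : 0 < ε / (8 * C * D * D) := by positivity
      obtain ⟨N, hN⟩ := hz _ hδ
      obtain ⟨M, hM⟩ := hsmall _ hδ
      refine ⟨max N M, fun m hm n hn => ?_⟩
      have h1 := hN m (le_trans (le_max_left _ _) hm) n (le_trans (le_max_left _ _) hn)
      have h2 := (he m).trans_lt (hM m (le_trans (le_max_right _ _) hm))
      have h3 := (he n).trans_lt (hM n (le_trans (le_max_right _ _) hn))
      set δ := ε / (8 * C * D * D) with hδd
      have h4 : Completion.of 𝕜 E (e m - e n) = (z m - z n) +
          ((z n - Completion.of 𝕜 E (e n)) - (z m - Completion.of 𝕜 E (e m))) := by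
        rw [map_sub]; abel
      have h5 := qnorm_sub_le 𝕜 hD (z n - Completion.of 𝕜 E (e n)) (z m - Completion.of 𝕜 E (e m))
      have h6 := hD (z m - z n)
        ((z n - Completion.of 𝕜 E (e n)) - (z m - Completion.of 𝕜 E (e m)))
      rw [← h4] at h6
      have h7 := le_norm_of 𝕜 hC1 hC (e m - e n)
      calc ‖e m - e n‖ ≤ 2 * C * ‖Completion.of 𝕜 E (e m - e n)‖ := h7
        _ ≤ 2 * C * (D * (δ + D * (δ + δ))) := by
          refine mul_le_mul_of_nonneg_left (h6.trans ?_) (by positivity)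
          refine mul_le_mul_of_nonneg_left (add_le_add h1.le (h5.trans ?_)) (by positivity)
          exact mul_le_mul_of_nonneg_left (add_le_add h3.le h2.le) (by positivity)
        _ ≤ 2 * C * (D * (D * δ + D * (δ + δ))) := by
          gcongr
          nlinarith
        _ = 3 / 4 * ε := by rw [hδd]; field_simp; ring
        _ < ε := by linarith
    refine ⟨Completion.mk 𝕜 E ⟨e, hc⟩, ?_⟩
    rw [ConvergesTo, Metric.tendsto_atTop]
    intro ε hε
    have hδ : 0 < ε / (4 * D) := by positivity
    obtain ⟨N, hN⟩ := hc _ hδ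
    obtain ⟨M, hM⟩ := hsmall _ hδ
    refine ⟨max N M, fun n hn => ?_⟩
    rw [Real.dist_eq, sub_zero, abs_of_nonneg (qnorm_nonneg 𝕜 _)]
    have h1 := (he n).trans_lt (hM n (le_trans (le_max_right _ _) hn))
    have h2 : ‖Completion.of 𝕜 E (e n) - Completion.mk 𝕜 E ⟨e, hc⟩‖ ≤ ε / (4 * D) := by
      change ‖Completion.mk 𝕜 E _ - Completion.mk 𝕜 E _‖ ≤ _
      rw [← map_sub]
      refine norm_mk_le_of_eventually 𝕜 ?_
      filter_upwards [eventually_ge_atTop N] with m hm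
      exact (hN n (le_trans (le_max_left _ _) hn) m hm).le
    have h3 := hD (z n - Completion.of 𝕜 E (e n))
      (Completion.of 𝕜 E (e n) - Completion.mk 𝕜 E ⟨e, hc⟩)
    rw [sub_add_sub_cancel] at h3
    calc _ ≤ _ := h3
      _ ≤ D * (ε / (4 * D) + ε / (4 * D)) := by gcongr
      _ = ε / 2 := by field_simp; norm_num
      _ < ε := by linarith

end Basic

section Extension

variable {𝕜 E F : Type u} [RCLike 𝕜] [AddCommGroup E] [Module 𝕜 E] [Norm E]
  [QuasinormedSpace 𝕜 E] [AddCommGroup F] [Module 𝕜 F] [Norm F] [QuasiBanachSpace 𝕜 F]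

theorem limit_unique (𝕜 : Type u) {F : Type u} [RCLike 𝕜] [AddCommGroup F] [Module 𝕜 F] [Norm F]
    [QuasiBanachSpace 𝕜 F] {v : ℕ → F} {x y : F} (hx : ConvergesTo v x) (hy : ConvergesTo v y) : x = y := by
  obtain ⟨C, hC1, hC⟩ := exists_modulus 𝕜 F
  have h : Tendsto (fun n => C * (‖v n - y‖ + ‖v n - x‖)) atTop (𝓝 (C * (0 + 0))) :=
    (Tendsto.add hy hx).const_mul C
  rw [add_zero, mul_zero] at h
  have h2 : ‖x - y‖ ≤ 0 := by
    refine ge_of_tendsto' h fun n => ?_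
    have := qnorm_sub_le 𝕜 hC (v n - y) (v n - x)
    rwa [sub_sub_sub_cancel_left] at this
  exact sub_eq_zero.1 (QuasinormedSpace.eq_zero (𝕜 := 𝕜) _
    (le_antisymm h2 (qnorm_nonneg 𝕜 _)))

theorem map_cauchy {𝕜 E F : Type u} [RCLike 𝕜] [AddCommGroup E] [Module 𝕜 E] [Norm E]
    [QuasinormedSpace 𝕜 E] [AddCommGroup F] [Module 𝕜 F] [Norm F] {T : E →ₗ[𝕜] F} (hT : IsBdd T) (v : cauchySeq 𝕜 E) :
    IsCauchy (fun n => T (v.1 n)) := by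
  obtain ⟨C, hC⟩ := hT
  intro ε hε
  obtain ⟨N, hN⟩ := v.2 (ε / (|C| + 1)) (by positivity)
  refine ⟨N, fun m hm n hn => ?_⟩
  have h0 := qnorm_nonneg 𝕜 (v.1 m - v.1 n)
  change ‖T (v.1 m) - T (v.1 n)‖ < ε
  rw [← map_sub]
  calc _ ≤ C * ‖v.1 m - v.1 n‖ := hC _
    _ ≤ (|C| + 1) * ‖v.1 m - v.1 n‖ := by
      gcongr
      linarith [le_abs_self C]
    _ < (|C| + 1) * (ε / (|C| + 1)) := by
      gcongr
      exact hN m hm n hn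
    _ = ε := by field_simp

/-- The linear map that sends a Cauchy sequence `v` to the limit of `T (v n)`. -/
def limMap (T : E →ₗ[𝕜] F) (hT : IsBdd T) : cauchySeq 𝕜 E →ₗ[𝕜] F where
  toFun v := (QuasiBanachSpace.complete (𝕜 := 𝕜) _ (map_cauchy hT v)).choose
  map_add' v w := by
    obtain ⟨C, hC1, hC⟩ := exists_modulus 𝕜 F
    have hv := (QuasiBanachSpace.complete (𝕜 := 𝕜) _ (map_cauchy hT v)).choose_spec
    have hw := (QuasiBanachSpace.complete (𝕜 := 𝕜) _ (map_cauchy hT w)).choose_spec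
    refine limit_unique 𝕜
      (QuasiBanachSpace.complete (𝕜 := 𝕜) _ (map_cauchy hT (v + w))).choose_spec ?_
    have h := (Tendsto.add hv hw).const_mul C
    rw [add_zero, mul_zero] at h
    refine squeeze_zero (fun n => qnorm_nonneg 𝕜 _) (fun n => ?_) h
    change ‖T (v.1 n + w.1 n) - _‖ ≤ _
    rw [map_add, add_sub_add_comm]
    exact hC _ _
  map_smul' c v := by
    have hv := (QuasiBanachSpace.complete (𝕜 := 𝕜) _ (map_cauchy hT v)).choose_spec
    refine limit_unique 𝕜
      (QuasiBanachSpace.complete (𝕜 := 𝕜) _ (map_cauchy hT (c • v))).choose_spec ?_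
    have h := Tendsto.const_mul ‖c‖ hv
    rw [mul_zero] at h
    refine h.congr fun n => ?_
    change _ = ‖T (c • v.1 n) - _‖
    rw [map_smul, RingHom.id_apply, ← smul_sub, qnorm_smul 𝕜]

theorem limMap_spec (T : E →ₗ[𝕜] F) (hT : IsBdd T) (v : cauchySeq 𝕜 E) :
    ConvergesTo (fun n => T (v.1 n)) (limMap T hT v) :=
  (QuasiBanachSpace.complete (𝕜 := 𝕜) _ (map_cauchy hT v)).choose_spec

/-- The extension of an operator with values in a quasi Banach space to the completion. -/
def Completion.extend (T : E →ₗ[𝕜] F) (hT : IsBdd T) : Completion 𝕜 E →ₗ[𝕜] F :=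
  (nullSeq 𝕜 E).liftQ (limMap T hT) (by
    intro v hv
    rw [LinearMap.mem_ker]
    refine limit_unique 𝕜 (limMap_spec T hT v) ?_
    obtain ⟨C, hC⟩ := hT
    have h := Tendsto.const_mul C hv
    rw [mul_zero] at h
    refine squeeze_zero (fun n => qnorm_nonneg 𝕜 _) (fun n => ?_) h
    rw [sub_zero]
    exact hC _)

theorem extend_mk (T : E →ₗ[𝕜] F) (hT : IsBdd T) (v : cauchySeq 𝕜 E) :
    Completion.extend T hT (Completion.mk 𝕜 E v) = limMap T hT v := rfl

theorem extend_of (T : E →ₗ[𝕜] F) (hT : IsBdd T) (e : E) :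
    Completion.extend T hT (Completion.of 𝕜 E e) = T e := by
  refine limit_unique 𝕜 (limMap_spec T hT _) ?_
  simp [ConvergesTo, qnorm_zero 𝕜]

theorem extend_bdd (T : E →ₗ[𝕜] F) (hT : IsBdd T) : IsBdd (Completion.extend T hT) := by
  obtain ⟨D, hD1, hD⟩ := exists_modulus 𝕜 F
  obtain ⟨C, hC⟩ := id hT
  refine ⟨D * (|C| + 1), fun z => le_of_forall_pos_le_add fun ε hε => ?_⟩
  have hδ : 0 < ε / (D * (|C| + 1)) := by positivity
  obtain ⟨v, hv, hb⟩ := exists_rep 𝕜 (lt_add_of_pos_right ‖z‖ hδ)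
  set r := ‖z‖ + ε / (D * (|C| + 1)) with hr
  have h : Tendsto (fun n => D * (‖T (v.1 n) - limMap T hT v‖ + (|C| + 1) * r)) atTop
      (𝓝 (D * (0 + (|C| + 1) * r))) := ((limMap_spec T hT v).add_const _).const_mul D
  have h2 : ‖limMap T hT v‖ ≤ D * (0 + (|C| + 1) * r) := by
    refine ge_of_tendsto' h fun n => ?_
    have h3 := qnorm_sub_le 𝕜 hD (T (v.1 n)) (T (v.1 n) - limMap T hT v)
    rw [sub_sub_cancel, add_comm] at h3
    refine h3.trans ?_
    gcongr
    have h0 := qnorm_nonneg 𝕜 (v.1 n)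
    calc _ ≤ C * ‖v.1 n‖ := hC _
      _ ≤ (|C| + 1) * r := by
        have := hb n
        gcongr
        linarith [le_abs_self C]
  rw [← hv, extend_mk, hv]
  refine h2.trans (le_of_eq ?_)
  rw [hr]
  field_simp
  ring

end Extension

/-! ## Quasilinear maps and the sequences they induce -/

/-- A quasilinear map `Φ : X₀ → Y`, where `X₀` is a linear subspace of `X`. -/
structure QuasilinearMap {𝕜 X : Type u} [RCLike 𝕜] [AddCommGroup X] [Module 𝕜 X] [Norm X]
    (X₀ : Submodule 𝕜 X) (Y : Type u) [AddCommGroup Y] [Module 𝕜 Y] [Norm Y] where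
  toFun : X₀ → Y
  map_smul : ∀ (c : 𝕜) (x : X₀), toFun (c • x) = c • toFun x
  quasi : ∃ Q : ℝ, ∀ x y : X₀,
    ‖toFun (x + y) - toFun x - toFun y‖ ≤ Q * (‖(x : X)‖ + ‖(y : X)‖)

/-- Density of a linear subspace in a quasinormed space. -/
def IsDenseSubspace {𝕜 X : Type u} [RCLike 𝕜] [AddCommGroup X] [Module 𝕜 X] [Norm X]
    (X₀ : Submodule 𝕜 X) : Prop :=
  ∀ x : X, ∀ ε : ℝ, 0 < ε → ∃ x₀ ∈ X₀, ‖x - x₀‖ < ε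

section Twisted

variable {𝕜 X Y : Type u} [RCLike 𝕜] [AddCommGroup X] [Module 𝕜 X] [Norm X]
  [AddCommGroup Y] [Module 𝕜 Y] [Norm Y] {X₀ : Submodule 𝕜 X}

/-- The linear space `Y × X₀`, to be endowed with the quasinorm `‖y - Φ x‖ + ‖x‖`. -/
def Twist (_Φ : QuasilinearMap X₀ Y) : Type u := Y × X₀

instance (Φ : QuasilinearMap X₀ Y) : AddCommGroup (Twist Φ) :=
  inferInstanceAs (AddCommGroup (Y × X₀))

instance (Φ : QuasilinearMap X₀ Y) : Module 𝕜 (Twist Φ) :=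
  inferInstanceAs (Module 𝕜 (Y × X₀))

instance (Φ : QuasilinearMap X₀ Y) : Norm (Twist Φ) where
  norm z := ‖z.1 - Φ.toFun z.2‖ + ‖(z.2 : X)‖

theorem norm_twist (Φ : QuasilinearMap X₀ Y) (z : Twist Φ) :
    ‖z‖ = ‖z.1 - Φ.toFun z.2‖ + ‖(z.2 : X)‖ := rfl

/-- The inclusion `y ↦ (y, 0)`. -/
def Twist.incl (Φ : QuasilinearMap X₀ Y) : Y →ₗ[𝕜] Twist Φ := LinearMap.inl 𝕜 Y X₀

/-- The projection `(y, x) ↦ x`. -/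
def Twist.proj (Φ : QuasilinearMap X₀ Y) : Twist Φ →ₗ[𝕜] X :=
  X₀.subtype ∘ₗ LinearMap.snd 𝕜 Y X₀

/-- The nonlinear lifting `x ↦ (Φ x, x)`. -/
def Twist.lift (Φ : QuasilinearMap X₀ Y) (x : X₀) : Twist Φ := (Φ.toFun x, x)

theorem proj_lift (Φ : QuasilinearMap X₀ Y) (x : X₀) :
    Twist.proj Φ (Twist.lift Φ x) = (x : X) := rfl

theorem QuasilinearMap.map_zero (Φ : QuasilinearMap X₀ Y) : Φ.toFun 0 = 0 := by
  have := Φ.map_smul 0 0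
  simpa using this

variable [QuasinormedSpace 𝕜 X] [QuasinormedSpace 𝕜 Y]

instance (Φ : QuasilinearMap X₀ Y) : QuasinormedSpace 𝕜 (Twist Φ) where
  nonneg z := add_nonneg (qnorm_nonneg 𝕜 _) (qnorm_nonneg 𝕜 _)
  smul c z := by
    have h1 : (c • z).1 = c • z.1 := rfl
    have h2 : (c • z).2 = c • z.2 := rfl
    rw [norm_twist, norm_twist, h1, h2, Φ.map_smul, ← smul_sub, Submodule.coe_smul,
      qnorm_smul 𝕜, qnorm_smul 𝕜, mul_add]
  eq_zero z hz := by
    rw [norm_twist] at hz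
    have h1 := qnorm_nonneg 𝕜 (z.1 - Φ.toFun z.2)
    have h2 := qnorm_nonneg 𝕜 (z.2 : X)
    have h3 : z.2 = 0 := Subtype.ext (QuasinormedSpace.eq_zero (𝕜 := 𝕜) _ (by linarith))
    have h4 := QuasinormedSpace.eq_zero (𝕜 := 𝕜) (z.1 - Φ.toFun z.2) (by linarith)
    rw [h3, Φ.map_zero, sub_zero] at h4
    exact Prod.ext h4 h3
  add_le := by
    obtain ⟨C, hC1, hC⟩ := exists_modulus 𝕜 X
    obtain ⟨D, hD1, hD⟩ := exists_modulus 𝕜 Y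
    obtain ⟨Q, hQ⟩ := Φ.quasi
    refine ⟨D * D + D * |Q| + C, fun z w => ?_⟩
    rw [norm_twist, norm_twist, norm_twist]
    have h1 : (z + w).1 = z.1 + w.1 := rfl
    have h2 : (z + w).2 = z.2 + w.2 := rfl
    have e : z.1 + w.1 - Φ.toFun (z.2 + w.2) = ((z.1 - Φ.toFun z.2) + (w.1 - Φ.toFun w.2)) -
      (Φ.toFun (z.2 + w.2) - Φ.toFun z.2 - Φ.toFun w.2) := by abel
    rw [h1, h2, e, Submodule.coe_add]
    have h3 := qnorm_sub_le 𝕜 hD ((z.1 - Φ.toFun z.2) + (w.1 - Φ.toFun w.2))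
      (Φ.toFun (z.2 + w.2) - Φ.toFun z.2 - Φ.toFun w.2)
    have h4 := hD (z.1 - Φ.toFun z.2) (w.1 - Φ.toFun w.2)
    have h5 := hQ z.2 w.2
    have h6 := hC (z.2 : X) (w.2 : X)
    have p1 := qnorm_nonneg 𝕜 (z.1 - Φ.toFun z.2)
    have p2 := qnorm_nonneg 𝕜 (w.1 - Φ.toFun w.2)
    have p3 := qnorm_nonneg 𝕜 (z.2 : X)
    have p4 := qnorm_nonneg 𝕜 (w.2 : X)
    set a := ‖z.1 - Φ.toFun z.2‖
    set b := ‖w.1 - Φ.toFun w.2‖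
    set c := ‖(z.2 : X)‖
    set d := ‖(w.2 : X)‖
    have h7 : Q * (c + d) ≤ |Q| * (c + d) :=
      mul_le_mul_of_nonneg_right (le_abs_self Q) (by positivity)
    calc _ ≤ D * (D * (a + b) + |Q| * (c + d)) + C * (c + d) := by
          refine add_le_add (h3.trans ?_) h6
          exact mul_le_mul_of_nonneg_left (add_le_add h4 (h5.trans h7)) (by positivity)
      _ ≤ (D * D + D * |Q| + C) * (a + c + (b + d)) := by
          have : 0 ≤ D * D * (c + d) + (D * |Q| + C) * (a + b) := by positivity
          nlinarith

theorem norm_lift (Φ : QuasilinearMap X₀ Y) (x : X₀) : ‖Twist.lift Φ x‖ = ‖(x : X)‖ := by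
  rw [norm_twist]
  change ‖Φ.toFun x - Φ.toFun x‖ + ‖(x : X)‖ = _
  rw [sub_self, qnorm_zero 𝕜, zero_add]

theorem norm_incl (Φ : QuasilinearMap X₀ Y) (y : Y) : ‖Twist.incl Φ y‖ = ‖y‖ := by
  rw [norm_twist]
  change ‖y - Φ.toFun 0‖ + ‖((0 : X₀) : X)‖ = _
  rw [Φ.map_zero, sub_zero, Submodule.coe_zero, qnorm_zero 𝕜, add_zero]

theorem proj_bdd (Φ : QuasilinearMap X₀ Y) : IsBdd (Twist.proj Φ) :=
  ⟨1, fun z => by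
    rw [one_mul, norm_twist]
    exact le_add_of_nonneg_left (qnorm_nonneg 𝕜 _)⟩

end Twisted

section Induced

variable {𝕜 X Y : Type u} [RCLike 𝕜] [AddCommGroup X] [Module 𝕜 X] [Norm X]
  [AddCommGroup Y] [Module 𝕜 Y] [Norm Y] [QuasiBanachSpace 𝕜 X] [QuasiBanachSpace 𝕜 Y]
  {X₀ : Submodule 𝕜 X}

/-- `Z(Φ)`, the completion of `Y ⊕_Φ X₀`. -/
abbrev ZSpace (Φ : QuasilinearMap X₀ Y) : Type u := Completion 𝕜 (Twist Φ)

/-- The arrow `ι : Y → Z(Φ)` of the induced sequence. -/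
def ZSpace.incl (Φ : QuasilinearMap X₀ Y) : Y →ₗ[𝕜] ZSpace Φ :=
  Completion.of 𝕜 (Twist Φ) ∘ₗ Twist.incl Φ

/-- The arrow `π : Z(Φ) → X` of the induced sequence. -/
def ZSpace.proj (Φ : QuasilinearMap X₀ Y) : ZSpace Φ →ₗ[𝕜] X :=
  Completion.extend (Twist.proj Φ) (proj_bdd Φ)

theorem ZSpace.incl_bdd (Φ : QuasilinearMap X₀ Y) : IsBdd (ZSpace.incl Φ) :=
  ⟨1, fun y => by
    rw [one_mul, ← norm_incl Φ y]
    exact norm_of_le 𝕜 _⟩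

theorem ZSpace.proj_bdd (Φ : QuasilinearMap X₀ Y) : IsBdd (ZSpace.proj Φ) :=
  extend_bdd _ _

theorem ZSpace.incl_injective (Φ : QuasilinearMap X₀ Y) :
    Function.Injective (ZSpace.incl Φ) := by
  rw [injective_iff_map_eq_zero]
  intro y hy
  obtain ⟨C, hC1, hC⟩ := exists_modulus 𝕜 (Twist Φ)
  have h := le_norm_of 𝕜 hC1 hC (Twist.incl Φ y)
  have h2 : Completion.of 𝕜 (Twist Φ) (Twist.incl Φ y) = 0 := hy
  rw [h2, qnorm_zero 𝕜, mul_zero, norm_incl] at h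
  exact QuasinormedSpace.eq_zero (𝕜 := 𝕜) _ (le_antisymm h (qnorm_nonneg 𝕜 _))

theorem ZSpace.exact (Φ : QuasilinearMap X₀ Y) :
    Function.Exact (ZSpace.incl Φ) (ZSpace.proj Φ) := by
  intro z
  constructor
  · intro hz
    obtain ⟨v, rfl⟩ := mk_surj 𝕜 z
    obtain ⟨C, hC1, hC⟩ := exists_modulus 𝕜 (Twist Φ)
    have hx : Tendsto (fun n => ‖((v.1 n).2 : X)‖) atTop (𝓝 0) := by
      have h := limMap_spec (Twist.proj Φ) (TwistedSum.proj_bdd Φ) v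
      have hz' : limMap (Twist.proj Φ) (TwistedSum.proj_bdd Φ) v = 0 := hz
      rw [hz'] at h
      refine Tendsto.congr (fun n => ?_) h
      rw [sub_zero]
      rfl
    let s : ℕ → Twist Φ := fun n => Twist.lift Φ (v.1 n).2
    have hs : Tendsto (fun n => ‖s n‖) atTop (𝓝 0) := by
      refine Tendsto.congr (fun n => ?_) hx
      exact (norm_lift Φ _).symm
    let y : ℕ → Y := fun n => (v.1 n).1 - Φ.toFun (v.1 n).2
    have hvs : ∀ n, v.1 n = Twist.incl Φ (y n) + s n := fun n =>
      Prod.ext (sub_add_cancel _ _).symm (zero_add _).symm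
    have hsc : s ∈ cauchySeq 𝕜 (Twist Φ) := by
      intro ε hε
      have hδ : 0 < ε / (2 * C) := by positivity
      obtain ⟨N, hN⟩ := eventually_atTop.1 (hs.eventually (gt_mem_nhds hδ))
      refine ⟨N, fun m hm n hn => ?_⟩
      calc _ ≤ C * (‖s m‖ + ‖s n‖) := qnorm_sub_le 𝕜 hC _ _
        _ < C * (ε / (2 * C) + ε / (2 * C)) := by
          gcongr
          exacts [hN m hm, hN n hn]
        _ = ε := by field_simp; norm_num
    have hyc : IsCauchy y := by
      intro ε hε
      obtain ⟨N, hN⟩ := ((cauchySeq 𝕜 (Twist Φ)).sub_mem v.2 hsc) ε hε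
      refine ⟨N, fun m hm n hn => ?_⟩
      have h := hN m hm n hn
      have e : (v.1 - s) m - (v.1 - s) n = Twist.incl Φ (y m - y n) := by
        rw [Pi.sub_apply, Pi.sub_apply, hvs m, hvs n, map_sub (Twist.incl Φ) (y m) (y n),
          add_sub_cancel_right,
          add_sub_cancel_right]
      rwa [e, norm_incl] at h
    obtain ⟨y₀, hy₀⟩ := QuasiBanachSpace.complete (𝕜 := 𝕜) y hyc
    refine ⟨y₀, ?_⟩
    change Completion.mk 𝕜 (Twist Φ) _ = _
    rw [mk_eq_iff]
    have h := (Tendsto.add hy₀ hs).const_mul C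
    rw [add_zero, mul_zero] at h
    refine squeeze_zero (fun n => qnorm_nonneg 𝕜 _) (fun n => ?_) h
    rw [qnorm_sub_comm 𝕜]
    have e : v.1 n - Twist.incl Φ y₀ = Twist.incl Φ (y n - y₀) + s n := by
      rw [hvs n, map_sub (Twist.incl Φ) (y n) y₀, add_sub_right_comm]
    rw [← norm_incl Φ (y n - y₀)]
    change ‖v.1 n - Twist.incl Φ y₀‖ ≤ _
    rw [e]
    exact hC _ _
  · rintro ⟨y, rfl⟩
    exact (extend_of _ _ _).trans rfl

theorem ZSpace.proj_surjective (Φ : QuasilinearMap X₀ Y) (hX : IsDenseSubspace X₀) :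
    Function.Surjective (ZSpace.proj Φ) := by
  intro x
  obtain ⟨C, hC1, hC⟩ := exists_modulus 𝕜 X
  obtain ⟨D, hD1, hD⟩ := exists_modulus 𝕜 (Twist Φ)
  have hpos : ∀ n : ℕ, 0 < ((2 * D) ^ (n + 1))⁻¹ / (2 * C) := fun n => by positivity
  choose a ha hax using fun n : ℕ => hX x _ (hpos n)
  let w : ℕ → Twist Φ := fun n => ∑ k ∈ Finset.range n,
    Twist.lift Φ ⟨a (k + 1) - a k, X₀.sub_mem (ha _) (ha _)⟩
  let b : Twist Φ := Twist.lift Φ ⟨a 0, ha 0⟩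
  have hstep : ∀ n, ‖w (n + 1) - w n‖ ≤ ((2 * D) ^ (n + 1))⁻¹ := by
    intro n
    have e : w (n + 1) - w n =
        Twist.lift Φ ⟨a (n + 1) - a n, X₀.sub_mem (ha _) (ha _)⟩ := by
      simp only [w, Finset.sum_range_succ, add_sub_cancel_left]
    rw [e, norm_lift, Subtype.coe_mk]
    have e2 : a (n + 1) - a n = (x - a n) - (x - a (n + 1)) := by abel
    rw [e2]
    have h1 := (hax (n + 1)).le
    have h2 := (hax n).le
    have h3 : ((2 * D) ^ (n + 1 + 1))⁻¹ / (2 * C) ≤ ((2 * D) ^ (n + 1))⁻¹ / (2 * C) := by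
      gcongr
      · linarith
      · omega
    calc _ ≤ C * (‖x - a n‖ + ‖x - a (n + 1)‖) := qnorm_sub_le 𝕜 hC _ _
      _ ≤ C * (((2 * D) ^ (n + 1))⁻¹ / (2 * C) + ((2 * D) ^ (n + 1))⁻¹ / (2 * C)) := by
        gcongr
        exact h1.trans h3
      _ = _ := by field_simp; norm_num
  have hsum : ∀ k m, ‖w (m + k) - w m‖ ≤ ((2 * D) ^ m)⁻¹ := by
    intro k
    induction k with
    | zero =>
      intro m
      rw [add_zero, sub_self, qnorm_zero 𝕜]
      positivity
    | succ k ih =>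
      intro m
      have h1 := ih (m + 1)
      have h2 := hD (w (m + 1 + k) - w (m + 1)) (w (m + 1) - w m)
      rw [sub_add_sub_cancel] at h2
      have e : m + (k + 1) = m + 1 + k := by omega
      rw [e]
      calc _ ≤ _ := h2
        _ ≤ D * (((2 * D) ^ (m + 1))⁻¹ + ((2 * D) ^ (m + 1))⁻¹) := by
          gcongr
          exact hstep m
        _ = _ := by rw [pow_succ]; field_simp; norm_num
  have hlim : Tendsto (fun m : ℕ => ((2 * D) ^ m)⁻¹) atTop (𝓝 0) := by
    have : ∀ m : ℕ, ((2 * D) ^ m)⁻¹ = ((2 * D)⁻¹) ^ m := fun m => (inv_pow _ _).symm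
    simp_rw [this]
    refine tendsto_pow_atTop_nhds_zero_of_lt_one (by positivity) ?_
    exact inv_lt_one_of_one_lt₀ (by linarith)
  have hc : (fun n => b + w n) ∈ cauchySeq 𝕜 (Twist Φ) := by
    intro ε hε
    obtain ⟨N, hN⟩ := (hlim.eventually (gt_mem_nhds hε)).exists_forall_of_atTop
    refine ⟨N, ?_⟩
    have main : ∀ m ≥ N, ∀ n ≥ m, ‖(b + w n) - (b + w m)‖ < ε := by
      intro m hm n hn
      obtain ⟨k, rfl⟩ := Nat.exists_eq_add_of_le hn
      rw [add_sub_add_left_eq_sub]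
      exact (hsum k m).trans_lt (hN m hm)
    intro m hm n hn
    rcases le_total m n with h | h
    · rw [qnorm_sub_comm 𝕜]
      exact main m hm n h
    · exact main n hn m h
  refine ⟨Completion.mk 𝕜 (Twist Φ) ⟨_, hc⟩, ?_⟩
  refine limit_unique 𝕜 (limMap_spec (Twist.proj Φ) (TwistedSum.proj_bdd Φ) ⟨_, hc⟩) ?_
  have hproj : ∀ n, Twist.proj Φ (b + w n) = a n := by
    intro n
    simp only [w, b, map_add, map_sum, proj_lift]
    change a 0 + ∑ k ∈ Finset.range n, (a (k + 1) - a k) = a n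
    rw [Finset.sum_range_sub, add_sub_cancel]
  have h0 : Tendsto (fun m : ℕ => ((2 * D) ^ m)⁻¹) atTop (𝓝 0) := hlim
  refine squeeze_zero (fun n => qnorm_nonneg 𝕜 _) (fun n => ?_) h0
  change ‖Twist.proj Φ (b + w n) - x‖ ≤ _
  rw [hproj, qnorm_sub_comm 𝕜]
  refine (hax n).le.trans ?_
  rw [pow_succ, div_le_iff₀ (by positivity), mul_inv]
  have hp : 0 < ((2 * D) ^ n)⁻¹ := by positivity
  have hq : (2 * D)⁻¹ ≤ 1 := inv_le_one_of_one_le₀ (by linarith)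
  nlinarith [mul_le_mul_of_nonneg_left hq hp.le]

end Induced

/-! ## Four-term exact sequences and `Ext²` -/

/-- A four-term exact sequence `0 → Y → E₁ → E₂ → X → 0` of quasi Banach spaces and operators. -/
structure FourTerm (𝕜 X Y : Type u) [RCLike 𝕜] [AddCommGroup X] [Module 𝕜 X] [Norm X]
    [AddCommGroup Y] [Module 𝕜 Y] [Norm Y] where
  E₁ : Type u
  E₂ : Type u
  [group₁ : AddCommGroup E₁]
  [module₁ : Module 𝕜 E₁]
  [norm₁ : Norm E₁]
  [quasiBanach₁ : QuasiBanachSpace 𝕜 E₁]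
  [group₂ : AddCommGroup E₂]
  [module₂ : Module 𝕜 E₂]
  [norm₂ : Norm E₂]
  [quasiBanach₂ : QuasiBanachSpace 𝕜 E₂]
  i : Y →ₗ[𝕜] E₁
  d : E₁ →ₗ[𝕜] E₂
  q : E₂ →ₗ[𝕜] X
  i_bdd : IsBdd i
  d_bdd : IsBdd d
  q_bdd : IsBdd q
  injective : Function.Injective i
  exact₁ : Function.Exact i d
  exact₂ : Function.Exact d q
  surjective : Function.Surjective q

attribute [instance] FourTerm.group₁ FourTerm.module₁ FourTerm.norm₁ FourTerm.quasiBanach₁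
  FourTerm.group₂ FourTerm.module₂ FourTerm.norm₂ FourTerm.quasiBanach₂

section Ext

variable {𝕜 X Y W : Type u} [RCLike 𝕜] [AddCommGroup X] [Module 𝕜 X] [Norm X]
  [AddCommGroup Y] [Module 𝕜 Y] [Norm Y] [AddCommGroup W] [Module 𝕜 W] [Norm W]

/-- There is a morphism of four-term sequences `S → T` that is the identity at both ends. -/
def FourTerm.Arrow (S T : FourTerm 𝕜 X Y) : Prop :=
  ∃ (u₁ : S.E₁ →ₗ[𝕜] T.E₁) (u₂ : S.E₂ →ₗ[𝕜] T.E₂), IsBdd u₁ ∧ IsBdd u₂ ∧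
    u₁ ∘ₗ S.i = T.i ∧ u₂ ∘ₗ S.d = T.d ∘ₗ u₁ ∧ T.q ∘ₗ u₂ = S.q

/-- Equivalence in `Ext²(X, Y)`: the equivalence relation generated by `FourTerm.Arrow`, that is,
existence of a finite zigzag of morphisms of four-term exact sequences. -/
def FourTerm.Equiv (S T : FourTerm 𝕜 X Y) : Prop := Relation.EqvGen FourTerm.Arrow S T

/-- The zero of `Ext²(X, Y)`: the sequence `0 → Y = Y → X = X → 0` with middle arrow `0`. -/
def FourTerm.zero (𝕜 X Y : Type u) [RCLike 𝕜] [AddCommGroup X] [Module 𝕜 X] [Norm X]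
    [AddCommGroup Y] [Module 𝕜 Y] [Norm Y] [QuasiBanachSpace 𝕜 X] [QuasiBanachSpace 𝕜 Y] :
    FourTerm 𝕜 X Y where
  E₁ := Y
  E₂ := X
  i := LinearMap.id
  d := 0
  q := LinearMap.id
  i_bdd := ⟨1, fun y => by simp⟩
  d_bdd := ⟨0, fun y => by simp [qnorm_zero 𝕜]⟩
  q_bdd := ⟨1, fun y => by simp⟩
  injective := Function.injective_id
  exact₁ := fun y => by simp
  exact₂ := fun x => by simp [eq_comm]
  surjective := Function.surjective_id

/-- The sequence is trivial in `Ext²(X, Y)`. -/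
def FourTerm.IsTrivial [QuasiBanachSpace 𝕜 X] [QuasiBanachSpace 𝕜 Y] (S : FourTerm 𝕜 X Y) : Prop :=
  S.Equiv (FourTerm.zero 𝕜 X Y)

/-- The additive inverse in `Ext²(X, Y)`, i.e. the product by the scalar `-1`: the push-out of the
sequence along `-id : Y → Y`. As `-id` is an isomorphism, this push-out is the same sequence with
the arrow `Y → E₁` replaced by its opposite. -/
def FourTerm.neg [QuasiBanachSpace 𝕜 Y] (S : FourTerm 𝕜 X Y) : FourTerm 𝕜 X Y where
  E₁ := S.E₁
  E₂ := S.E₂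
  i := -S.i
  d := S.d
  q := S.q
  i_bdd := by
    obtain ⟨C, hC⟩ := S.i_bdd
    exact ⟨C, fun y => by simpa [qnorm_neg 𝕜] using hC y⟩
  d_bdd := S.d_bdd
  q_bdd := S.q_bdd
  injective := fun a b h => S.injective (neg_injective h)
  exact₁ := fun z => by
    rw [S.exact₁ z]
    constructor
    · rintro ⟨y, rfl⟩
      exact ⟨-y, by simp⟩
    · rintro ⟨y, rfl⟩
      exact ⟨-y, by simp⟩
  exact₂ := S.exact₂
  surjective := S.surjective

theorem IsBdd.comp {𝕜 E F G : Type u} [RCLike 𝕜] [AddCommGroup E] [Module 𝕜 E] [Norm E]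
    [AddCommGroup F] [Module 𝕜 F] [Norm F] [AddCommGroup G] [Module 𝕜 G] [Norm G]
    [QuasinormedSpace 𝕜 F] {T : F →ₗ[𝕜] G} {S : E →ₗ[𝕜] F}
    (hT : IsBdd T) (hS : IsBdd S) : IsBdd (T ∘ₗ S) := by
  obtain ⟨C, hC⟩ := hT
  obtain ⟨D, hD⟩ := hS
  refine ⟨|C| * D, fun x => ?_⟩
  have h0 := qnorm_nonneg 𝕜 (S x)
  calc _ ≤ C * ‖S x‖ := hC _
    _ ≤ |C| * ‖S x‖ := by gcongr; exact le_abs_self C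
    _ ≤ |C| * (D * ‖x‖) := by gcongr; exact hD x
    _ = _ := by ring

/-- The concatenation `Φ Ψ` of quasilinear maps `Ψ : X₀ → W` and `Φ : W₀ → Y` defined on dense
subspaces `X₀ ⊆ X` and `W₀ ⊆ W`: the sequence `0 → Y → Z(Φ) → Z(Ψ) → X → 0` obtained by splicing
`0 → Y → Z(Φ) → W → 0` and `0 → W → Z(Ψ) → X → 0` through `W`. -/
def splice [QuasiBanachSpace 𝕜 X] [QuasiBanachSpace 𝕜 W] [QuasiBanachSpace 𝕜 Y]
    {X₀ : Submodule 𝕜 X} {W₀ : Submodule 𝕜 W} (hX : IsDenseSubspace X₀) (hW : IsDenseSubspace W₀)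
    (Φ : QuasilinearMap W₀ Y) (Ψ : QuasilinearMap X₀ W) : FourTerm 𝕜 X Y where
  E₁ := ZSpace Φ
  E₂ := ZSpace Ψ
  i := ZSpace.incl Φ
  d := ZSpace.incl Ψ ∘ₗ ZSpace.proj Φ
  q := ZSpace.proj Ψ
  i_bdd := ZSpace.incl_bdd Φ
  d_bdd := (ZSpace.incl_bdd Ψ).comp (ZSpace.proj_bdd Φ)
  q_bdd := ZSpace.proj_bdd Ψ
  injective := ZSpace.incl_injective Φ
  exact₁ := fun z => by
    rw [← ZSpace.exact Φ z, LinearMap.comp_apply]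
    exact map_eq_zero_iff _ (ZSpace.incl_injective Ψ)
  exact₂ := fun z => by
    rw [ZSpace.exact Ψ z, LinearMap.coe_comp, (ZSpace.proj_surjective Φ hW).range_comp]
  surjective := ZSpace.proj_surjective Ψ hX

end Ext

/-! ## The spaces `ℓ_p` for `0 < p < ∞` and their centralizers -/

/-- The space `ℓ_p` of sequences `ℕ → 𝕜`, with its usual (quasi)norm. -/
abbrev Ellp (𝕜 : Type u) [RCLike 𝕜] (p : ℝ≥0∞) : Type u := lp (fun _ : ℕ => 𝕜) p

section Ellp

variable {𝕜 : Type u} [RCLike 𝕜] {p : ℝ≥0∞}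

theorem toReal_pos (p : ℝ≥0∞) [h0 : Fact (0 < p)] [h1 : Fact (p < ∞)] : 0 < p.toReal :=
  ENNReal.toReal_pos h0.out.ne' h1.out.ne

theorem norm_le_of_pointwise [Fact (0 < p)] [Fact (p < ∞)] (x y z : Ellp 𝕜 p)
    (h : ∀ i, ‖z i‖ ≤ ‖x i‖ + ‖y i‖) :
    ‖z‖ ≤ 2 * 2 ^ (1 / p.toReal) * (‖x‖ + ‖y‖) := by
  have hp := toReal_pos p
  have hx := lp.norm_nonneg' x
  have hy := lp.norm_nonneg' y
  refine lp.norm_le_of_forall_sum_le hp (by positivity) fun s => ?_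
  have hpt : ∀ i, ‖z i‖ ^ p.toReal ≤
      2 ^ p.toReal * (‖x i‖ ^ p.toReal + ‖y i‖ ^ p.toReal) := by
    intro i
    have h1 : ‖z i‖ ≤ 2 * max ‖x i‖ ‖y i‖ := by
      have := le_max_left ‖x i‖ ‖y i‖
      have := le_max_right ‖x i‖ ‖y i‖
      linarith [h i]
    have hm : 0 ≤ max ‖x i‖ ‖y i‖ := le_max_of_le_left (norm_nonneg _)
    calc _ ≤ (2 * max ‖x i‖ ‖y i‖) ^ p.toReal := by gcongr
      _ = 2 ^ p.toReal * (max ‖x i‖ ‖y i‖) ^ p.toReal := Real.mul_rpow (by norm_num) hm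
      _ ≤ _ := by
        gcongr
        rcases max_choice ‖x i‖ ‖y i‖ with h | h <;> rw [h]
        · exact le_add_of_nonneg_right (by positivity)
        · exact le_add_of_nonneg_left (by positivity)
  have e : (2 * 2 ^ (1 / p.toReal) * (‖x‖ + ‖y‖)) ^ p.toReal =
      2 ^ p.toReal * (2 * (‖x‖ + ‖y‖) ^ p.toReal) := by
    rw [Real.mul_rpow (by positivity) (by positivity), Real.mul_rpow (by norm_num) (by positivity),
      ← Real.rpow_mul (by norm_num), one_div_mul_cancel hp.ne', Real.rpow_one, mul_assoc]
  rw [e]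
  calc _ ≤ ∑ i ∈ s, 2 ^ p.toReal * (‖x i‖ ^ p.toReal + ‖y i‖ ^ p.toReal) :=
        Finset.sum_le_sum fun i _ => hpt i
    _ = 2 ^ p.toReal * (∑ i ∈ s, ‖x i‖ ^ p.toReal + ∑ i ∈ s, ‖y i‖ ^ p.toReal) := by
        rw [← Finset.mul_sum, Finset.sum_add_distrib]
    _ ≤ 2 ^ p.toReal * (‖x‖ ^ p.toReal + ‖y‖ ^ p.toReal) := by
        gcongr
        · exact lp.sum_rpow_le_norm_rpow hp x s
        · exact lp.sum_rpow_le_norm_rpow hp y s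
    _ ≤ _ := by
        have h1 : ‖x‖ ^ p.toReal ≤ (‖x‖ + ‖y‖) ^ p.toReal := by gcongr; linarith
        have h2 : ‖y‖ ^ p.toReal ≤ (‖x‖ + ‖y‖) ^ p.toReal := by gcongr; linarith
        gcongr
        linarith

instance [h0 : Fact (0 < p)] [Fact (p < ∞)] : QuasinormedSpace 𝕜 (Ellp 𝕜 p) where
  nonneg := lp.norm_nonneg'
  smul _ x := lp.norm_const_smul h0.out.ne' x
  eq_zero _ := lp.norm_eq_zero_iff.1
  add_le := ⟨_, fun x y => norm_le_of_pointwise x y (x + y) fun _ => norm_add_le _ _⟩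

instance [h0 : Fact (0 < p)] [Fact (p < ∞)] : QuasiBanachSpace 𝕜 (Ellp 𝕜 p) where
  complete v hv := by
    have hp := toReal_pos p
    have hcoord : ∀ i, ∃ l : 𝕜, Tendsto (fun n => v n i) atTop (𝓝 l) := by
      intro i
      refine cauchySeq_tendsto_of_complete (Metric.cauchySeq_iff.2 fun ε hε => ?_)
      obtain ⟨N, hN⟩ := hv ε hε
      refine ⟨N, fun m hm n hn => ?_⟩
      rw [dist_eq_norm]
      exact (lp.norm_apply_le_norm h0.out.ne' (v m - v n) i).trans_lt (hN m hm n hn)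
    choose l hl using hcoord
    have hsum : ∀ ε : ℝ, 0 < ε → ∃ N, ∀ n ≥ N, ∀ s : Finset ℕ,
        ∑ i ∈ s, ‖v n i - l i‖ ^ p.toReal ≤ ε ^ p.toReal := by
      intro ε hε
      obtain ⟨N, hN⟩ := hv ε hε
      refine ⟨N, fun n hn s => ?_⟩
      have ht : Tendsto (fun m => ∑ i ∈ s, ‖v n i - v m i‖ ^ p.toReal) atTop
          (𝓝 (∑ i ∈ s, ‖v n i - l i‖ ^ p.toReal)) :=
        tendsto_finsetSum s fun i _ =>
          ((tendsto_const_nhds.sub (hl i)).norm).rpow_const (Or.inr hp.le)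
      refine le_of_tendsto ht ?_
      filter_upwards [eventually_ge_atTop N] with m hm
      refine (lp.sum_rpow_le_norm_rpow hp (v n - v m) s).trans ?_
      have := lp.norm_nonneg' (v n - v m)
      gcongr
      exact (hN n hn m hm).le
    have hmem : ∀ n, ∀ ε : ℝ, (∀ s : Finset ℕ,
        ∑ i ∈ s, ‖v n i - l i‖ ^ p.toReal ≤ ε ^ p.toReal) →
        Memℓp (fun i => v n i - l i) p := fun n ε h => memℓp_gen' h
    obtain ⟨N₁, hN₁⟩ := hsum 1 one_pos
    have hl_mem : Memℓp l p := by
      have h := (lp.memℓp (v N₁)).sub (hmem N₁ 1 (hN₁ N₁ le_rfl))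
      convert h using 1
      funext i
      simp
    refine ⟨⟨l, hl_mem⟩, ?_⟩
    rw [ConvergesTo, Metric.tendsto_atTop]
    intro ε hε
    obtain ⟨N, hN⟩ := hsum (ε / 2) (by positivity)
    refine ⟨N, fun n hn => ?_⟩
    rw [Real.dist_eq, sub_zero, abs_of_nonneg (lp.norm_nonneg' _)]
    have : ‖v n - (⟨l, hl_mem⟩ : Ellp 𝕜 p)‖ ≤ ε / 2 :=
      lp.norm_le_of_forall_sum_le hp (by positivity) (hN n hn)
    linarith

variable (𝕜 p) in
/-- The subspace `ℓ_p⁰` of finitely supported sequences of `ℓ_p`. -/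
def EllpFin : Submodule 𝕜 (Ellp 𝕜 p) where
  carrier := {x | (Function.support (fun i => x i)).Finite}
  zero_mem' := by simp [Function.support]
  add_mem' := fun {a b} ha hb => (ha.union hb).subset (Function.support_add _ _)
  smul_mem' := fun c x hx => hx.subset (Function.support_const_smul_subset c _)

theorem ellpFin_dense [Fact (0 < p)] [Fact (p < ∞)] : IsDenseSubspace (EllpFin 𝕜 p) := by
  intro x ε hε
  have hp := toReal_pos p
  have hs := (lp.memℓp x).summable hp
  have ht := tendsto_tsum_compl_atTop_zero (fun i => ‖x i‖ ^ p.toReal)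
  obtain ⟨s, hs'⟩ := (ht.eventually (gt_mem_nhds
    (show (0 : ℝ) < (ε / 2) ^ p.toReal by positivity))).exists
  have hfin : (Function.support (fun i => if i ∈ s then x i else 0)).Finite :=
    s.finite_toSet.subset fun i hi => by
      by_contra h
      exact hi (if_neg h)
  have hmem : Memℓp (fun i => if i ∈ s then x i else 0) p :=
    (memℓp_zero hfin).of_exponent_ge (zero_le)
  refine ⟨⟨_, hmem⟩, hfin, ?_⟩
  refine lt_of_le_of_lt (b := ε / 2) ?_ (by linarith)
  refine lp.norm_le_of_forall_sum_le hp (by positivity) fun t => ?_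
  have hpt : ∀ i, ‖x i - (if i ∈ s then x i else 0)‖ ^ p.toReal =
      ({i | i ∉ s} : Set ℕ).indicator (fun i => ‖x i‖ ^ p.toReal) i := by
    intro i
    by_cases h : i ∈ s
    · simp [h, Real.zero_rpow hp.ne']
    · simp [h]
  change ∑ i ∈ t, ‖x i - (if i ∈ s then x i else 0)‖ ^ p.toReal ≤ _
  simp_rw [hpt]
  have hts := tsum_subtype ({i | i ∉ s} : Set ℕ) (fun i => ‖x i‖ ^ p.toReal)
  replace hs' := hts.symm.trans_lt hs'
  refine ((hs.indicator _).sum_le_tsum t fun i _ => ?_).trans hs'.le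
  exact Set.indicator_nonneg (fun _ _ => by positivity) i

/-- The pointwise product `a x ∈ ℓ_p` of `a ∈ ℓ_∞` and `x ∈ ℓ_p`. -/
def ellMul (a : Ellp 𝕜 ∞) (x : Ellp 𝕜 p) : Ellp 𝕜 p :=
  ⟨fun i => a i * x i, (lp.memℓp a).bilin_of_top_left (q := p)
    (fun _ => ContinuousLinearMap.mul 𝕜 𝕜) (K := 1)
    (fun _ => ContinuousLinearMap.opNorm_mul_le 𝕜 𝕜) (lp.memℓp x)⟩

/-- The pointwise product `a x ∈ ℓ_p⁰` of `a ∈ ℓ_∞` and `x ∈ ℓ_p⁰`. -/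
def ellMulFin (a : Ellp 𝕜 ∞) (x : EllpFin 𝕜 p) : EllpFin 𝕜 p :=
  ⟨ellMul a x, x.2.subset fun _ hi h => hi (mul_eq_zero_of_right _ h)⟩

end Ellp

/-- A centralizer `Φ : ℓ_p⁰ → ℓ_p`. -/
structure Centralizer (𝕜 : Type u) [RCLike 𝕜] (p : ℝ≥0∞) where
  toFun : EllpFin 𝕜 p → Ellp 𝕜 p
  map_smul : ∀ (c : 𝕜) (x : EllpFin 𝕜 p), toFun (c • x) = c • toFun x
  estimate : ∃ C : ℝ, ∀ (a : Ellp 𝕜 ∞) (x : EllpFin 𝕜 p),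
    ‖toFun (ellMulFin a x) - ellMul a (toFun x)‖ ≤ C * ‖a‖ * ‖(x : Ellp 𝕜 p)‖

namespace Centralizer

variable {𝕜 : Type u} [RCLike 𝕜] {p : ℝ≥0∞} [Fact (0 < p)] [Fact (p < ∞)]

theorem ellMul_add (a : Ellp 𝕜 ∞) (x y : Ellp 𝕜 p) :
    ellMul a (x + y) = ellMul a x + ellMul a y :=
  lp.ext (funext fun i => mul_add (a i) (x i) (y i))

theorem ellMul_neg (a : Ellp 𝕜 ∞) (x : Ellp 𝕜 p) : ellMul a (-x) = -ellMul a x :=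
  lp.ext (funext fun i => mul_neg (a i) (x i))

theorem add_ellMul (a b : Ellp 𝕜 ∞) (x : Ellp 𝕜 p) :
    ellMul (a + b) x = ellMul a x + ellMul b x :=
  lp.ext (funext fun i => add_mul (a i) (b i) (x i))

/-- The pointwise sum of two centralizers. -/
instance : Add (Centralizer 𝕜 p) where
  add Φ Ψ :=
    { toFun := fun x => Φ.toFun x + Ψ.toFun x
      map_smul := fun c x => by rw [Φ.map_smul, Ψ.map_smul, smul_add]
      estimate := by
        obtain ⟨K, hK1, hK⟩ := exists_modulus 𝕜 (Ellp 𝕜 p)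
        obtain ⟨C, hC⟩ := Φ.estimate
        obtain ⟨D, hD⟩ := Ψ.estimate
        refine ⟨K * (C + D), fun a x => ?_⟩
        rw [ellMul_add, add_sub_add_comm]
        calc _ ≤ K * (‖Φ.toFun (ellMulFin a x) - ellMul a (Φ.toFun x)‖ +
              ‖Ψ.toFun (ellMulFin a x) - ellMul a (Ψ.toFun x)‖) := hK _ _
          _ ≤ K * (C * ‖a‖ * ‖(x : Ellp 𝕜 p)‖ + D * ‖a‖ * ‖(x : Ellp 𝕜 p)‖) := by
            gcongr
            exacts [hC a x, hD a x]
          _ = _ := by ring }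

/-- The pointwise opposite of a centralizer. -/
instance : Neg (Centralizer 𝕜 p) where
  neg Φ :=
    { toFun := fun x => -Φ.toFun x
      map_smul := fun c x => by rw [Φ.map_smul, smul_neg]
      estimate := by
        obtain ⟨C, hC⟩ := Φ.estimate
        refine ⟨C, fun a x => ?_⟩
        rw [ellMul_neg, ← neg_sub', qnorm_neg 𝕜]
        exact hC a x }

/-- The pointwise difference of two centralizers. -/
instance : Sub (Centralizer 𝕜 p) where
  sub Φ Ψ := Φ + -Ψ

theorem quasi (Φ : Centralizer 𝕜 p) : ∃ Q : ℝ, ∀ x y : EllpFin 𝕜 p,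
    ‖Φ.toFun (x + y) - Φ.toFun x - Φ.toFun y‖ ≤
      Q * (‖(x : Ellp 𝕜 p)‖ + ‖(y : Ellp 𝕜 p)‖) := by
  obtain ⟨K, hK1, hK⟩ := exists_modulus 𝕜 (Ellp 𝕜 p)
  obtain ⟨C, hC⟩ := Φ.estimate
  set M : ℝ := 2 * 2 ^ (1 / p.toReal) with hM
  refine ⟨K * (K * (|C| * 1 * M + |C| * 1 * M) + |C| * 1 * M), fun x y => ?_⟩
  have hfin : (Function.support (fun i =>
      (((‖(x : Ellp 𝕜 p) i‖ + ‖(y : Ellp 𝕜 p) i‖ : ℝ)) : 𝕜))).Finite := by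
    refine (x.2.union y.2).subset fun i hi => ?_
    by_contra h
    simp only [Set.mem_union, Function.mem_support, not_or, not_not] at h
    exact hi (by simp [h.1, h.2])
  have hz_mem : Memℓp (fun i => (((‖(x : Ellp 𝕜 p) i‖ + ‖(y : Ellp 𝕜 p) i‖ : ℝ)) : 𝕜)) p :=
    (memℓp_zero hfin).of_exponent_ge (zero_le)
  let z : EllpFin 𝕜 p := ⟨⟨_, hz_mem⟩, hfin⟩
  have hzi : ∀ i, (z : Ellp 𝕜 p) i =
      ((‖(x : Ellp 𝕜 p) i‖ + ‖(y : Ellp 𝕜 p) i‖ : ℝ) : 𝕜) := fun i => rfl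
  have hzn : ∀ i, ‖(z : Ellp 𝕜 p) i‖ = ‖(x : Ellp 𝕜 p) i‖ + ‖(y : Ellp 𝕜 p) i‖ := by
    intro i
    rw [hzi, RCLike.norm_ofReal, abs_of_nonneg (by positivity)]
  have hz : ‖(z : Ellp 𝕜 p)‖ ≤ M * (‖(x : Ellp 𝕜 p)‖ + ‖(y : Ellp 𝕜 p)‖) :=
    norm_le_of_pointwise _ _ _ fun i => (hzn i).le
  have key : ∀ w : EllpFin 𝕜 p,
      (∀ i, ‖(w : Ellp 𝕜 p) i‖ ≤ ‖(z : Ellp 𝕜 p) i‖) →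
      ∃ a : Ellp 𝕜 ∞, ellMulFin a z = w ∧ ‖a‖ ≤ 1 ∧
        ∀ i, a i = (w : Ellp 𝕜 p) i / (z : Ellp 𝕜 p) i := by
    intro w hw
    have hb : ∀ i, ‖(w : Ellp 𝕜 p) i / (z : Ellp 𝕜 p) i‖ ≤ 1 := fun i => by
      rw [norm_div]
      exact div_le_one_of_le₀ (hw i) (norm_nonneg _)
    refine ⟨⟨fun i => (w : Ellp 𝕜 p) i / (z : Ellp 𝕜 p) i,
      memℓp_infty ⟨1, by rintro _ ⟨i, rfl⟩; exact hb i⟩⟩, ?_, ?_, fun _ => rfl⟩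
    · refine Subtype.ext (lp.ext (funext fun i => ?_))
      change (w : Ellp 𝕜 p) i / (z : Ellp 𝕜 p) i * (z : Ellp 𝕜 p) i = (w : Ellp 𝕜 p) i
      rcases eq_or_ne ((z : Ellp 𝕜 p) i) 0 with h | h
      · have h1 := hw i
        rw [h, norm_zero] at h1
        rw [h, mul_zero, norm_le_zero_iff.1 h1]
      · exact div_mul_cancel₀ _ h
    · exact lp.norm_le_of_forall_le zero_le_one hb
  obtain ⟨a, ha, ha1, hai⟩ := key x fun i => by rw [hzn]; linarith [norm_nonneg ((y : Ellp 𝕜 p) i)]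
  obtain ⟨b, hb, hb1, hbi⟩ := key y fun i => by rw [hzn]; linarith [norm_nonneg ((x : Ellp 𝕜 p) i)]
  obtain ⟨c, hc, hc1, hci⟩ := key (x + y) fun i => by rw [hzn]; exact norm_add_le _ _
  have hcab : c = a + b := lp.ext (funext fun i => by
    change c i = a i + b i
    rw [hci, hai, hbi, ← add_div]
    rfl)
  have est : ∀ d : Ellp 𝕜 ∞, ‖d‖ ≤ 1 →
      ‖Φ.toFun (ellMulFin d z) - ellMul d (Φ.toFun z)‖ ≤
        |C| * 1 * M * (‖(x : Ellp 𝕜 p)‖ + ‖(y : Ellp 𝕜 p)‖) := by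
    intro d hd
    have h0 := lp.norm_nonneg' (z : Ellp 𝕜 p)
    have h1 := norm_nonneg d
    calc _ ≤ C * ‖d‖ * ‖(z : Ellp 𝕜 p)‖ := hC d z
      _ ≤ |C| * 1 * ‖(z : Ellp 𝕜 p)‖ := by
        gcongr
        exact le_abs_self C
      _ ≤ |C| * 1 * (M * (‖(x : Ellp 𝕜 p)‖ + ‖(y : Ellp 𝕜 p)‖)) := by gcongr
      _ = _ := by ring
  have e1 := est a ha1
  have e2 := est b hb1
  have e3 := est c hc1
  rw [ha] at e1
  rw [hb] at e2
  rw [hc, hcab, add_ellMul] at e3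
  have e : Φ.toFun (x + y) - Φ.toFun x - Φ.toFun y =
      ((Φ.toFun (x + y) - (ellMul a (Φ.toFun z) + ellMul b (Φ.toFun z))) -
        (Φ.toFun x - ellMul a (Φ.toFun z))) - (Φ.toFun y - ellMul b (Φ.toFun z)) := by abel
  rw [e]
  calc _ ≤ K * (‖(Φ.toFun (x + y) - (ellMul a (Φ.toFun z) + ellMul b (Φ.toFun z))) -
        (Φ.toFun x - ellMul a (Φ.toFun z))‖ + ‖Φ.toFun y - ellMul b (Φ.toFun z)‖) :=
        qnorm_sub_le 𝕜 hK _ _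
    _ ≤ K * (K * (|C| * 1 * M * (‖(x : Ellp 𝕜 p)‖ + ‖(y : Ellp 𝕜 p)‖) +
        |C| * 1 * M * (‖(x : Ellp 𝕜 p)‖ + ‖(y : Ellp 𝕜 p)‖)) +
        |C| * 1 * M * (‖(x : Ellp 𝕜 p)‖ + ‖(y : Ellp 𝕜 p)‖)) := by
      refine mul_le_mul_of_nonneg_left (add_le_add ?_ e2) (by linarith)
      exact (qnorm_sub_le 𝕜 hK _ _).trans
        (mul_le_mul_of_nonneg_left (add_le_add e3 e1) (by linarith))
    _ = _ := by ring

/-- Every centralizer on `ℓ_p` is quasilinear. -/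
def toQuasilinearMap (Φ : Centralizer 𝕜 p) : QuasilinearMap (EllpFin 𝕜 p) (Ellp 𝕜 p) where
  toFun := Φ.toFun
  map_smul := Φ.map_smul
  quasi := Φ.quasi

/-- The concatenation `Φ Ψ`: the four-term sequence `0 → ℓ_p → Z(Φ) → Z(Ψ) → ℓ_p → 0`. -/
def concat (Φ Ψ : Centralizer 𝕜 p) : FourTerm 𝕜 (Ellp 𝕜 p) (Ellp 𝕜 p) :=
  splice ellpFin_dense ellpFin_dense Φ.toQuasilinearMap Ψ.toQuasilinearMap

/-- `Φ` and `Ψ` commute: `Φ Ψ ∼ Ψ Φ` in `Ext²(ℓ_p, ℓ_p)`. -/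
def Commutes (Φ Ψ : Centralizer 𝕜 p) : Prop := (Φ.concat Ψ).Equiv (Ψ.concat Φ)

end Centralizer

end TwistedSum

/-! Write r for the real number p. The heart of the matter is that a centralizer becomes an ordinary
multiplication on sequences that are slightly better than ℓ_p. For every x in ℓ_p⁰ there is a scalar
sequence φ(x), with φ(cx) = φ(x) for c ≠ 0, such that ‖Φ(y) - yφ(x)‖^{2r} ≤ C ‖x‖^r ∑ |y_i|^{2r} /
|x_i|^r for every y supported where x is (`IsMultiplier`, `exists_isMultiplier`). In other words, a
centralizer from a weighted ℓ_{2p} into ℓ_p is at bounded distance from a multiplication.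

To find φ(x), consider the quotients Φ(h)/h with h^r = √(|x|^r G), G a positive weight. The
centralizer estimate compares the quotients of G and H when G ≤ H. The point is that all of them lie
near one common sequence (`exists_common_multiplier`). This follows from an estimate on average over
any finite family of weights (`averaging_estimate`, by random sampling), a minimax argument that
makes it uniform over the family, and compactness.

Granting multipliers, Φ(x) is close to xφ(x). Let z = |x| + |x'|. If |u| ≤ |z|, then φ(u) - φ(z) is
2p-integrable with respect to |u|^r (`IsMultiplier.sub_estimate`). Hence the defect of additivity of
x ↦ xψ(x) lies in the weighted ℓ_{2p} attached to z, where Φ acts as multiplication by φ(z); and a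
product of two differences of this kind costs only an error bounded in ℓ_p. So the obstruction
cocycle of Φ Ψ is explicit, namely φ(z) times the defect of x ↦ xψ(x), up to bounded error. Since
pointwise multiplication is commutative, adding the cocycle of Ψ Φ gives the coboundary of x ↦
xφ(x)ψ(x), up to bounded error.

The same computation handles any R C + R' C' for which the form γ(z)ρ(u) + γ'(z)ρ'(u) is symmetric
in u and z; this is `cocycle_estimate`. Algebraically, a cocycle of R C + R' C' that is a coboundary
up to bounded error means that (C, C') : X → W × W lifts to a quasilinear map into Z(R ⊕ R'). The
lift yields a four-term sequence mapping both to R C and to -R' C' (`splice_equiv_neg_splice`,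
`concat_equiv_neg_concat`).

Taking (Φ, Ψ) and (Ψ, Φ) gives (1). Taking (Φ + Ψ, Φ - Ψ) and (2Φ, Ψ) gives (Φ + Ψ)(Φ - Ψ) ∼ -(2Φ)Ψ,
hence (3), because nonzero scalars do not affect triviality. For (2), commuting means Ψ Φ ∼ -Ψ Φ,
and a Baer sum shows that a spliced sequence equivalent to its opposite is trivial
(`FourTerm.isTrivial_of_equiv_neg`). -/

namespace TwistedSum

/-! ## Finite sampling -/

section Sampling

variable {F : Type*} [Fintype F]

/-- Expectation of a function of `N` independent samples of a distribution with weights `μ`. -/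
def sampleMean (μ : F → ℝ) (N : ℕ) (f : (Fin N → F) → ℝ) : ℝ :=
  ∑ ω : Fin N → F, (∏ j, μ (ω j)) * f ω

theorem sampleMean_mono {μ : F → ℝ} (hμ : ∀ a, 0 ≤ μ a) {N : ℕ} {f g : (Fin N → F) → ℝ}
    (h : ∀ ω, f ω ≤ g ω) : sampleMean μ N f ≤ sampleMean μ N g :=
  Finset.sum_le_sum fun ω _ =>
    mul_le_mul_of_nonneg_left (h ω) (Finset.prod_nonneg fun _ _ => hμ _)

theorem sampleMean_add (μ : F → ℝ) {N : ℕ} (f g : (Fin N → F) → ℝ) :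
    sampleMean μ N (fun ω => f ω + g ω) = sampleMean μ N f + sampleMean μ N g := by
  simp only [sampleMean, mul_add, Finset.sum_add_distrib]

theorem sampleMean_mul_left (μ : F → ℝ) {N : ℕ} (c : ℝ) (f : (Fin N → F) → ℝ) :
    sampleMean μ N (fun ω => c * f ω) = c * sampleMean μ N f := by
  simp only [sampleMean, Finset.mul_sum]
  exact Finset.sum_congr rfl fun _ _ => by ring

theorem sampleMean_sum (μ : F → ℝ) {N : ℕ} {α : Type*} (s : Finset α)
    (f : α → (Fin N → F) → ℝ) :
    sampleMean μ N (fun ω => ∑ a ∈ s, f a ω) = ∑ a ∈ s, sampleMean μ N (f a) := by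
  simp only [sampleMean, Finset.mul_sum]
  exact Finset.sum_comm

theorem sampleMean_prod (μ : F → ℝ) {N : ℕ} (h : Fin N → F → ℝ) :
    sampleMean μ N (fun ω => ∏ j, h j (ω j)) = ∏ j, ∑ a, μ a * h j a := by
  rw [Finset.prod_univ_sum, Fintype.piFinset_univ]
  simp only [sampleMean, Finset.prod_mul_distrib]

theorem sampleMean_const {μ : F → ℝ} (hμ : ∑ a, μ a = 1) {N : ℕ} (c : ℝ) :
    sampleMean μ N (fun _ => c) = c := by
  have h := sampleMean_prod μ (N := N) (fun _ _ => 1)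
  simp only [Finset.prod_const_one, mul_one, hμ] at h
  have h2 := sampleMean_mul_left μ (N := N) c (fun _ => 1)
  rw [h] at h2
  simpa using h2

theorem sampleMean_le {μ : F → ℝ} (hμ : ∀ a, 0 ≤ μ a) (hμ1 : ∑ a, μ a = 1) {N : ℕ}
    {f : (Fin N → F) → ℝ} {c : ℝ} (h : ∀ ω, f ω ≤ c) : sampleMean μ N f ≤ c :=
  (sampleMean_mono hμ h).trans (sampleMean_const hμ1 c).le

theorem sampleMean_comp (μ : F → ℝ) {N : ℕ} (σ : Equiv.Perm (Fin N)) (f : (Fin N → F) → ℝ) :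
    sampleMean μ N (fun ω => f (ω ∘ σ)) = sampleMean μ N f := by
  unfold sampleMean
  refine Fintype.sum_equiv (σ.symm.arrowCongr (Equiv.refl F)) _ _ fun ω => ?_
  have : (σ.symm.arrowCongr (Equiv.refl F)) ω = ω ∘ σ := by
    ext; simp [Equiv.arrowCongr]
  rw [this]
  congr 1
  exact (Equiv.prod_comp σ fun j => μ (ω j)).symm

/-- The gain by exchangeability: the event that `0` is the only index below `n` whose sample
satisfies `c` accounts for at most a fraction `1 / n`. -/
theorem sampleMean_unique_le {μ : F → ℝ} (hμ : ∀ a, 0 ≤ μ a) {N : ℕ} [NeZero N] {n : ℕ}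
    (hn : 0 < n) (hnN : n ≤ N) (c : F → Prop) [DecidablePred c] {v : F → ℝ}
    {X V : (Fin N → F) → ℝ} (hX : ∀ ω, 0 ≤ X ω) (hV : ∀ ω, 0 ≤ V ω)
    (hXs : ∀ j : Fin N, (j : ℕ) < n → ∀ ω, X (ω ∘ Equiv.swap 0 j) = X ω)
    (hVv : ∀ ω, ∀ j : Fin N, (j : ℕ) < n → c (ω j) → v (ω j) ≤ V ω) :
    n * sampleMean μ N (fun ω => (if c (ω 0) ∧ ∀ j : Fin N, j ≠ 0 → (j : ℕ) < n → ¬ c (ω j)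
      then v (ω 0) else 0) * X ω) ≤ sampleMean μ N (fun ω => V ω * X ω) := by
  classical
  set U : Fin N → (Fin N → F) → ℝ := fun i ω =>
    if c (ω i) ∧ ∀ j : Fin N, j ≠ i → (j : ℕ) < n → ¬ c (ω j) then v (ω i) else 0 with hU
  set s : Finset (Fin N) := Finset.univ.filter fun j => (j : ℕ) < n with hs
  have hcard : s.card = n := by
    rw [hs, Fin.card_filter_val_lt, min_eq_right hnN]
  -- Exchangeability: transposing the samples 0 and i turns the event for 0 into the event for i and
  -- leaves X unchanged.
  have hswap : ∀ i ∈ s, sampleMean μ N (fun ω => U i ω * X ω) =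
      sampleMean μ N (fun ω => U 0 ω * X ω) := by
    intro i hi
    have hi' : (i : ℕ) < n := (Finset.mem_filter.1 hi).2
    rw [← sampleMean_comp μ (Equiv.swap 0 i) (fun ω => U 0 ω * X ω)]
    congr 1
    funext ω
    rw [hXs i hi']
    congr 1
    simp only [hU, Function.comp_apply, Equiv.swap_apply_left]
    have key : (∀ j : Fin N, j ≠ i → (j : ℕ) < n → ¬ c (ω j)) ↔
        (∀ j : Fin N, j ≠ 0 → (j : ℕ) < n → ¬ c (ω (Equiv.swap 0 i j))) := by
      constructor
      · intro h j hj hjn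
        refine h _ (fun e => hj ?_) ?_
        · have := congrArg (Equiv.swap 0 i) e
          simpa using this
        · by_cases hji : j = i
          · subst hji; simpa using hn
          · rwa [Equiv.swap_apply_of_ne_of_ne hj hji]
      · intro h j hj hjn
        have := h (Equiv.swap 0 i j) (fun e => hj ?_) ?_
        · simpa using this
        · have := congrArg (Equiv.swap 0 i) e
          simpa using this
        · by_cases hj0 : j = 0
          · subst hj0; simpa using hi'
          · rwa [Equiv.swap_apply_of_ne_of_ne hj0 hj]
    simp only [key]
  -- The n events are disjoint, so at most one summand is nonzero, and it is at most V.
  have hsum : ∀ ω, ∑ i ∈ s, U i ω ≤ V ω := by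
    intro ω
    by_cases h : ∃ i ∈ s, c (ω i)
    · obtain ⟨i, hi, hci⟩ := h
      have hi' : (i : ℕ) < n := (Finset.mem_filter.1 hi).2
      rw [Finset.sum_eq_single_of_mem i hi]
      · simp only [hU]
        split_ifs
        · exact hVv ω i hi' hci
        · exact hV ω
      · intro j _ hji
        simp only [hU]
        rw [if_neg]
        rintro ⟨-, h2⟩
        exact h2 i hji.symm hi' hci
    · push Not at h
      refine (Finset.sum_nonpos fun i hi => ?_).trans (hV ω)
      simp only [hU]
      rw [if_neg fun h2 => h i hi h2.1]
  calc (n : ℝ) * sampleMean μ N (fun ω => U 0 ω * X ω)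
      = ∑ i ∈ s, sampleMean μ N (fun ω => U i ω * X ω) := by
        rw [Finset.sum_congr rfl hswap, Finset.sum_const, hcard, nsmul_eq_mul]
    _ = sampleMean μ N (fun ω => (∑ i ∈ s, U i ω) * X ω) := by
        rw [← sampleMean_sum]
        simp only [Finset.sum_mul]
    _ ≤ _ := sampleMean_mono hμ fun ω => mul_le_mul_of_nonneg_right (hsum ω) (hX ω)

/-- A union bound: for independent events of probabilities `f a`, the chance that all occur is at
least one minus the sum of the chances of failure. -/
theorem one_sub_sum_le_prod {α : Type*} (s : Finset α) {f : α → ℝ} (h0 : ∀ a ∈ s, 0 ≤ f a)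
    (h1 : ∀ a ∈ s, f a ≤ 1) : 1 - ∑ a ∈ s, (1 - f a) ≤ ∏ a ∈ s, f a := by
  classical
  induction s using Finset.induction_on with
  | empty => simp
  | insert a s ha ih =>
    rw [Finset.sum_insert ha, Finset.prod_insert ha]
    have i1 := ih (fun b hb => h0 b (Finset.mem_insert_of_mem hb))
      (fun b hb => h1 b (Finset.mem_insert_of_mem hb))
    have i2 := h0 a (Finset.mem_insert_self _ _)
    have i3 := h1 a (Finset.mem_insert_self _ _)
    have i4 : 0 ≤ ∑ b ∈ s, (1 - f b) := Finset.sum_nonneg fun b hb => by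
      have := h1 b (Finset.mem_insert_of_mem hb); linarith
    nlinarith [mul_le_mul_of_nonneg_left i1 i2]

/-- The block from 16^k to 16^(k+1) has at most 16^(k+1) indices of weight 64^(-(k+1)), so the
blocks decay like 4^(-k). The subtracted term closes the induction, since 1/3 - 1/4 = (1/3)(1/4).
The sum will bound the probability that some sample is untypically large. -/
theorem sum_block_le (K : ℕ) :
    ∑ j ∈ Finset.range (16 ^ K), ((64 : ℝ) ^ (Nat.log 16 j + 1))⁻¹ ≤
      1 / 2 - (1 / 3) * ((4 : ℝ) ^ K)⁻¹ := by
  induction K with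
  | zero => norm_num
  | succ K ih =>
    have hle : 16 ^ K ≤ 16 ^ (K + 1) := Nat.pow_le_pow_right (by norm_num) (Nat.le_succ K)
    rw [← Finset.sum_range_add_sum_Ico _ hle]
    have h2 : ∑ j ∈ Finset.Ico (16 ^ K) (16 ^ (K + 1)), ((64 : ℝ) ^ (Nat.log 16 j + 1))⁻¹ ≤
        (16 : ℝ) ^ (K + 1) * ((64 : ℝ) ^ (K + 1))⁻¹ := by
      calc _ ≤ ∑ j ∈ Finset.Ico (16 ^ K) (16 ^ (K + 1)), ((64 : ℝ) ^ (K + 1))⁻¹ := by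
            refine Finset.sum_le_sum fun j hj => ?_
            rw [Finset.mem_Ico] at hj
            rw [Nat.log_eq_of_pow_le_of_lt_pow hj.1 hj.2]
        _ ≤ _ := by
            rw [Finset.sum_const, Nat.card_Ico, nsmul_eq_mul]
            gcongr
            have : 16 ^ (K + 1) - 16 ^ K ≤ 16 ^ (K + 1) := Nat.sub_le _ _
            exact_mod_cast this
    have h3 : (16 : ℝ) ^ (K + 1) * ((64 : ℝ) ^ (K + 1))⁻¹ = (1 / 4) * ((4 : ℝ) ^ K)⁻¹ := by
      rw [← div_eq_mul_inv, ← div_pow, pow_succ, ← inv_pow]; norm_num; ring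
    have h4 : ((4 : ℝ) ^ (K + 1))⁻¹ = (1 / 4) * ((4 : ℝ) ^ K)⁻¹ := by
      rw [pow_succ, mul_inv]; ring
    rw [h4]
    linarith

end Sampling

/-! ## Chains -/

/-- Either a ≤ ηb, and b carries the sum at the cost (1 + η)^r = 3/2, or a carries it. The asymmetry
is essential: in a chain of k steps the second slot is used k times, and its factor 3/2 per step
must be beaten by the geometric gains 1/4 and 1/2 found later, whatever r is. -/
theorem exists_add_rpow_le {r : ℝ} (hr : 0 < r) :
    ∃ A : ℝ, 1 ≤ A ∧ ∀ a b : ℝ, 0 ≤ a → 0 ≤ b → (a + b) ^ r ≤ A * a ^ r + 3 / 2 * b ^ r := by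
  set η : ℝ := (3 / 2 : ℝ) ^ (1 / r) - 1 with hη
  have hη0 : 0 < η := by
    have : 1 < (3 / 2 : ℝ) ^ (1 / r) := Real.one_lt_rpow (by norm_num) (by positivity)
    linarith
  have hη1 : (1 + η) ^ r = 3 / 2 := by
    rw [hη, add_sub_cancel, ← Real.rpow_mul (by norm_num), one_div_mul_cancel hr.ne',
      Real.rpow_one]
  refine ⟨(1 + η⁻¹) ^ r, Real.one_le_rpow (by linarith [inv_pos.2 hη0]) hr.le,
    fun a b ha hb => ?_⟩
  rcases le_total a (η * b) with h | h
  · calc (a + b) ^ r ≤ ((1 + η) * b) ^ r := by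
          apply Real.rpow_le_rpow (by positivity) _ hr.le; linarith
      _ = 3 / 2 * b ^ r := by rw [Real.mul_rpow (by positivity) hb, hη1]
      _ ≤ _ := by
        have : 0 ≤ (1 + η⁻¹) ^ r * a ^ r := by positivity
        linarith
  · calc (a + b) ^ r ≤ ((1 + η⁻¹) * a) ^ r := by
          apply Real.rpow_le_rpow (by positivity) _ hr.le
          have : b ≤ η⁻¹ * a := by rw [inv_mul_eq_div, le_div_iff₀ hη0]; linarith
          linarith
      _ = (1 + η⁻¹) ^ r * a ^ r := Real.mul_rpow (by positivity) ha
      _ ≤ _ := by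
        have : 0 ≤ 3 / 2 * b ^ r := by positivity
        linarith

theorem norm_rpow_sub_le {V : Type*} [SeminormedAddCommGroup V] {r A : ℝ} (hr : 0 < r)
    (hA : ∀ a b : ℝ, 0 ≤ a → 0 ≤ b → (a + b) ^ r ≤ A * a ^ r + 3 / 2 * b ^ r) (x y z : V) :
    ‖x - z‖ ^ r ≤ A * ‖x - y‖ ^ r + 3 / 2 * ‖y - z‖ ^ r :=
  (Real.rpow_le_rpow (norm_nonneg _) (norm_sub_le_norm_sub_add_norm_sub x y z) hr.le).trans
    (hA _ _ (norm_nonneg _) (norm_nonneg _))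

/-- Each triangle inequality puts the rest of the chain in the cheap slot, so that the l-th link is
charged (3/2)^l only. -/
theorem chain_rpow_le {V : Type*} [SeminormedAddCommGroup V] {r A : ℝ} (hr : 0 < r)
    (hA : ∀ a b : ℝ, 0 ≤ a → 0 ≤ b → (a + b) ^ r ≤ A * a ^ r + 3 / 2 * b ^ r)
    (h : ℕ → V) (z : V) (k : ℕ) :
    ‖h 0 - z‖ ^ r ≤ A * ∑ l ∈ Finset.range k, (3 / 2) ^ l * ‖h l - h (l + 1)‖ ^ r +
      (3 / 2) ^ k * ‖h k - z‖ ^ r := by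
  induction k with
  | zero => simp
  | succ k ih =>
    refine ih.trans ?_
    have h1 := norm_rpow_sub_le hr hA (h k) (h (k + 1)) z
    have h2 : (0 : ℝ) ≤ (3 / 2) ^ k := by positivity
    rw [Finset.sum_range_succ, pow_succ]
    nlinarith [mul_le_mul_of_nonneg_left h1 h2]

/-! ### Random partial sums and the average estimate -/

section Averaging

variable {V ι F : Type*} [SeminormedAddCommGroup V] [Fintype ι] [Fintype F]

/-- The constant in `averaging_estimate`. -/
def averageConst (A : ℝ) : ℝ := 2 * (√2 * (11 * A + 48))

/-- The sum of the first `16 ^ k` samples and `16 ^ k` times the barycentre. -/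
def partialSum (γ : F → ι → ℝ) (b : ι → ℝ) {N : ℕ} (k : ℕ) (ω : Fin N → F) (i : ι) : ℝ :=
  16 ^ k * b i + ∑ j : Fin N, if (j : ℕ) < 16 ^ k then γ (ω j) i else 0

/-- The first 16^k samples enter symmetrically; this is the invariance that the exchangeability
argument requires of the links of the chain. -/
theorem partialSum_swap (γ : F → ι → ℝ) (b : ι → ℝ) {N : ℕ} [NeZero N] {k n : ℕ}
    (hn : n ≤ 16 ^ k) (i : Fin N) (hi : (i : ℕ) < n) (ω : Fin N → F) :
    partialSum γ b k (ω ∘ Equiv.swap 0 i) = partialSum γ b k ω := by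
  funext x
  unfold partialSum
  congr 1
  rw [← Equiv.sum_comp (Equiv.swap 0 i)]
  refine Finset.sum_congr rfl fun j _ => ?_
  have : ((Equiv.swap 0 i j : Fin N) : ℕ) < 16 ^ k ↔ (j : ℕ) < 16 ^ k := by
    rcases eq_or_ne j 0 with rfl | h0
    · rw [Equiv.swap_apply_left]
      have : ((0 : Fin N) : ℕ) < 16 ^ k := by simp
      exact ⟨fun _ => this, fun _ => by omega⟩
    · rcases eq_or_ne j i with rfl | h1
      · rw [Equiv.swap_apply_right]
        have : ((0 : Fin N) : ℕ) < 16 ^ k := by simp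
        exact ⟨fun _ => by omega, fun _ => this⟩
      · rw [Equiv.swap_apply_of_ne_of_ne h0 h1]
  simp only [this, Function.comp_apply, Equiv.swap_apply_self]

theorem partialSum_mono {γ : F → ι → ℝ} {b : ι → ℝ} (hγ : ∀ a i, 0 < γ a i) (hb : ∀ i, 0 < b i)
    {N : ℕ} (k : ℕ) (ω : Fin N → F) (i : ι) : partialSum γ b k ω i ≤ partialSum γ b (k + 1) ω i := by
  unfold partialSum
  have h : (16 : ℝ) ^ k ≤ 16 ^ (k + 1) := pow_le_pow_right₀ (by norm_num) (Nat.le_succ k)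
  have h' : 16 ^ k ≤ 16 ^ (k + 1) := Nat.pow_le_pow_right (by norm_num) (Nat.le_succ k)
  refine add_le_add (mul_le_mul_of_nonneg_right h (hb i).le) (Finset.sum_le_sum fun j _ => ?_)
  have := (hγ (ω j) i).le
  split_ifs <;> first | omega | exact le_rfl

theorem le_partialSum {γ : F → ι → ℝ} {b : ι → ℝ} (hγ : ∀ a i, 0 < γ a i) (hb : ∀ i, 0 < b i)
    {N : ℕ} {k : ℕ} (ω : Fin N → F) (i : ι) {j : Fin N} (hj : (j : ℕ) < 16 ^ k) :
    γ (ω j) i ≤ partialSum γ b k ω i := by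
  unfold partialSum
  have h1 : (if (j : ℕ) < 16 ^ k then γ (ω j) i else 0) ≤
      ∑ j : Fin N, if (j : ℕ) < 16 ^ k then γ (ω j) i else 0 :=
    Finset.single_le_sum (f := fun j : Fin N => if (j : ℕ) < 16 ^ k then γ (ω j) i else 0)
      (fun j _ => by split_ifs <;> simp [(hγ _ _).le]) (Finset.mem_univ j)
  rw [if_pos hj] at h1
  have h2 : 0 ≤ 16 ^ k * b i := mul_nonneg (by positivity) (hb i).le
  linarith

theorem pow_mul_le_partialSum {γ : F → ι → ℝ} {b : ι → ℝ} (hγ : ∀ a i, 0 < γ a i)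
    {N : ℕ} (k : ℕ) (ω : Fin N → F) (i : ι) : 16 ^ k * b i ≤ partialSum γ b k ω i :=
  le_add_of_nonneg_right (Finset.sum_nonneg fun j _ => by split_ifs <;> simp [(hγ _ _).le])

theorem sum_partialSum_le {γ : F → ι → ℝ} {b : ι → ℝ} (hγ1 : ∀ a, ∑ i, γ a i ≤ 1)
    (hb1 : ∑ i, b i ≤ 1) {N : ℕ} (k : ℕ) (ω : Fin N → F) :
    ∑ i, partialSum γ b k ω i ≤ 2 * 16 ^ k := by
  unfold partialSum
  rw [Finset.sum_add_distrib, ← Finset.mul_sum, Finset.sum_comm, two_mul]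
  refine add_le_add (mul_le_of_le_one_right (by positivity) hb1) ?_
  calc _ ≤ ∑ j : Fin N, if (j : ℕ) < 16 ^ k then (1 : ℝ) else 0 := by
        refine Finset.sum_le_sum fun j _ => ?_
        split_ifs
        · exact hγ1 _
        · simp
    _ = ((Finset.univ.filter fun j : Fin N => (j : ℕ) < 16 ^ k).card : ℝ) := by
        rw [Finset.sum_ite]; simp
    _ ≤ _ := by
        rw [Fin.card_filter_val_lt]
        exact_mod_cast min_le_right _ _

theorem sqrt_two_mul_pow (k : ℕ) : √(2 * 16 ^ k) = √2 * 4 ^ k := by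
  rw [Real.sqrt_mul (by norm_num)]
  congr 1
  rw [show (16 : ℝ) = 4 ^ 2 by norm_num, ← pow_mul, mul_comm, pow_mul]
  exact Real.sqrt_sq (by positivity)

theorem sqrt_pow_sixtyfour (k : ℕ) : √(64 ^ k) = 8 ^ k := by
  rw [show (64 : ℝ) = 8 ^ 2 by norm_num, ← pow_mul, mul_comm, pow_mul]
  exact Real.sqrt_sq (by positivity)

/-- Only boundedly many scales below `16 ^ k` are exceeded by another sample. -/
def Exceeds (x b : ℝ) : ℕ → Prop
  | 0 => True
  | k + 1 => 64 ^ (k + 1) * b < x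

theorem Exceeds.of_le {x b : ℝ} (hb : 0 ≤ b) {k l : ℕ} (h : Exceeds x b k) (hl : l ≤ k) :
    Exceeds x b l := by
  cases l with
  | zero => trivial
  | succ l =>
    cases k with
    | zero => omega
    | succ k =>
      have h2 : (64 : ℝ) ^ (l + 1) ≤ 64 ^ (k + 1) := pow_le_pow_right₀ (by norm_num) hl
      exact lt_of_le_of_lt (mul_le_mul_of_nonneg_right h2 hb) h

theorem exists_last_exceeds {x b : ℝ} {K : ℕ} (h : ¬ Exceeds x b (K + 1)) :
    ∃ k ≤ K, Exceeds x b k ∧ ¬ Exceeds x b (k + 1) := by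
  induction K with
  | zero => exact ⟨0, le_rfl, trivial, h⟩
  | succ K ih =>
    by_cases h2 : Exceeds x b (K + 1)
    · exact ⟨K + 1, le_rfl, h2, h⟩
    · obtain ⟨k, hk, h3⟩ := ih h2
      exact ⟨k, by omega, h3⟩

theorem geom_sum_le {q : ℝ} (h0 : 0 ≤ q) (h1 : q < 1) (n : ℕ) :
    ∑ l ∈ Finset.range n, q ^ l ≤ (1 - q)⁻¹ := by
  rw [← tsum_geometric_of_lt_one h0 h1]
  exact (summable_geometric_of_lt_one h0 h1).sum_le_tsum _ fun _ _ => by positivity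

open Classical in
/-- The weight of the first sample when it alone exceeds the scale `k`, among the first `n`. -/
def soloWeight (b : ι → ℝ) (γ : F → ι → ℝ) (v : F → ι → ℝ) {N : ℕ} [NeZero N] (k n : ℕ) (i : ι)
    (ω : Fin N → F) : ℝ :=
  if Exceeds (γ (ω 0) i) (b i) k ∧
    ∀ j : Fin N, j ≠ 0 → (j : ℕ) < n → ¬ Exceeds (γ (ω j) i) (b i) k then v (ω 0) i else 0

theorem soloWeight_nonneg (b : ι → ℝ) (γ : F → ι → ℝ) {v : F → ι → ℝ} (hv : ∀ a i, 0 ≤ v a i)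
    {N : ℕ} [NeZero N] (k n : ℕ) (i : ι) (ω : Fin N → F) : 0 ≤ soloWeight b γ v k n i ω := by
  unfold soloWeight
  split_ifs
  · exact hv _ _
  · exact le_rfl

/-- The gain 1/n of exchangeability is obtained coordinate by coordinate, each having its own
exceptional event. The bound C is available only for the sum over coordinates, at every sample
point, so the coordinates are summed again before it is used. -/
theorem sum_soloWeight_le {μ : F → ℝ} (hμ : ∀ a, 0 ≤ μ a) (hμ1 : ∑ a, μ a = 1)
    {b : ι → ℝ} {γ : F → ι → ℝ} {v : F → ι → ℝ} {N : ℕ} [NeZero N] {k n : ℕ}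
    (hn : 0 < n) (hnN : n ≤ N) {X W : ι → (Fin N → F) → ℝ} (hX : ∀ i ω, 0 ≤ X i ω)
    (hW : ∀ i ω, 0 ≤ W i ω)
    (hXs : ∀ j : Fin N, (j : ℕ) < n → ∀ i ω, X i (ω ∘ Equiv.swap 0 j) = X i ω)
    (hWv : ∀ i ω, ∀ j : Fin N, (j : ℕ) < n → v (ω j) i ≤ W i ω) {C : ℝ}
    (hC : ∀ ω, ∑ i, W i ω * X i ω ≤ C) :
    n * sampleMean μ N (fun ω => ∑ i, soloWeight b γ v k n i ω * X i ω) ≤ C := by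
  classical
  rw [sampleMean_sum, Finset.mul_sum]
  calc _ ≤ ∑ i, sampleMean μ N (fun ω => W i ω * X i ω) := by
        refine Finset.sum_le_sum fun i _ => ?_
        have := sampleMean_unique_le hμ hn hnN (fun a => Exceeds (γ a i) (b i) k)
          (v := fun a => v a i) (hX i) (hW i) (fun j hj => hXs j hj i)
          (fun ω j hj _ => hWv i ω j hj)
        refine le_of_eq_of_le ?_ this
        congr 2
    _ = sampleMean μ N (fun ω => ∑ i, W i ω * X i ω) := (sampleMean_sum _ _ _).symm
    _ ≤ C := sampleMean_le hμ hμ1 hC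

end Averaging

section Averaging

variable {V ι F : Type*} [SeminormedAddCommGroup V] [Fintype ι] [Fintype F]

/-- In a single coordinate, φ(γ(ω 0)) is joined to φ(b) through the partial sums, and the chain
stops at the last scale that the first sample exceeds. When the other samples are tame, the first
one is alone above every scale used, so every term carries a solo weight and can be averaged with a
gain. -/
theorem chain_soloWeight_le {r A : ℝ} (hr : 0 < r) (hA1 : 1 ≤ A)
    (hA : ∀ a b : ℝ, 0 ≤ a → 0 ≤ b → (a + b) ^ r ≤ A * a ^ r + 3 / 2 * b ^ r)
    {b : ι → ℝ} (hb : ∀ i, 0 < b i) {γ : F → ι → ℝ} (φ : (ι → ℝ) → ι → V)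
    {N K : ℕ} [NeZero N] {i : ι} (hK : ∀ a, γ a i ≤ 64 ^ (K + 1) * b i) (ω : Fin N → F)
    (hω : ∀ j : Fin N, j ≠ 0 → γ (ω j) i ≤ 64 ^ (Nat.log 16 j + 1) * b i) :
    √(γ (ω 0) i) * ‖φ (γ (ω 0)) i - φ b i‖ ^ r ≤
      A * (√(γ (ω 0) i) * ‖φ (γ (ω 0)) i - φ (partialSum γ b 0 ω) i‖ ^ r) +
      (3 / 2 * A) * ∑ l ∈ Finset.range K, (3 / 2) ^ l *
        (soloWeight b γ (fun a i => √(γ a i)) (l + 1) (16 ^ l) i ω *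
          ‖φ (partialSum γ b l ω) i - φ (partialSum γ b (l + 1) ω) i‖ ^ r) +
      3 / 2 * ∑ k ∈ Finset.range (K + 1), (3 / 2) ^ k *
        (soloWeight b γ (fun a i => if γ a i ≤ 64 ^ (k + 1) * b i then √(γ a i) else 0)
          k (16 ^ k) i ω * ‖φ (partialSum γ b k ω) i - φ b i‖ ^ r) := by
  classical
  have hK' : ¬ Exceeds (γ (ω 0) i) (b i) (K + 1) := not_lt.2 (hK _)
  -- The stopping scale of the coordinate: 64^k b_i < γ(ω 0)_i ≤ 64^(k+1) b_i, without the lower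
  -- bound when k = 0.
  obtain ⟨k, hkK, hk1, hk2⟩ := exists_last_exceeds hK'
  -- A tame sample of index 0 < j < 16^n has `Nat.log 16 j + 1 ≤ n`, so it does not exceed the scale
  -- n, nor any larger one.
  have hother : ∀ m n : ℕ, n ≤ m → ∀ j : Fin N, j ≠ 0 → (j : ℕ) < 16 ^ n →
      ¬ Exceeds (γ (ω j) i) (b i) m := by
    intro m n hnm j hj hjn
    have hj0 : (j : ℕ) ≠ 0 := fun h => hj (Fin.ext (by simpa using h))
    have hlog : Nat.log 16 j < n := Nat.log_lt_of_lt_pow hj0 hjn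
    obtain ⟨m, rfl⟩ : ∃ m', m = m' + 1 := ⟨m - 1, by omega⟩
    refine not_lt.2 ((hω j hj).trans ?_)
    refine mul_le_mul_of_nonneg_right ?_ (hb i).le
    exact pow_le_pow_right₀ (by norm_num) (by omega)
  set H := fun k => partialSum γ b k ω with hH
  have h1 := norm_rpow_sub_le hr hA (φ (γ (ω 0)) i) (φ (H 0) i) (φ b i)
  have h2 := chain_rpow_le hr hA (fun k => φ (H k) i) (φ b i) k
  set s := √(γ (ω 0) i) with hs
  have hs0 : 0 ≤ s := Real.sqrt_nonneg _
  -- For l < k the first sample exceeds the scale l + 1 and the others of index below 16^l do not,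
  -- so the solo weight equals s. The sum is then extended to the deterministic range K.
  have h3 : s * ∑ l ∈ Finset.range k, (3 / 2 : ℝ) ^ l * ‖φ (H l) i - φ (H (l + 1)) i‖ ^ r ≤
      ∑ l ∈ Finset.range K, (3 / 2 : ℝ) ^ l *
        (soloWeight b γ (fun a i => √(γ a i)) (l + 1) (16 ^ l) i ω *
          ‖φ (H l) i - φ (H (l + 1)) i‖ ^ r) := by
    rw [Finset.mul_sum]
    calc _ ≤ ∑ l ∈ Finset.range k, (3 / 2 : ℝ) ^ l *
        (soloWeight b γ (fun a i => √(γ a i)) (l + 1) (16 ^ l) i ω *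
          ‖φ (H l) i - φ (H (l + 1)) i‖ ^ r) := by
          refine Finset.sum_le_sum fun l hl => le_of_eq ?_
          have hlk := Finset.mem_range.1 hl
          have : soloWeight b γ (fun a i => √(γ a i)) (l + 1) (16 ^ l) i ω = s := by
            unfold soloWeight
            rw [if_pos ⟨hk1.of_le (hb i).le (by omega), hother _ _ (by omega)⟩]
          rw [this]
          ring
      _ ≤ _ := by
          refine Finset.sum_le_sum_of_subset_of_nonneg
            (Finset.range_subset_range.2 hkK) fun l _ _ => ?_
          have := soloWeight_nonneg b γ (fun a i => Real.sqrt_nonneg (γ a i)) (l + 1) (16 ^ l) i ω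
          positivity
  have h4 : s * ((3 / 2 : ℝ) ^ k * ‖φ (H k) i - φ b i‖ ^ r) ≤
      ∑ k ∈ Finset.range (K + 1), (3 / 2 : ℝ) ^ k *
        (soloWeight b γ (fun a i => if γ a i ≤ 64 ^ (k + 1) * b i then √(γ a i) else 0)
          k (16 ^ k) i ω * ‖φ (H k) i - φ b i‖ ^ r) := by
    have : soloWeight b γ (fun a i => if γ a i ≤ 64 ^ (k + 1) * b i then √(γ a i) else 0)
          k (16 ^ k) i ω = s := by
      unfold soloWeight
      rw [if_pos ⟨hk1, hother _ _ le_rfl⟩]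
      exact if_pos (not_lt.1 hk2)
    have h5 := Finset.single_le_sum (s := Finset.range (K + 1)) (a := k)
      (f := fun k => (3 / 2 : ℝ) ^ k *
        (soloWeight b γ (fun a i => if γ a i ≤ 64 ^ (k + 1) * b i then √(γ a i) else 0)
          k (16 ^ k) i ω * ‖φ (H k) i - φ b i‖ ^ r)) (fun l _ => by
        have := soloWeight_nonneg b γ
          (v := fun a i => if γ a i ≤ 64 ^ (l + 1) * b i then √(γ a i) else 0)
          (fun a i => by split_ifs <;> positivity) l (16 ^ l) i ω
        positivity) (Finset.mem_range.2 (by omega))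
    simp only [this] at h5
    refine le_trans (le_of_eq (by ring)) h5
  have h6 := mul_le_mul_of_nonneg_left h2 hs0
  have h7 := mul_le_mul_of_nonneg_left h1 hs0
  have h8 := mul_le_mul_of_nonneg_left h3 (show (0 : ℝ) ≤ 3 / 2 * A by linarith)
  linarith

/-- A direct use of `hφ` with γ_a ≤ b / μ_a loses a factor μ_a^(-1/2), which no constant absorbs.
Instead, independent samples of the family are drawn and φ(γ(ω 0)) is compared with φ of the sums of
16^k samples, to which 16^k b is added so that φ(16^k b) = φ(b) can be reached from them. Later
links are costly, as the sums grow, but they occur only in coordinates where the first sample is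
exceptionally large among 16^k of them, and exchangeability makes that a fraction 16^(-k) of the
total. -/
theorem averaging_estimate {r A : ℝ} (hr : 0 < r) (hA1 : 1 ≤ A)
    (hA : ∀ a b : ℝ, 0 ≤ a → 0 ≤ b → (a + b) ^ r ≤ A * a ^ r + 3 / 2 * b ^ r)
    {w : ι → ℝ} (hw : ∀ i, 0 ≤ w i) {φ : (ι → ℝ) → ι → V} {B : ℝ} (hB : 0 ≤ B)
    (hs : ∀ t : ℝ, 0 < t → ∀ G : ι → ℝ, (∀ i, 0 < G i) → φ (fun i => t * G i) = φ G)
    (hφ : ∀ G H : ι → ℝ, (∀ i, 0 < G i) → (∀ i, G i ≤ H i) →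
      ∑ i, w i * √(G i) * ‖φ G i - φ H i‖ ^ r ≤ B * √(∑ i, H i))
    {μ : F → ℝ} (hμ : ∀ a, 0 ≤ μ a) (hμ1 : ∑ a, μ a = 1)
    {γ : F → ι → ℝ} (hγ : ∀ a i, 0 < γ a i) (hγ1 : ∀ a, ∑ i, γ a i ≤ 1) :
    ∑ a, μ a * ∑ i, w i * √(γ a i) * ‖φ (γ a) i - φ (fun i => ∑ a, μ a * γ a i) i‖ ^ r ≤
      averageConst A * B := by
  classical
  set b : ι → ℝ := fun i => ∑ a, μ a * γ a i with hbdef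
  have hb : ∀ i, 0 < b i := by
    intro i
    obtain ⟨a, ha⟩ : ∃ a, μ a ≠ 0 := by
      by_contra h
      push Not at h
      simp [h] at hμ1
    refine Finset.sum_pos' (fun a _ => mul_nonneg (hμ a) (hγ a i).le)
      ⟨a, Finset.mem_univ _, mul_pos (lt_of_le_of_ne (hμ a) ha.symm) (hγ a i)⟩
  have hb1 : ∑ i, b i ≤ 1 := by
    simp only [hbdef]
    rw [Finset.sum_comm, ← hμ1]
    refine Finset.sum_le_sum fun a _ => ?_
    rw [← Finset.mul_sum]
    exact mul_le_of_le_one_right (hμ a) (hγ1 a)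
  -- The family is finite, so no weight exceeds the scale K + 1 in any coordinate and every chain
  -- stops by step K. The final constant does not depend on K.
  obtain ⟨K, hK⟩ : ∃ K : ℕ, ∀ a i, γ a i ≤ 64 ^ (K + 1) * b i := by
    obtain ⟨K, hK⟩ := pow_unbounded_of_one_lt (∑ a, ∑ i, γ a i / b i)
      (show (1 : ℝ) < 64 by norm_num)
    refine ⟨K, fun a i => ?_⟩
    have hnn : ∀ a i, 0 ≤ γ a i / b i := fun a i => div_nonneg (hγ a i).le (hb i).le
    have h1 : γ a i / b i ≤ ∑ a, ∑ i, γ a i / b i :=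
      (Finset.single_le_sum (fun i _ => hnn a i) (Finset.mem_univ i)).trans
        (Finset.single_le_sum (f := fun a => ∑ i, γ a i / b i)
          (fun a _ => Finset.sum_nonneg fun i _ => hnn a i) (Finset.mem_univ a))
    rw [← div_le_iff₀ (hb i), pow_succ]
    have : (0 : ℝ) < 64 ^ K := by positivity
    linarith
  have : NeZero (16 ^ K) := ⟨by positivity⟩
  set N := 16 ^ K with hN
  set dev : ι → F → ℝ := fun i a => w i * √(γ a i) * ‖φ (γ a) i - φ b i‖ ^ r with hdev
  have hdev0 : ∀ i a, 0 ≤ dev i a := fun i a => by have := hw i; positivity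
  set g : ι → Fin N → F → ℝ := fun i j a =>
    if γ a i ≤ 64 ^ (Nat.log 16 j + 1) * b i then 1 else 0 with hg
  -- a fixed coordinate has only tame samples with probability at least one half
  have stepA : ∀ i, 1 / 2 * ∑ a, μ a * dev i a ≤
      sampleMean μ N (fun ω => dev i (ω 0) * ∏ j ∈ Finset.univ.erase 0, g i j (ω j)) := by
    intro i
    have e1 : (fun ω : Fin N → F => dev i (ω 0) * ∏ j ∈ Finset.univ.erase 0, g i j (ω j)) =
        fun ω => ∏ j, (if j = 0 then dev i (ω j) else g i j (ω j)) := by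
      funext ω
      rw [← Finset.mul_prod_erase Finset.univ _ (Finset.mem_univ (0 : Fin N)), if_pos rfl]
      congr 1
      refine Finset.prod_congr rfl fun j hj => ?_
      rw [if_neg (Finset.ne_of_mem_erase hj)]
    rw [e1, sampleMean_prod μ (fun j a => if j = 0 then dev i a else g i j a),
      ← Finset.mul_prod_erase Finset.univ _ (Finset.mem_univ (0 : Fin N))]
    simp only [if_true]
    rw [mul_comm]
    refine mul_le_mul_of_nonneg_left ?_
      (Finset.sum_nonneg fun a _ => mul_nonneg (hμ a) (hdev0 i a))
    have e2 : ∏ j ∈ Finset.univ.erase (0 : Fin N), ∑ a, μ a * (if j = 0 then dev i a else g i j a) =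
        ∏ j ∈ Finset.univ.erase (0 : Fin N), ∑ a, μ a * g i j a := by
      refine Finset.prod_congr rfl fun j hj => ?_
      simp only [if_neg (Finset.ne_of_mem_erase hj)]
    rw [e2]
    have hg0 : ∀ j a, 0 ≤ g i j a := fun j a => by simp only [hg]; split_ifs <;> norm_num
    have hg1 : ∀ j a, g i j a ≤ 1 := fun j a => by simp only [hg]; split_ifs <;> norm_num
    -- Markov's inequality: γ(·)_i has mean b_i.
    have htail : ∀ j : Fin N, 1 - ∑ a, μ a * g i j a ≤ ((64 : ℝ) ^ (Nat.log 16 j + 1))⁻¹ := by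
      intro j
      set t : ℝ := 64 ^ (Nat.log 16 j + 1) with ht
      have ht0 : 0 < t := by positivity
      rw [← hμ1, ← Finset.sum_sub_distrib]
      have h1 : ∑ a, (μ a - μ a * g i j a) ≤ ∑ a, (t⁻¹ * (b i)⁻¹) * (μ a * γ a i) := by
        refine Finset.sum_le_sum fun a _ => ?_
        have hq : 0 ≤ t⁻¹ * (b i)⁻¹ := by have := hb i; positivity
        simp only [hg]
        split_ifs with h
        · have := mul_nonneg hq (mul_nonneg (hμ a) (hγ a i).le)
          linarith
        · push Not at h
          rw [mul_zero, sub_zero]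
          have h2 : 1 ≤ t⁻¹ * (b i)⁻¹ * γ a i := by
            rw [← mul_inv, inv_mul_eq_div, one_le_div (mul_pos ht0 (hb i))]
            exact h.le
          have := mul_le_mul_of_nonneg_left h2 (hμ a)
          linarith
      refine h1.trans (le_of_eq ?_)
      rw [← Finset.mul_sum]
      have : ∑ a, μ a * γ a i = b i := rfl
      rw [this, mul_assoc, inv_mul_cancel₀ (hb i).ne', mul_one]
    refine le_trans ?_ (one_sub_sum_le_prod _
      (fun j _ => Finset.sum_nonneg fun a _ => mul_nonneg (hμ a) (hg0 j a)) (fun j _ => ?_))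
    · have h1 : ∑ j ∈ Finset.univ.erase (0 : Fin N), (1 - ∑ a, μ a * g i j a) ≤
          ∑ j : Fin N, ((64 : ℝ) ^ (Nat.log 16 j + 1))⁻¹ := by
        refine (Finset.sum_le_sum fun j _ => htail j).trans ?_
        exact Finset.sum_le_sum_of_subset_of_nonneg (Finset.erase_subset _ _)
          fun _ _ _ => by positivity
      rw [Fin.sum_univ_eq_sum_range (fun j => ((64 : ℝ) ^ (Nat.log 16 j + 1))⁻¹)] at h1
      have h2 := sum_block_le K
      have h3 : (0 : ℝ) < ((4 : ℝ) ^ K)⁻¹ := by positivity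
      linarith
    · rw [← hμ1]
      exact Finset.sum_le_sum fun a _ => mul_le_of_le_one_right (hμ a) (hg1 j a)
  set X0 : (Fin N → F) → ℝ := fun ω =>
    ∑ i, w i * √(γ (ω 0) i) * ‖φ (γ (ω 0)) i - φ (partialSum γ b 0 ω) i‖ ^ r with hX0
  set XL : ℕ → ι → (Fin N → F) → ℝ := fun l i ω =>
    w i * ‖φ (partialSum γ b l ω) i - φ (partialSum γ b (l + 1) ω) i‖ ^ r with hXL
  set XT : ℕ → ι → (Fin N → F) → ℝ := fun k i ω =>
    w i * ‖φ (partialSum γ b k ω) i - φ b i‖ ^ r with hXT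
  set vT : ℕ → F → ι → ℝ := fun k a i =>
    if γ a i ≤ 64 ^ (k + 1) * b i then √(γ a i) else 0 with hvT
  set SL : ℕ → (Fin N → F) → ℝ := fun l ω =>
    ∑ i, soloWeight b γ (fun a i => √(γ a i)) (l + 1) (16 ^ l) i ω * XL l i ω with hSL
  set ST : ℕ → (Fin N → F) → ℝ := fun k ω =>
    ∑ i, soloWeight b γ (vT k) k (16 ^ k) i ω * XT k i ω with hST
  have stepB : ∀ ω : Fin N → F,
      ∑ i, dev i (ω 0) * ∏ j ∈ Finset.univ.erase 0, g i j (ω j) ≤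
      A * X0 ω + (3 / 2 * A) * ∑ l ∈ Finset.range K, (3 / 2) ^ l * SL l ω +
      3 / 2 * ∑ k ∈ Finset.range (K + 1), (3 / 2) ^ k * ST k ω := by
    intro ω
    simp only [hX0, hSL, hST, Finset.mul_sum]
    rw [Finset.sum_comm (s := Finset.range K), Finset.sum_comm (s := Finset.range (K + 1)),
      ← Finset.sum_add_distrib, ← Finset.sum_add_distrib]
    refine Finset.sum_le_sum fun i _ => ?_
    have hwi := hw i
    by_cases hω : ∀ j : Fin N, j ≠ 0 → γ (ω j) i ≤ 64 ^ (Nat.log 16 j + 1) * b i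
    · have e1 : ∏ j ∈ Finset.univ.erase 0, g i j (ω j) = 1 :=
        Finset.prod_eq_one fun j hj => if_pos (hω j (Finset.ne_of_mem_erase hj))
      rw [e1, mul_one]
      have h := mul_le_mul_of_nonneg_left
        (chain_soloWeight_le hr hA1 hA hb φ (fun a => hK a i) ω hω) hwi
      simp only [hdev, hXL, hXT, hvT]
      refine le_trans (le_of_eq (by ring)) (h.trans (le_of_eq ?_))
      simp only [mul_add, Finset.mul_sum]
      congr 1
      · congr 1
        · ring
        · exact Finset.sum_congr rfl fun _ _ => by ring
      · exact Finset.sum_congr rfl fun _ _ => by ring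
    · push Not at hω
      obtain ⟨j, hj, hlt⟩ := hω
      have e1 : ∏ j ∈ Finset.univ.erase 0, g i j (ω j) = 0 :=
        Finset.prod_eq_zero (Finset.mem_erase.2 ⟨hj, Finset.mem_univ j⟩) (if_neg (not_le.2 hlt))
      rw [e1, mul_zero]
      refine add_nonneg (add_nonneg (by positivity) (Finset.sum_nonneg fun l _ => ?_))
        (Finset.sum_nonneg fun k _ => ?_)
      · have := soloWeight_nonneg b γ (fun a i => Real.sqrt_nonneg (γ a i)) (l + 1) (16 ^ l) i ω
        simp only [hXL]
        positivity
      · have := soloWeight_nonneg b γ (v := vT k)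
          (fun a i => by simp only [hvT]; split_ifs <;> positivity) k (16 ^ k) i ω
        simp only [hXT]
        positivity
  have hpos : ∀ k (ω : Fin N → F) i, 0 < partialSum γ b k ω i := fun k ω i =>
    (mul_pos (by positivity) (hb i)).trans_le (pow_mul_le_partialSum hγ k ω i)
  have bX0 : ∀ ω, X0 ω ≤ B * √2 := by
    -- The first link is not random in size: γ(ω 0) is dominated by the sum S_0, whose total mass is
    -- at most 2.
    intro ω
    refine (hφ _ _ (hγ _) fun i => le_partialSum hγ hb ω i (by simp)).trans ?_
    have := sum_partialSum_le hγ1 hb1 0 ω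
    rw [pow_zero, mul_one] at this
    gcongr
  have hle : ∀ k ≤ K, 16 ^ k ≤ N := fun k hk => Nat.pow_le_pow_right (by norm_num) hk
  -- `hφ` bounds the link by B√(2·16^(l+1)) = 4√2·B·4^l, and being solo among 16^l samples divides
  -- this by 16^l.
  have bSL : ∀ l ∈ Finset.range K, sampleMean μ N (SL l) ≤ 4 * √2 * B * (1 / 4) ^ l := by
    intro l hl
    have hlK := Finset.mem_range.1 hl
    have h := sum_soloWeight_le hμ hμ1 (b := b) (γ := γ) (v := fun a i => √(γ a i))
      (k := l + 1) (n := 16 ^ l) (by positivity) (hle l hlK.le) (X := XL l)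
      (W := fun i ω => √(partialSum γ b l ω i))
      (fun i ω => by have := hw i; simp only [hXL]; positivity)
      (fun i ω => Real.sqrt_nonneg _)
      (fun j hj i ω => by
        simp only [hXL]
        rw [partialSum_swap γ b le_rfl j hj, partialSum_swap γ b
          (Nat.pow_le_pow_right (by norm_num) (Nat.le_succ l)) j hj])
      (fun i ω j hj => Real.sqrt_le_sqrt (le_partialSum hγ hb ω i hj))
      (C := B * (√2 * 4 ^ (l + 1))) (fun ω => by
        have h1 := hφ _ _ (hpos l ω) (partialSum_mono hγ hb l ω)
        have h2 := Real.sqrt_le_sqrt (sum_partialSum_le hγ1 hb1 (l + 1) ω)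
        rw [sqrt_two_mul_pow] at h2
        refine le_trans (le_of_eq ?_) (h1.trans (mul_le_mul_of_nonneg_left h2 hB))
        exact Finset.sum_congr rfl fun i _ => by simp only [hXL]; ring)
    have h16 : (0 : ℝ) < 16 ^ l := by positivity
    have e : 4 * √2 * B * (1 / 4) ^ l = (B * (√2 * 4 ^ (l + 1))) / 16 ^ l := by
      rw [show (16 : ℝ) = 4 * 4 by norm_num, mul_pow, pow_succ, one_div, inv_pow]
      field_simp
    rw [e, le_div_iff₀ h16, mul_comm]
    exact_mod_cast h
  -- The sample is at most 64^(k+1) b_i here, so its root costs 8^(k+1) √(b_i); division by 16^k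
  -- leaves 8·2^(-k).
  have bST : ∀ k ∈ Finset.range (K + 1), sampleMean μ N (ST k) ≤ 8 * √2 * B * (1 / 2) ^ k := by
    intro k hk
    have hkK : k ≤ K := Nat.lt_succ_iff.1 (Finset.mem_range.1 hk)
    have h := sum_soloWeight_le hμ hμ1 (b := b) (γ := γ) (v := vT k)
      (k := k) (n := 16 ^ k) (by positivity) (hle k hkK) (X := XT k)
      (W := fun i ω => 8 ^ (k + 1) * √(b i))
      (fun i ω => by have := hw i; simp only [hXT]; positivity)
      (fun i ω => by positivity)
      (fun j hj i ω => by
        simp only [hXT]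
        rw [partialSum_swap γ b le_rfl j hj])
      (fun i ω j hj => by
        simp only [hvT]
        split_ifs with h
        · rw [← sqrt_pow_sixtyfour, ← Real.sqrt_mul (by positivity)]
          exact Real.sqrt_le_sqrt h
        · positivity)
      (C := 8 ^ (k + 1) * (B * √2)) (fun ω => by
        -- φ(b) = φ(16^k b) by scale invariance, and 16^k b lies below the partial sum; the factor
        -- 4^k = √(16^k) then cancels from both sides.
        have h1 := hφ (fun i => 16 ^ k * b i) _
          (fun i => mul_pos (by positivity) (hb i)) (pow_mul_le_partialSum hγ k ω)
        rw [hs _ (by positivity) _ hb] at h1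
        have h2 := Real.sqrt_le_sqrt (sum_partialSum_le hγ1 hb1 k ω)
        rw [sqrt_two_mul_pow] at h2
        have h3 := h1.trans (mul_le_mul_of_nonneg_left h2 hB)
        have e16 : √((16 : ℝ) ^ k) = 4 ^ k := by
          rw [show (16 : ℝ) = 4 ^ 2 by norm_num, ← pow_mul, mul_comm, pow_mul]
          exact Real.sqrt_sq (by positivity)
        have h4 : 4 ^ k * ∑ i, √(b i) * XT k i ω ≤ 4 ^ k * (B * √2) := by
          refine le_trans (le_of_eq ?_) (h3.trans (le_of_eq (by ring)))
          rw [Finset.mul_sum]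
          refine Finset.sum_congr rfl fun i _ => ?_
          simp only [hXT]
          rw [Real.sqrt_mul (by positivity), e16, norm_sub_rev]
          ring
        have h5 := le_of_mul_le_mul_left h4 (by positivity)
        simp only [mul_assoc]
        rw [← Finset.mul_sum]
        gcongr)
    have h16 : (0 : ℝ) < 16 ^ k := by positivity
    have e : 8 * √2 * B * (1 / 2) ^ k = (8 ^ (k + 1) * (B * √2)) / 16 ^ k := by
      rw [show (16 : ℝ) = 8 * 2 by norm_num, mul_pow, pow_succ, one_div, inv_pow]
      field_simp
    rw [e, le_div_iff₀ h16, mul_comm]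
    exact_mod_cast h
  have total := sampleMean_mono hμ stepB
  have hsumA : ∑ i, (1 / 2) * ∑ a, μ a * dev i a ≤
      ∑ i, sampleMean μ N (fun ω => dev i (ω 0) * ∏ j ∈ Finset.univ.erase 0, g i j (ω j)) := by
    exact Finset.sum_le_sum fun i _ => stepA i
  simp only [sampleMean_add, sampleMean_mul_left, sampleMean_sum] at total
  have c0 : sampleMean μ N X0 ≤ B * √2 := sampleMean_le hμ hμ1 bX0
  have hB2 : 0 ≤ √2 * B := by positivity
  have c1 : ∑ l ∈ Finset.range K, (3 / 2) ^ l * sampleMean μ N (SL l) ≤ 32 / 5 * (√2 * B) := by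
    calc _ ≤ ∑ l ∈ Finset.range K, 4 * (√2 * B) * (3 / 8 : ℝ) ^ l := by
          refine Finset.sum_le_sum fun l hl => ?_
          have := mul_le_mul_of_nonneg_left (bSL l hl) (show (0 : ℝ) ≤ (3 / 2) ^ l by positivity)
          refine this.trans (le_of_eq ?_)
          rw [show (3 / 8 : ℝ) = 3 / 2 * (1 / 4) by norm_num, mul_pow]
          ring
      _ ≤ 4 * (√2 * B) * (1 - 3 / 8)⁻¹ := by
          rw [← Finset.mul_sum]
          gcongr
          exact geom_sum_le (by norm_num) (by norm_num) K
      _ = _ := by norm_num; ring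
  have c2 : ∑ k ∈ Finset.range (K + 1), (3 / 2) ^ k * sampleMean μ N (ST k) ≤
      32 * (√2 * B) := by
    calc _ ≤ ∑ l ∈ Finset.range (K + 1), 8 * (√2 * B) * (3 / 4 : ℝ) ^ l := by
          refine Finset.sum_le_sum fun l hl => ?_
          have := mul_le_mul_of_nonneg_left (bST l hl) (show (0 : ℝ) ≤ (3 / 2) ^ l by positivity)
          refine this.trans (le_of_eq ?_)
          rw [show (3 / 4 : ℝ) = 3 / 2 * (1 / 2) by norm_num, mul_pow]
          ring
      _ ≤ 8 * (√2 * B) * (1 - 3 / 4)⁻¹ := by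
          rw [← Finset.mul_sum]
          gcongr
          exact geom_sum_le (by norm_num) (by norm_num) _
      _ = _ := by norm_num; ring
  have goal : ∑ a, μ a * ∑ i, dev i a = 2 * ∑ i, (1 / 2) * ∑ a, μ a * dev i a := by
    simp only [Finset.mul_sum]
    rw [Finset.sum_comm]
    exact Finset.sum_congr rfl fun _ _ => Finset.sum_congr rfl fun _ _ => by ring
  change ∑ a, μ a * ∑ i, dev i a ≤ _
  rw [goal]
  -- The three contributions are A, (3/2)(32/5)A and (3/2)·32. The first two add up to less than
  -- 11A, the last is 48, and the outer factor 2 undoes the probability 1/2.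
  unfold averageConst
  have t := hsumA.trans total
  have d0 := mul_le_mul_of_nonneg_left c0 (show (0 : ℝ) ≤ A by linarith)
  have d1 := mul_le_mul_of_nonneg_left c1 (show (0 : ℝ) ≤ 3 / 2 * A by linarith)
  have d3 : 0 ≤ A * (√2 * B) := mul_nonneg (by linarith) hB2
  nlinarith

end Averaging

/-! ### Minimax and compactness: one multiplier for all weights -/

/-- A form of the minimax theorem for finitely many rows. -/
theorem exists_mixture {T F : Type*} [Fintype F] [Nonempty F] (M : F → T → ℝ) {c c' : ℝ}
    (hc : c < c')
    (h : ∀ μ : F → ℝ, (∀ a, 0 ≤ μ a) → ∑ a, μ a = 1 → ∃ t, ∑ a, μ a * M a t ≤ c) :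
    ∃ (κ : Type) (s : Finset κ) (ν : κ → ℝ) (z : κ → T), (∀ k ∈ s, 0 ≤ ν k) ∧
      ∑ k ∈ s, ν k = 1 ∧ ∀ a, ∑ k ∈ s, ν k * M a (z k) ≤ c' := by
  classical
  set S : Set (F → ℝ) := {v | ∀ a, v a < c'} with hS
  set col : T → F → ℝ := fun t a => M a t with hcol
  -- If the open orthant S misses the convex hull of the columns, a separating functional, once
  -- normalised, is a distribution μ that contradicts the hypothesis.
  by_cases hd : Disjoint S (convexHull ℝ (Set.range col))
  · exfalso
    have hSo : IsOpen S := by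
      have : S = Set.univ.pi fun _ => Set.Iio c' := by ext; simp [hS]
      rw [this]
      exact isOpen_set_pi Set.finite_univ fun _ _ => isOpen_Iio
    have hSc : Convex ℝ S := by
      have : S = Set.univ.pi fun _ => Set.Iio c' := by ext; simp [hS]
      rw [this]
      exact convex_pi fun _ _ => convex_Iio c'
    obtain ⟨f, u, hfu, huf⟩ := geometric_hahn_banach_open hSc hSo (convex_convexHull ℝ _) hd
    set l : F → ℝ := fun a => f (Pi.single a 1) with hl
    have hf : ∀ v : F → ℝ, f v = ∑ a, l a * v a := by
      intro v
      conv_lhs => rw [pi_eq_sum_univ' v]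
      rw [map_sum]
      refine Finset.sum_congr rfl fun a _ => ?_
      rw [map_smul, smul_eq_mul, mul_comm]
    have hcolu : ∀ t, u ≤ ∑ a, l a * M a t := fun t => by
      have := huf _ (subset_convexHull ℝ _ ⟨t, rfl⟩)
      rwa [hf] at this
    -- S contains the rays in the directions -e_a, along which a functional with a negative
    -- coefficient would be unbounded above.
    have hl0 : ∀ a, 0 ≤ l a := by
      intro a
      by_contra hneg
      push Not at hneg
      set v0 : F → ℝ := fun _ => c' - 1
      set τ : ℝ := (|u - f v0| + 1) / (-l a) with hτ
      have hτ0 : 0 ≤ τ := div_nonneg (by positivity) (by linarith)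
      have h1 := hfu (v0 - τ • Pi.single a 1) (by
        intro b
        have : 0 ≤ (Pi.single a (1 : ℝ) : F → ℝ) b := by
          by_cases hb : b = a
          · subst hb; simp
          · simp [hb]
        simp only [Pi.sub_apply, Pi.smul_apply, smul_eq_mul, v0]
        nlinarith [mul_nonneg hτ0 this])
      rw [map_sub, map_smul, smul_eq_mul] at h1
      have h2 : τ * l a = -(|u - f v0| + 1) := by
        rw [hτ, div_neg, neg_mul, div_mul_cancel₀ _ hneg.ne]
      change f v0 - τ * l a < u at h1
      rw [h2] at h1
      linarith [le_abs_self (u - f v0)]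
    have hsum0 : 0 ≤ ∑ a, l a := Finset.sum_nonneg fun a _ => hl0 a
    have hconst : ∀ d < c', d * ∑ a, l a < u := by
      intro d hd
      have := hfu (fun _ => d) (fun _ => hd)
      rw [hf, ← Finset.sum_mul] at this
      linarith
    rcases hsum0.eq_or_lt with h0 | hpos
    -- The zero functional is excluded: it gives 0 < u on S and u ≤ 0 at any column; a column exists
    -- by the hypothesis at a point mass.
    · have hz : ∀ a, l a = 0 := fun a =>
        (Finset.sum_eq_zero_iff_of_nonneg fun a _ => hl0 a).1 h0.symm a (Finset.mem_univ a)
      obtain ⟨a0⟩ := ‹Nonempty F›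
      obtain ⟨t, -⟩ := h (Pi.single a0 1) (fun a => by
        by_cases hb : a = a0
        · subst hb; simp
        · simp [hb]) (by simp)
      have h1 := hcolu t
      have h2 := hconst (c' - 1) (by linarith)
      rw [← h0, mul_zero] at h2
      simp only [hz, zero_mul, Finset.sum_const_zero] at h1
      linarith
    · obtain ⟨t, ht⟩ := h (fun a => l a / ∑ a, l a) (fun a => div_nonneg (hl0 a) hsum0)
        (by rw [← Finset.sum_div, div_self hpos.ne'])
      have h1 := hcolu t
      -- Any number strictly between c and c' would do.
      have h2 := hconst ((c + c') / 2) (by linarith)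
      have h3 : ∑ a, l a / (∑ a, l a) * M a t = (∑ a, l a * M a t) / ∑ a, l a := by
        rw [Finset.sum_div]
        exact Finset.sum_congr rfl fun _ _ => by ring
      rw [h3, div_le_iff₀ hpos] at ht
      nlinarith
  · rw [Set.not_disjoint_iff] at hd
    obtain ⟨v, hv, hvc⟩ := hd
    rw [convexHull_eq] at hvc
    obtain ⟨κ, s, ν, y, hν, hν1, hy, hvy⟩ := hvc
    have hT : Nonempty T := by
      obtain ⟨k, hk⟩ : s.Nonempty := by
        by_contra hne
        rw [Finset.not_nonempty_iff_eq_empty] at hne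
        simp [hne] at hν1
      obtain ⟨t, -⟩ := hy k hk
      exact ⟨t⟩
    have : ∀ k, ∃ t, k ∈ s → col t = y k := by
      intro k
      by_cases hk : k ∈ s
      · obtain ⟨t, ht⟩ := hy k hk
        exact ⟨t, fun _ => ht⟩
      · exact ⟨hT.some, fun h => absurd h hk⟩
    choose z hz using this
    refine ⟨κ, s, ν, z, hν, hν1, fun a => ?_⟩
    have h1 := hv a
    rw [← hvy, Finset.centerMass_eq_of_sum_1 _ _ hν1, Finset.sum_apply] at h1
    refine le_of_eq_of_le (Finset.sum_congr rfl fun k hk => ?_) h1.le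
    rw [← hz k hk]
    rfl

/-- The constant in `exists_common_multiplier`. -/
def commonConst (A : ℝ) : ℝ := (5 / 2 * A + 9 / 4) * (2 * averageConst A)

theorem averageConst_pos {A : ℝ} (hA : 1 ≤ A) : 0 < averageConst A := by
  unfold averageConst
  have : 0 < √(2 : ℝ) := by positivity
  have : 0 < 11 * A + 48 := by linarith
  positivity

/-- By `averaging_estimate` the barycentre answers every distribution on the family, so minimax
provides a mixture of weights G that is good for all members at once. As |·|^r need not be convex,
the mixture is not averaged: in each coordinate it is replaced by the one of its values nearest, in
mean, to the others. -/
theorem exists_multiplier_finite {V ι F : Type*} [SeminormedAddCommGroup V] [Fintype ι]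
    [Fintype F] [Nonempty F] {r A : ℝ} (hr : 0 < r) (hA1 : 1 ≤ A)
    (hA : ∀ a b : ℝ, 0 ≤ a → 0 ≤ b → (a + b) ^ r ≤ A * a ^ r + 3 / 2 * b ^ r)
    {w : ι → ℝ} (hw : ∀ i, 0 ≤ w i) {φ : (ι → ℝ) → ι → V} {B : ℝ} (hB : 0 < B)
    (hs : ∀ t : ℝ, 0 < t → ∀ G : ι → ℝ, (∀ i, 0 < G i) → φ (fun i => t * G i) = φ G)
    (hφ : ∀ G H : ι → ℝ, (∀ i, 0 < G i) → (∀ i, G i ≤ H i) →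
      ∑ i, w i * √(G i) * ‖φ G i - φ H i‖ ^ r ≤ B * √(∑ i, H i))
    {γ : F → ι → ℝ} (hγ : ∀ a i, 0 < γ a i) (hγ1 : ∀ a, ∑ i, γ a i ≤ 1) :
    ∃ m : ι → V, ∀ a, ∑ i, w i * √(γ a i) * ‖φ (γ a) i - m i‖ ^ r ≤ commonConst A * B := by
  classical
  have hc := mul_pos (averageConst_pos hA1) hB
  obtain ⟨κ, s, ν, z, hν, hν1, hM⟩ := exists_mixture
    (fun a (G : ι → ℝ) => ∑ i, w i * √(γ a i) * ‖φ (γ a) i - φ G i‖ ^ r)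
    (c := averageConst A * B) (c' := 2 * (averageConst A * B)) (by linarith)
    (fun μ hμ hμ1 => ⟨_, averaging_estimate hr hA1 hA hw hB.le hs hφ hμ hμ1 hγ hγ1⟩)
  have hsne : s.Nonempty := by
    by_contra hne
    rw [Finset.not_nonempty_iff_eq_empty] at hne
    simp [hne] at hν1
  have hmin : ∀ i, ∃ k0 ∈ s, ∀ k' ∈ s, ∑ k ∈ s, ν k * ‖φ (z k) i - φ (z k0) i‖ ^ r ≤
      ∑ k ∈ s, ν k * ‖φ (z k) i - φ (z k') i‖ ^ r := fun i =>
    s.exists_min_image (fun k' => ∑ k ∈ s, ν k * ‖φ (z k) i - φ (z k') i‖ ^ r) hsne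
  choose k0 hk0 hk0min using hmin
  refine ⟨fun i => φ (z (k0 i)) i, fun a => ?_⟩
  set e : ι → ℝ := fun i => ∑ k ∈ s, ν k * ‖φ (γ a) i - φ (z k) i‖ ^ r with he
  have hpt : ∀ i, ‖φ (γ a) i - φ (z (k0 i)) i‖ ^ r ≤ (5 / 2 * A + 9 / 4) * e i := by
    intro i
    -- The minimum over k' is at most the ν-average over k', and that average is controlled through
    -- the point φ(γ a).
    have h1 : ∑ k ∈ s, ν k * ‖φ (z k) i - φ (z (k0 i)) i‖ ^ r ≤ (A + 3 / 2) * e i := by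
      have h2 : ∀ k' ∈ s, ν k' * ∑ k ∈ s, ν k * ‖φ (z k) i - φ (z (k0 i)) i‖ ^ r ≤
          ν k' * (A * e i + 3 / 2 * ‖φ (γ a) i - φ (z k') i‖ ^ r) := by
        intro k' hk'
        refine mul_le_mul_of_nonneg_left ((hk0min i k' hk').trans ?_) (hν k' hk')
        calc _ ≤ ∑ k ∈ s, ν k * (A * ‖φ (γ a) i - φ (z k) i‖ ^ r +
              3 / 2 * ‖φ (γ a) i - φ (z k') i‖ ^ r) := by
              refine Finset.sum_le_sum fun k hk => mul_le_mul_of_nonneg_left ?_ (hν k hk)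
              rw [norm_sub_rev (φ (γ a) i) (φ (z k) i)]
              exact norm_rpow_sub_le hr hA _ _ _
          _ = _ := by
              simp only [mul_add, Finset.sum_add_distrib]
              congr 1
              · rw [he, Finset.mul_sum]
                exact Finset.sum_congr rfl fun _ _ => by ring
              · rw [← Finset.sum_mul, hν1, one_mul]
      have h3 := Finset.sum_le_sum h2
      rw [← Finset.sum_mul, hν1, one_mul] at h3
      refine h3.trans (le_of_eq ?_)
      simp only [mul_add, Finset.sum_add_distrib]
      rw [← Finset.sum_mul, hν1, one_mul, add_mul]
      congr 1
      rw [he, Finset.mul_sum]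
      exact Finset.sum_congr rfl fun _ _ => by ring
    have h4 : ∑ k ∈ s, ν k * ‖φ (γ a) i - φ (z (k0 i)) i‖ ^ r ≤
        ∑ k ∈ s, ν k * (A * ‖φ (γ a) i - φ (z k) i‖ ^ r +
          3 / 2 * ‖φ (z k) i - φ (z (k0 i)) i‖ ^ r) :=
      Finset.sum_le_sum fun k hk =>
        mul_le_mul_of_nonneg_left (norm_rpow_sub_le hr hA _ _ _) (hν k hk)
    rw [← Finset.sum_mul, hν1, one_mul] at h4
    have h5 : ∑ k ∈ s, ν k * (A * ‖φ (γ a) i - φ (z k) i‖ ^ r +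
          3 / 2 * ‖φ (z k) i - φ (z (k0 i)) i‖ ^ r) =
        A * e i + 3 / 2 * ∑ k ∈ s, ν k * ‖φ (z k) i - φ (z (k0 i)) i‖ ^ r := by
      simp only [he, mul_add, Finset.sum_add_distrib, Finset.mul_sum]
      congr 1 <;> exact Finset.sum_congr rfl fun _ _ => by ring
    rw [h5] at h4
    linarith
  have hsum : ∑ i, w i * √(γ a i) * e i ≤ 2 * (averageConst A * B) := by
    refine le_of_eq_of_le ?_ (hM a)
    simp only [he, Finset.mul_sum]
    rw [Finset.sum_comm]
    exact Finset.sum_congr rfl fun _ _ => Finset.sum_congr rfl fun _ _ => by ring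
  calc _ ≤ ∑ i, w i * √(γ a i) * ((5 / 2 * A + 9 / 4) * e i) := by
        refine Finset.sum_le_sum fun i _ => ?_
        have := hw i
        exact mul_le_mul_of_nonneg_left (hpt i) (by positivity)
    _ = (5 / 2 * A + 9 / 4) * ∑ i, w i * √(γ a i) * e i := by
        rw [Finset.mul_sum]
        exact Finset.sum_congr rfl fun _ _ => by ring
    _ ≤ (5 / 2 * A + 9 / 4) * (2 * (averageConst A * B)) := by
        gcongr
    _ = _ := by unfold commonConst; ring

/-- The admissible m for a given G form a closed set. Finite intersections are nonempty by
`exists_multiplier_finite`, applied to the weights normalised to total mass 1, which changes no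
φ(G). Compactness passes to all G, since the constant does not depend on the size of the family. -/
theorem exists_common_multiplier {V ι : Type*} [NormedAddCommGroup V] [ProperSpace V] [Fintype ι]
    {r A : ℝ} (hr : 0 < r) (hA1 : 1 ≤ A)
    (hA : ∀ a b : ℝ, 0 ≤ a → 0 ≤ b → (a + b) ^ r ≤ A * a ^ r + 3 / 2 * b ^ r)
    {w : ι → ℝ} (hw : ∀ i, 0 < w i) {φ : (ι → ℝ) → ι → V} {B : ℝ} (hB : 0 < B)
    (hs : ∀ t : ℝ, 0 < t → ∀ G : ι → ℝ, (∀ i, 0 < G i) → φ (fun i => t * G i) = φ G)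
    (hφ : ∀ G H : ι → ℝ, (∀ i, 0 < G i) → (∀ i, G i ≤ H i) →
      ∑ i, w i * √(G i) * ‖φ G i - φ H i‖ ^ r ≤ B * √(∑ i, H i)) :
    ∃ m : ι → V, ∀ G : ι → ℝ, (∀ i, 0 < G i) →
      ∑ i, w i * √(G i) * ‖φ G i - m i‖ ^ r ≤ commonConst A * B * √(∑ i, G i) := by
  classical
  rcases isEmpty_or_nonempty ι with hι | hι
  · exact ⟨fun _ => 0, fun G _ => by simp⟩
  set D := commonConst A * B with hD
  set S : {G : ι → ℝ // ∀ i, 0 < G i} → Set (ι → V) := fun G =>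
    {m | ∑ i, w i * √(G.1 i) * ‖φ G.1 i - m i‖ ^ r ≤ D * √(∑ i, G.1 i)} with hSdef
  have hclosed : ∀ G, IsClosed (S G) := by
    intro G
    refine isClosed_le ?_ continuous_const
    refine continuous_finsetSum _ fun i _ => continuous_const.mul ?_
    exact ((continuous_const.sub (continuous_apply i)).norm).rpow_const fun _ => Or.inr hr.le
  have hfin : ∀ u : Finset {G : ι → ℝ // ∀ i, 0 < G i}, u.Nonempty → (⋂ G ∈ u, S G).Nonempty := by
    intro u hu
    have : Nonempty u := hu.to_subtype
    have hpos : ∀ G : u, 0 < ∑ i, G.1.1 i := fun G =>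
      Finset.sum_pos (fun i _ => G.1.2 i) Finset.univ_nonempty
    obtain ⟨m, hm⟩ := exists_multiplier_finite hr hA1 hA (fun i => (hw i).le) hB hs hφ
      (γ := fun (G : u) i => (∑ i, G.1.1 i)⁻¹ * G.1.1 i)
      (fun G i => mul_pos (inv_pos.2 (hpos G)) (G.1.2 i))
      (fun G => by rw [← Finset.mul_sum, inv_mul_cancel₀ (hpos G).ne'])
    refine ⟨m, Set.mem_iInter₂.2 fun G hG => ?_⟩
    have h := hm ⟨G, hG⟩
    have hp := hpos ⟨G, hG⟩
    simp only at h hp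
    rw [hs _ (inv_pos.2 hp) _ G.2] at h
    change ∑ i, w i * √(G.1 i) * ‖φ G.1 i - m i‖ ^ r ≤ D * √(∑ i, G.1 i)
    have hsq : 0 < √(∑ i, G.1 i) := Real.sqrt_pos.2 hp
    rw [← div_le_iff₀ hsq]
    refine le_of_eq_of_le ?_ h
    rw [Finset.sum_div]
    refine Finset.sum_congr rfl fun i _ => ?_
    rw [Real.sqrt_mul (inv_pos.2 hp).le, Real.sqrt_inv]
    ring
  have hone : ∀ i : ι, (0 : ℝ) < (fun _ => 1 : ι → ℝ) i := fun _ => one_pos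
  -- One weight already gives a compact set: for G = 1 every coordinate of m is bounded, because w_i
  -- > 0.
  set G0 : {G : ι → ℝ // ∀ i, 0 < G i} := ⟨fun _ => 1, hone⟩
  have hcompact : IsCompact (S G0) := by
    set E := D * √(∑ i : ι, (1 : ℝ)) with hE
    refine IsCompact.of_isClosed_subset
      (isCompact_univ_pi fun i => isCompact_closedBall (φ G0.1 i) ((E / w i) ^ (1 / r)))
      (hclosed G0) fun m hm => ?_
    rw [Set.mem_univ_pi]
    intro i
    rw [Metric.mem_closedBall, dist_comm, dist_eq_norm]
    have h1 : w i * ‖φ G0.1 i - m i‖ ^ r ≤ E := by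
      have h2 : ∑ i, w i * √(G0.1 i) * ‖φ G0.1 i - m i‖ ^ r ≤ E := hm
      refine le_trans ?_ h2
      have h3 := Finset.single_le_sum (f := fun i => w i * √(G0.1 i) * ‖φ G0.1 i - m i‖ ^ r)
        (fun i _ => by have := hw i; positivity) (Finset.mem_univ i)
      simpa [G0] using h3
    have h4 : ‖φ G0.1 i - m i‖ ^ r ≤ E / w i := by
      rw [le_div_iff₀ (hw i)]; linarith
    calc ‖φ G0.1 i - m i‖ = (‖φ G0.1 i - m i‖ ^ r) ^ (1 / r) := by
          rw [← Real.rpow_mul (norm_nonneg _), mul_one_div_cancel hr.ne', Real.rpow_one]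
      _ ≤ _ := Real.rpow_le_rpow (by positivity) h4 (by positivity)
  obtain ⟨m, -, hm⟩ := hcompact.inter_iInter_nonempty S hclosed fun u => by
    obtain ⟨m, hm⟩ := hfin (insert G0 u) (Finset.insert_nonempty _ _)
    rw [Finset.set_biInter_insert] at hm
    exact ⟨m, hm⟩
  exact ⟨m, fun G hG => Set.mem_iInter.1 hm ⟨G, hG⟩⟩

/-! ### Finitely supported sequences and the majorants built from a weight -/

section FiniteSequences

variable {𝕜 : Type u} [RCLike 𝕜] {p : ℝ≥0∞}

/-- A finitely supported sequence as an element of `ℓ_p⁰`. -/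
def finSeq (f : ℕ → 𝕜) (hf : (Function.support f).Finite) : EllpFin 𝕜 p :=
  ⟨⟨f, (memℓp_zero hf).of_exponent_ge zero_le⟩, hf⟩

/-- The pointwise product of a finitely supported sequence with an arbitrary sequence. -/
def ptMul (m : ℕ → 𝕜) (x : EllpFin 𝕜 p) : EllpFin 𝕜 p :=
  finSeq (fun i => x.1 i * m i) (x.2.subset fun _ hi h => hi (mul_eq_zero_of_left h _))

theorem ptMul_apply (m : ℕ → 𝕜) (x : EllpFin 𝕜 p) (i : ℕ) :
    (ptMul m x).1 i = x.1 i * m i := rfl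

variable [Fact (0 < p)] [Fact (p < ∞)]

theorem norm_rpow_eq_sum (x : Ellp 𝕜 p) (s : Finset ℕ) (h : ∀ i ∉ s, x i = 0) :
    ‖x‖ ^ p.toReal = ∑ i ∈ s, ‖x i‖ ^ p.toReal := by
  have hp := toReal_pos p
  rw [lp.norm_rpow_eq_tsum hp]
  refine tsum_eq_sum fun i hi => ?_
  rw [h i hi, norm_zero, Real.zero_rpow hp.ne']

theorem norm_rpow_le_of_sum_le {x : Ellp 𝕜 p} {M : ℝ}
    (h : ∀ s : Finset ℕ, ∑ i ∈ s, ‖x i‖ ^ p.toReal ≤ M) : ‖x‖ ^ p.toReal ≤ M := by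
  rw [lp.norm_rpow_eq_tsum (toReal_pos p)]
  exact ((lp.memℓp x).summable (toReal_pos p)).tsum_le_of_sum_le h

theorem norm_sub_rpow_le {A : ℝ}
    (hA : ∀ a b : ℝ, 0 ≤ a → 0 ≤ b → (a + b) ^ p.toReal ≤ A * a ^ p.toReal + 3 / 2 * b ^ p.toReal)
    (hA1 : 1 ≤ A) (x y z : Ellp 𝕜 p) :
    ‖x - z‖ ^ p.toReal ≤ A * ‖x - y‖ ^ p.toReal + 3 / 2 * ‖y - z‖ ^ p.toReal := by
  have hp := toReal_pos p
  refine norm_rpow_le_of_sum_le fun s => ?_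
  have h1 := lp.sum_rpow_le_norm_rpow hp (x - y) s
  have h2 := lp.sum_rpow_le_norm_rpow hp (y - z) s
  calc _ ≤ ∑ i ∈ s, (A * ‖(x - y) i‖ ^ p.toReal + 3 / 2 * ‖(y - z) i‖ ^ p.toReal) :=
        Finset.sum_le_sum fun i _ => norm_rpow_sub_le hp hA (x i) (y i) (z i)
    _ ≤ _ := by
        rw [Finset.sum_add_distrib, ← Finset.mul_sum, ← Finset.mul_sum]
        gcongr

namespace Centralizer

/-- Apply the centralizer estimate to a = x/h, which has norm at most 1. Where h vanishes so does x,
and division by zero gives a = 0 there, so that ah = x still holds. -/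
theorem exists_bound (Φ : Centralizer 𝕜 p) : ∃ C : ℝ, 1 ≤ C ∧ ∀ x h : EllpFin 𝕜 p,
    (∀ i, ‖x.1 i‖ ≤ ‖h.1 i‖) → ∀ s : Finset ℕ,
    ∑ i ∈ s, ‖Φ.toFun x i - x.1 i / h.1 i * Φ.toFun h i‖ ^ p.toReal ≤
      C ^ p.toReal * ‖h.1‖ ^ p.toReal := by
  obtain ⟨C, hC⟩ := Φ.estimate
  have hp := toReal_pos p
  refine ⟨max C 1, le_max_right _ _, fun x h hxh s => ?_⟩
  have hb : ∀ i, ‖x.1 i / h.1 i‖ ≤ 1 := fun i => by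
    rw [norm_div]
    exact div_le_one_of_le₀ (hxh i) (norm_nonneg _)
  let a : Ellp 𝕜 ∞ := ⟨fun i => x.1 i / h.1 i,
    memℓp_infty ⟨1, by rintro _ ⟨i, rfl⟩; exact hb i⟩⟩
  have ha : ‖a‖ ≤ 1 := lp.norm_le_of_forall_le zero_le_one hb
  have hax : ellMulFin a h = x := by
    refine Subtype.ext (lp.ext (funext fun i => ?_))
    change x.1 i / h.1 i * h.1 i = x.1 i
    rcases eq_or_ne (h.1 i) 0 with h0 | h0
    · have h1 := hxh i
      rw [h0, norm_zero] at h1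
      rw [h0, mul_zero, norm_le_zero_iff.1 h1]
    · exact div_mul_cancel₀ _ h0
  have h1 := hC a h
  rw [hax] at h1
  have h0 := lp.norm_nonneg' h.1
  have h2 : ‖Φ.toFun x - ellMul a (Φ.toFun h)‖ ≤ max C 1 * ‖h.1‖ := by
    refine h1.trans ?_
    calc C * ‖a‖ * ‖h.1‖ ≤ max C 1 * 1 * ‖h.1‖ := by
          gcongr
          exact le_max_left _ _
      _ = _ := by ring
  rw [← Real.mul_rpow (by positivity) h0]
  refine (lp.sum_rpow_le_norm_rpow hp (Φ.toFun x - ellMul a (Φ.toFun h)) s).trans ?_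
  exact Real.rpow_le_rpow (lp.norm_nonneg' _) h2 hp.le

theorem map_zero (Φ : Centralizer 𝕜 p) : Φ.toFun 0 = 0 := by
  have := Φ.map_smul 0 0
  simpa using this

/-- The majorant `√(|x|^p G)^{1/p}` of the proof of `exists_multiplier_at`. -/
def scaled (x : EllpFin 𝕜 p) (G : ℕ → ℝ) (i : ℕ) : ℝ :=
  (√(‖x.1 i‖ ^ p.toReal * G i)) ^ (1 / p.toReal)

theorem scaled_nonneg (x : EllpFin 𝕜 p) (G : ℕ → ℝ) (i : ℕ) : 0 ≤ scaled x G i := by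
  unfold scaled; positivity

theorem scaled_rpow (x : EllpFin 𝕜 p) (G : ℕ → ℝ) (i : ℕ) :
    scaled x G i ^ p.toReal = √(‖x.1 i‖ ^ p.toReal * G i) := by
  unfold scaled
  rw [← Real.rpow_mul (Real.sqrt_nonneg _), one_div_mul_cancel (toReal_pos p).ne', Real.rpow_one]

theorem scaled_zero (x : EllpFin 𝕜 p) (G : ℕ → ℝ) {i : ℕ} (h : x.1 i = 0) : scaled x G i = 0 := by
  have hp := toReal_pos p
  unfold scaled
  rw [h, norm_zero, Real.zero_rpow hp.ne', zero_mul, Real.sqrt_zero,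
    Real.zero_rpow (one_div_pos.2 hp).ne']

theorem scaled_pos (x : EllpFin 𝕜 p) {G : ℕ → ℝ} {i : ℕ} (h : x.1 i ≠ 0) (hG : 0 < G i) :
    0 < scaled x G i := by
  unfold scaled
  have := norm_pos_iff.2 h
  positivity

theorem scaled_mono (x : EllpFin 𝕜 p) {G H : ℕ → ℝ} {i : ℕ} (h : G i ≤ H i) :
    scaled x G i ≤ scaled x H i := by
  unfold scaled
  have := toReal_pos p
  gcongr

/-- `scaled x G` as an element of `ℓ_p⁰`. -/
def scaledSeq (x : EllpFin 𝕜 p) (G : ℕ → ℝ) : EllpFin 𝕜 p :=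
  finSeq (fun i => (scaled x G i : 𝕜)) (x.2.subset fun i hi h => hi (by
    simp only [scaled_zero x G h, RCLike.ofReal_zero]))

theorem norm_scaledSeq_apply (x : EllpFin 𝕜 p) (G : ℕ → ℝ) (i : ℕ) :
    ‖(scaledSeq x G).1 i‖ = scaled x G i := by
  change ‖(scaled x G i : 𝕜)‖ = _
  rw [RCLike.norm_ofReal, abs_of_nonneg (scaled_nonneg _ _ _)]

/-- Cauchy–Schwarz. This is the inequality that exchanges ℓ_p for a weighted ℓ_{2p}. -/
theorem norm_scaledSeq_le (x : EllpFin 𝕜 p) {G : ℕ → ℝ} (hG : ∀ i, 0 ≤ G i) (s : Finset ℕ)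
    (hs : ∀ i ∉ s, x.1 i = 0) :
    ‖(scaledSeq x G).1‖ ^ p.toReal ≤ √(‖x.1‖ ^ p.toReal) * √(∑ i ∈ s, G i) := by
  rw [norm_rpow_eq_sum (scaledSeq x G).1 s (fun i hi => by
      have : (scaledSeq x G).1 i = (scaled x G i : 𝕜) := rfl
      rw [this, scaled_zero x G (hs i hi), RCLike.ofReal_zero]),
    norm_rpow_eq_sum x.1 s hs]
  simp only [norm_scaledSeq_apply, scaled_rpow]
  refine le_of_eq_of_le (Finset.sum_congr rfl fun i _ => ?_)
    (Real.sum_sqrt_mul_sqrt_le s (fun i => by positivity) hG)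
  rw [Real.sqrt_mul (by positivity)]

theorem scaledSeq_smul (x : EllpFin 𝕜 p) {t : ℝ} (ht : 0 < t) (G : ℕ → ℝ) :
    scaledSeq x (fun i => t * G i) =
      (((√t) ^ (1 / p.toReal) : ℝ) : 𝕜) • scaledSeq x G := by
  refine Subtype.ext (lp.ext (funext fun i => ?_))
  change (scaled x (fun i => t * G i) i : 𝕜) = (((√t) ^ (1 / p.toReal) : ℝ) : 𝕜) * (scaled x G i : 𝕜)
  rw [← RCLike.ofReal_mul]
  congr 1
  unfold scaled
  rw [mul_left_comm, Real.sqrt_mul ht.le, Real.mul_rpow (by positivity) (by positivity)]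

end Centralizer

end FiniteSequences

/-! ### Multipliers that approximate a centralizer -/

namespace Centralizer

variable {𝕜 : Type u} [RCLike 𝕜] {p : ℝ≥0∞} [Fact (0 < p)] [Fact (p < ∞)]

/-- For fixed x, let h_G be the majorant of the weight G, so that h_G^r = √(|x|^r G), and let φ(G) =
Φ(h_G)/h_G. A common m for all φ(G) works: given y, choose G so that |y| ≤ h_G; then Φ(y) is close
to (y/h_G)Φ(h_G) = yφ(G), which is close to ym. -/
theorem exists_multiplier_at (Φ : Centralizer 𝕜 p) : ∃ C : ℝ, 0 ≤ C ∧ ∀ x : EllpFin 𝕜 p,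
    ∃ m : ℕ → 𝕜, ∀ y : EllpFin 𝕜 p, (∀ i, x.1 i = 0 → y.1 i = 0) →
    ∀ s : Finset ℕ, (∀ i ∉ s, x.1 i = 0) →
    (‖Φ.toFun y - (ptMul m y).1‖ ^ p.toReal) ^ 2 ≤
      C * (‖x.1‖ ^ p.toReal * ∑ i ∈ s, (‖y.1 i‖ ^ p.toReal) ^ 2 / ‖x.1 i‖ ^ p.toReal) := by
  classical
  have hp := toReal_pos p
  obtain ⟨A, hA1, hA⟩ := exists_add_rpow_le hp
  obtain ⟨C, hC1, hC⟩ := Φ.exists_bound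
  set r := p.toReal with hr
  have hK : 0 < commonConst A := by
    unfold commonConst
    have := averageConst_pos hA1
    have : 0 < 5 / 2 * A + 9 / 4 := by linarith
    positivity
  set D : ℝ := A * C ^ r + 3 / 2 * (commonConst A * C ^ r) with hD
  have hCr : 0 < C ^ r := Real.rpow_pos_of_pos (by linarith) r
  have hD0 : 0 ≤ D := by positivity
  refine ⟨2 * D ^ 2, by positivity, fun x => ?_⟩
  rcases eq_or_ne x.1 0 with hx0 | hx0
  · refine ⟨fun _ => 0, fun y hy s hs => ?_⟩
    have hy0 : y = 0 := Subtype.ext (lp.ext (funext fun i => hy i (by rw [hx0]; rfl)))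
    have e : Φ.toFun y - (ptMul (fun _ => (0 : 𝕜)) y).1 = 0 := by
      rw [hy0, Φ.map_zero, zero_sub, neg_eq_zero]
      exact lp.ext (funext fun i => mul_zero _)
    rw [e, lp.norm_zero, Real.zero_rpow hp.ne']
    have := lp.norm_nonneg' x.1
    have : 0 ≤ ∑ i ∈ s, (‖y.1 i‖ ^ r) ^ 2 / ‖x.1 i‖ ^ r :=
      Finset.sum_nonneg fun i _ => by positivity
    simp only [ne_eq, OfNat.ofNat_ne_zero, not_false_eq_true, zero_pow]
    positivity
  have hfin : (Function.support fun i => x.1 i).Finite := x.2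
  set s0 : Finset ℕ := hfin.toFinset with hs0
  have hmem : ∀ i, i ∈ s0 ↔ x.1 i ≠ 0 := fun i => Set.Finite.mem_toFinset hfin
  have hnot : ∀ i ∉ s0, x.1 i = 0 := fun i hi => by
    by_contra h; exact hi ((hmem i).2 h)
  have hX : 0 < ‖x.1‖ ^ r := by
    refine Real.rpow_pos_of_pos (lt_of_le_of_ne (lp.norm_nonneg' _) fun h => hx0 ?_) r
    exact lp.norm_eq_zero_iff.1 h.symm
  set X := ‖x.1‖ ^ r with hXdef
  -- Weights live on the support of x and are extended by zero; the majorant vanishes off the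
  -- support in any case.
  let ex : (s0 → ℝ) → ℕ → ℝ := fun G i => if h : i ∈ s0 then G ⟨i, h⟩ else 0
  have hex : ∀ G (i : s0), ex G i = G i := fun G i => dif_pos i.2
  let φ : (s0 → ℝ) → s0 → 𝕜 := fun G i =>
    Φ.toFun (scaledSeq x (ex G)) i / (scaledSeq x (ex G)).1 i
  have hexsum : ∀ G : s0 → ℝ, ∑ i ∈ s0, ex G i = ∑ i, G i := by
    intro G
    rw [← Finset.sum_coe_sort s0]
    exact Finset.sum_congr rfl fun i _ => hex G i
  have hne : ∀ (G : s0 → ℝ), (∀ i, 0 < G i) → ∀ i : s0, (scaledSeq x (ex G)).1 i ≠ 0 := by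
    intro G hG i h
    have h1 := norm_scaledSeq_apply x (ex G) i
    rw [h, norm_zero] at h1
    exact (scaled_pos x ((hmem i).1 i.2) (by rw [hex]; exact hG i)).ne h1
  obtain ⟨m, hm⟩ := exists_common_multiplier (V := 𝕜) (ι := s0) hp hA1 hA
    (w := fun i => √(‖x.1 i‖ ^ r)) (φ := φ) (B := C ^ r * √X)
    (fun i => by have := norm_pos_iff.2 ((hmem i).1 i.2); positivity) (by positivity)
    -- Scaling G scales h_G by a positive constant, and Φ is homogeneous.
    (fun t ht G hG => by
      funext i
      have e : ex (fun i => t * G i) = fun i => t * ex G i := by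
        funext j
        simp only [ex]
        split_ifs <;> simp
      simp only [φ]
      rw [e, scaledSeq_smul x ht, Φ.map_smul]
      change (_ * Φ.toFun (scaledSeq x (ex G)) i) / (_ * (scaledSeq x (ex G)).1 i) = _
      refine mul_div_mul_left _ _ ?_
      rw [ne_eq, RCLike.ofReal_eq_zero]
      positivity)
    -- Multiplying φ(G) - φ(H) by h_G gives Φ(h_G) - (h_G/h_H)Φ(h_H), to which the centralizer
    -- estimate applies since h_G ≤ h_H; Cauchy–Schwarz bounds h_H.
    (fun G H hG hGH => by
      have hH : ∀ i, 0 < H i := fun i => (hG i).trans_le (hGH i)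
      have hle : ∀ i, ‖(scaledSeq x (ex G)).1 i‖ ≤ ‖(scaledSeq x (ex H)).1 i‖ := by
        intro i
        rw [norm_scaledSeq_apply, norm_scaledSeq_apply]
        refine scaled_mono x ?_
        simp only [ex]
        split_ifs
        · exact hGH _
        · exact le_rfl
      have h1 := hC _ _ hle s0
      have h2 := norm_scaledSeq_le x (G := ex H) (fun i => by
        simp only [ex]
        split_ifs
        · exact (hH _).le
        · exact le_rfl) s0 hnot
      rw [hexsum] at h2
      have h3 : ∑ i : s0, √(‖x.1 i‖ ^ r) * √(G i) * ‖φ G i - φ H i‖ ^ r =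
          ∑ i ∈ s0, ‖Φ.toFun (scaledSeq x (ex G)) i -
            (scaledSeq x (ex G)).1 i / (scaledSeq x (ex H)).1 i *
              Φ.toFun (scaledSeq x (ex H)) i‖ ^ r := by
        rw [← Finset.sum_coe_sort s0]
        refine Finset.sum_congr rfl fun i _ => ?_
        have e : Φ.toFun (scaledSeq x (ex G)) i -
            (scaledSeq x (ex G)).1 i / (scaledSeq x (ex H)).1 i *
              Φ.toFun (scaledSeq x (ex H)) i = (scaledSeq x (ex G)).1 i * (φ G i - φ H i) := by
          simp only [φ]
          have := hne G hG i
          rw [mul_sub, mul_div_cancel₀ _ this]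
          ring
        rw [e, norm_mul, Real.mul_rpow (norm_nonneg _) (norm_nonneg _), norm_scaledSeq_apply,
          scaled_rpow, hex, Real.sqrt_mul (by positivity)]
      rw [h3, mul_assoc]
      exact h1.trans (mul_le_mul_of_nonneg_left h2 hCr.le))
  let m' : ℕ → 𝕜 := fun i => if h : i ∈ s0 then m ⟨i, h⟩ else 0
  refine ⟨m', fun y hy s hs => ?_⟩
  have hy0 : ∀ i ∉ s0, y.1 i = 0 := fun i hi => hy i (hnot i hi)
  have hsub : s0 ⊆ s := fun i hi => by
    by_contra h; exact (hmem i).1 hi (hs i h)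
  set Q : ℝ := ∑ i ∈ s0, (‖y.1 i‖ ^ r) ^ 2 / ‖x.1 i‖ ^ r with hQ
  have hQ0 : 0 ≤ Q := Finset.sum_nonneg fun i _ => by positivity
  have hQs : Q ≤ ∑ i ∈ s, (‖y.1 i‖ ^ r) ^ 2 / ‖x.1 i‖ ^ r :=
    Finset.sum_le_sum_of_subset_of_nonneg hsub fun i _ _ => by positivity
  refine le_trans ?_ (mul_le_mul_of_nonneg_left (mul_le_mul_of_nonneg_left hQs hX.le)
    (by positivity))
  have hs0ne : s0.Nonempty := by
    by_contra h
    rw [Finset.not_nonempty_iff_eq_empty] at h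
    exact hx0 (lp.ext (funext fun i => hnot i (by simp [h])))
  have hcard : (0 : ℝ) < s0.card := by exact_mod_cast hs0ne.card_pos
  suffices hε : ∀ ε : ℝ, 0 < ε → ‖Φ.toFun y - (ptMul m' y).1‖ ^ r ≤ D * (√X * √(Q + ε)) by
    have hlim : Tendsto (fun ε : ℝ => D * (√X * √(Q + ε))) (𝓝[>] 0) (𝓝 (D * (√X * √(Q + 0)))) := by
      refine Tendsto.mono_left (Continuous.tendsto (f := fun ε : ℝ => D * (√X * √(Q + ε))) ?_ 0)
        nhdsWithin_le_nhds
      fun_prop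
    have h1 := ge_of_tendsto hlim (eventually_nhdsWithin_of_forall fun ε h => hε ε h)
    rw [add_zero] at h1
    have h2 := lp.norm_nonneg' (Φ.toFun y - (ptMul m' y).1)
    calc _ ≤ (D * (√X * √Q)) ^ 2 := by gcongr
      _ = D ^ 2 * (X * Q) := by
        rw [mul_pow, mul_pow, Real.sq_sqrt hX.le, Real.sq_sqrt hQ0]
      _ ≤ _ := by
        have : 0 ≤ D ^ 2 * (X * Q) := by positivity
        linarith
  intro ε hε
  -- The first term is what |y|^r ≤ √(|x|^r G) requires; the second makes G positive where y
  -- vanishes and has total mass ε, which tends to 0 at the end.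
  let G : s0 → ℝ := fun i => (‖y.1 i‖ ^ r) ^ 2 / ‖x.1 i‖ ^ r + ε / s0.card
  have hG : ∀ i, 0 < G i := fun i => by
    have : 0 < ε / s0.card := by positivity
    simp only [G]
    positivity
  have hGsum : ∑ i, G i = Q + ε := by
    simp only [G, Finset.sum_add_distrib, Finset.sum_const, Finset.card_univ,
      Fintype.card_coe, nsmul_eq_mul, hQ]
    rw [mul_div_cancel₀ _ hcard.ne', Finset.sum_coe_sort s0
      (fun i => (‖y.1 i‖ ^ r) ^ 2 / ‖x.1 i‖ ^ r)]
  have hyG : ∀ i : s0, ‖y.1 i‖ ^ r ≤ √(‖x.1 i‖ ^ r) * √(G i) := by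
    intro i
    have hxi : 0 < ‖x.1 i‖ ^ r := Real.rpow_pos_of_pos (norm_pos_iff.2 ((hmem i).1 i.2)) r
    rw [← Real.sqrt_mul hxi.le]
    refine Real.le_sqrt_of_sq_le ?_
    have h1 : (‖y.1 i‖ ^ r) ^ 2 / ‖x.1 i‖ ^ r ≤ G i := by
      simp only [G]
      have : 0 < ε / s0.card := by positivity
      linarith
    rw [div_le_iff₀ hxi] at h1
    linarith
  set h := scaledSeq x (ex G) with hh
  have hle : ∀ i, ‖y.1 i‖ ≤ ‖h.1 i‖ := by
    intro i
    by_cases hi : i ∈ s0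
    · have h1 := hyG ⟨i, hi⟩
      rw [hh, norm_scaledSeq_apply, ← Real.rpow_le_rpow_iff (norm_nonneg _)
        (scaled_nonneg _ _ _) hp, scaled_rpow, Real.sqrt_mul (by positivity)]
      have h2 := hex G ⟨i, hi⟩
      simp only at h2
      rw [h2]
      exact h1
    · rw [hy0 i hi, norm_zero]
      exact norm_nonneg _
  have hnorm := norm_scaledSeq_le x (G := ex G) (fun i => by
        simp only [ex]
        split_ifs
        · exact (hG _).le
        · exact le_rfl) s0 hnot
  rw [hexsum, hGsum] at hnorm
  have hmG := hm G hG
  rw [hGsum] at hmG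
  refine norm_rpow_le_of_sum_le fun t => ?_
  have h1 := hC y h hle t
  have hterm : ∀ i, ‖(Φ.toFun y - (ptMul m' y).1) i‖ ^ r ≤
      A * ‖Φ.toFun y i - y.1 i / h.1 i * Φ.toFun h i‖ ^ r +
      3 / 2 * ‖y.1 i / h.1 i * Φ.toFun h i - y.1 i * m' i‖ ^ r := fun i =>
    norm_rpow_sub_le hp hA (Φ.toFun y i) (y.1 i / h.1 i * Φ.toFun h i) (y.1 i * m' i)
  have h2 : ∑ i ∈ t, ‖y.1 i / h.1 i * Φ.toFun h i - y.1 i * m' i‖ ^ r ≤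
      ∑ i ∈ s0, ‖y.1 i / h.1 i * Φ.toFun h i - y.1 i * m' i‖ ^ r := by
    rw [← Finset.sum_filter_add_sum_filter_not t (· ∈ s0)]
    have z : ∑ i ∈ t with i ∉ s0, ‖y.1 i / h.1 i * Φ.toFun h i - y.1 i * m' i‖ ^ r = 0 := by
      refine Finset.sum_eq_zero fun i hi => ?_
      rw [hy0 i (Finset.mem_filter.1 hi).2]
      simp [Real.zero_rpow hp.ne']
    rw [z, add_zero]
    refine Finset.sum_le_sum_of_subset_of_nonneg (fun i hi => (Finset.mem_filter.1 hi).2)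
      fun i _ _ => by positivity
  have h3 : ∑ i ∈ s0, ‖y.1 i / h.1 i * Φ.toFun h i - y.1 i * m' i‖ ^ r ≤
      ∑ i : s0, √(‖x.1 i‖ ^ r) * √(G i) * ‖φ G i - m i‖ ^ r := by
    rw [← Finset.sum_coe_sort s0]
    refine Finset.sum_le_sum fun i _ => ?_
    have e : y.1 i / h.1 i * Φ.toFun h i - y.1 i * m' i = y.1 i * (φ G i - m i) := by
      have : m' i = m i := dif_pos i.2
      rw [this]
      simp only [φ]
      rw [← hh]
      ring
    rw [e, norm_mul, Real.mul_rpow (norm_nonneg _) (norm_nonneg _)]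
    exact mul_le_mul_of_nonneg_right (hyG i) (by positivity)
  calc _ ≤ ∑ i ∈ t, (A * ‖Φ.toFun y i - y.1 i / h.1 i * Φ.toFun h i‖ ^ r +
      3 / 2 * ‖y.1 i / h.1 i * Φ.toFun h i - y.1 i * m' i‖ ^ r) :=
        Finset.sum_le_sum fun i _ => hterm i
    _ = A * ∑ i ∈ t, ‖Φ.toFun y i - y.1 i / h.1 i * Φ.toFun h i‖ ^ r +
      3 / 2 * ∑ i ∈ t, ‖y.1 i / h.1 i * Φ.toFun h i - y.1 i * m' i‖ ^ r := by
        rw [Finset.sum_add_distrib, ← Finset.mul_sum, ← Finset.mul_sum]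
    _ ≤ A * (C ^ r * (√X * √(Q + ε))) +
        3 / 2 * (commonConst A * (C ^ r * √X) * √(Q + ε)) := by
        gcongr
        · exact h1.trans (mul_le_mul_of_nonneg_left hnorm hCr.le)
        · exact (h2.trans h3).trans hmG
    _ = _ := by rw [hD]; ring

/-- `φ` is a family of multipliers that approximate the centralizer `Φ`: the map
`y ↦ y φ x` is close to `Φ` on the sequences `y` that are small with respect to `|x|^{1/2}`. -/
def IsMultiplier (Φ : Centralizer 𝕜 p) (φ : EllpFin 𝕜 p → ℕ → 𝕜) : Prop :=
  (∀ (c : 𝕜) (x : EllpFin 𝕜 p), c ≠ 0 → φ (c • x) = φ x) ∧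
  ∃ C : ℝ, 0 ≤ C ∧ ∀ x y : EllpFin 𝕜 p, (∀ i, x.1 i = 0 → y.1 i = 0) →
    ∀ s : Finset ℕ, (∀ i ∉ s, x.1 i = 0) →
    (‖Φ.toFun y - (ptMul (φ x) y).1‖ ^ p.toReal) ^ 2 ≤
      C * (‖x.1‖ ^ p.toReal * ∑ i ∈ s, (‖y.1 i‖ ^ p.toReal) ^ 2 / ‖x.1 i‖ ^ p.toReal)

/-- The multiplier of x is taken at |x|/‖x‖, which depends on x only up to nonzero scalars. The
estimate survives because it involves x only through |x_i|^r / ‖x‖^r. -/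
theorem exists_isMultiplier (Φ : Centralizer 𝕜 p) : ∃ φ, IsMultiplier Φ φ := by
  have hp := toReal_pos p
  obtain ⟨C, hC0, hC⟩ := Φ.exists_multiplier_at
  choose m hm using hC
  let nrm : EllpFin 𝕜 p → EllpFin 𝕜 p := fun x =>
    finSeq (fun i => ((‖x.1 i‖ / ‖x.1‖ : ℝ) : 𝕜)) (x.2.subset fun i hi h => hi (by simp [h]))
  have hnrm : ∀ x i, ‖(nrm x).1 i‖ = ‖x.1 i‖ / ‖x.1‖ := fun x i => by
    change ‖((‖x.1 i‖ / ‖x.1‖ : ℝ) : 𝕜)‖ = _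
    rw [RCLike.norm_ofReal, abs_of_nonneg (div_nonneg (norm_nonneg _) (lp.norm_nonneg' _))]
  refine ⟨fun x => m (nrm x), fun c x hc => ?_, C, hC0, fun x y hy s hs => ?_⟩
  · have : nrm (c • x) = nrm x := by
      refine Subtype.ext (lp.ext (funext fun i => ?_))
      change ((‖c * x.1 i‖ / ‖c • x.1‖ : ℝ) : 𝕜) = ((‖x.1 i‖ / ‖x.1‖ : ℝ) : 𝕜)
      rw [qnorm_smul 𝕜, norm_mul, mul_div_mul_left _ _ (norm_ne_zero_iff.2 hc)]
    simp only [this]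
  · rcases eq_or_ne x.1 0 with hx0 | hx0
    · have hy0 : y = 0 := Subtype.ext (lp.ext (funext fun i => hy i (by rw [hx0]; rfl)))
      have e : Φ.toFun y - (ptMul (m (nrm x)) y).1 = 0 := by
        rw [hy0, Φ.map_zero, zero_sub, neg_eq_zero]
        exact lp.ext (funext fun i => zero_mul _)
      rw [e, lp.norm_zero, Real.zero_rpow hp.ne', hx0, lp.norm_zero, Real.zero_rpow hp.ne']
      simp
    · have hX : 0 < ‖x.1‖ := lt_of_le_of_ne (lp.norm_nonneg' _) fun h =>
        hx0 (lp.norm_eq_zero_iff.1 h.symm)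
      have hz : ∀ i, (nrm x).1 i = 0 ↔ x.1 i = 0 := fun i => by
        rw [← norm_eq_zero, hnrm, div_eq_zero_iff, norm_eq_zero, or_iff_left hX.ne']
      have h1 := hm (nrm x) y (fun i hi => hy i ((hz i).1 hi)) s (fun i hi => (hz i).2 (hs i hi))
      refine h1.trans (le_of_eq ?_)
      congr 1
      have hXr : 0 < ‖x.1‖ ^ p.toReal := Real.rpow_pos_of_pos hX _
      have hn : ‖(nrm x).1‖ ^ p.toReal = 1 := by
        rw [norm_rpow_eq_sum (nrm x).1 s (fun i hi => (hz i).2 (hs i hi))]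
        simp only [hnrm, Real.div_rpow (norm_nonneg _) hX.le]
        rw [← Finset.sum_div, ← norm_rpow_eq_sum x.1 s hs, div_self hXr.ne']
      rw [hn, one_mul, Finset.mul_sum]
      refine Finset.sum_congr rfl fun i _ => ?_
      rw [hnrm, Real.div_rpow (norm_nonneg _) hX.le, div_div_eq_mul_div]
      ring

end Centralizer

/-! ### Power inequalities, and the variation of the multipliers -/

theorem add_three_rpow_le {r a b c : ℝ} (hr : 0 < r) (ha : 0 ≤ a) (hb : 0 ≤ b) (hc : 0 ≤ c) :
    (a + b + c) ^ r ≤ 3 ^ r * (a ^ r + b ^ r + c ^ r) := by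
  have ha' : 0 ≤ a ^ r := by positivity
  have hb' : 0 ≤ b ^ r := by positivity
  have hc' : 0 ≤ c ^ r := by positivity
  have key : ∀ m : ℝ, 0 ≤ m → a ≤ m → b ≤ m → c ≤ m → m ^ r ≤ a ^ r + b ^ r + c ^ r →
      (a + b + c) ^ r ≤ 3 ^ r * (a ^ r + b ^ r + c ^ r) := by
    intro m hm h1 h2 h3 h4
    calc (a + b + c) ^ r ≤ (3 * m) ^ r := by
          apply Real.rpow_le_rpow (by positivity) (by linarith) hr.le
      _ = 3 ^ r * m ^ r := Real.mul_rpow (by norm_num) hm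
      _ ≤ _ := by gcongr
  rcases le_total a b with h1 | h1 <;> rcases le_total b c with h2 | h2 <;>
    rcases le_total a c with h3 | h3
  · exact key c hc h3 h2 le_rfl (by linarith)
  · exact key c hc (h1.trans h2) h2 le_rfl (by linarith)
  · exact key b hb h1 le_rfl h2 (by linarith)
  · exact key b hb h1 le_rfl h2 (by linarith)
  · exact key c hc h3 h2 le_rfl (by linarith)
  · exact key a ha le_rfl h1 h3 (by linarith)
  · exact key a ha le_rfl h1 (h2.trans h1) (by linarith)
  · exact key a ha le_rfl h1 h3 (by linarith)

theorem add_three_rpow_sq_le {r a b c : ℝ} (hr : 0 < r) (ha : 0 ≤ a) (hb : 0 ≤ b) (hc : 0 ≤ c) :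
    ((a + b + c) ^ r) ^ 2 ≤ (3 ^ r) ^ 2 * 3 * ((a ^ r) ^ 2 + (b ^ r) ^ 2 + (c ^ r) ^ 2) := by
  have h := add_three_rpow_le hr ha hb hc
  have h0 : 0 ≤ (a + b + c) ^ r := by positivity
  calc ((a + b + c) ^ r) ^ 2 ≤ (3 ^ r * (a ^ r + b ^ r + c ^ r)) ^ 2 := by gcongr
    _ = (3 ^ r) ^ 2 * (a ^ r + b ^ r + c ^ r) ^ 2 := by ring
    _ ≤ (3 ^ r) ^ 2 * (3 * ((a ^ r) ^ 2 + (b ^ r) ^ 2 + (c ^ r) ^ 2)) := by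
      gcongr
      nlinarith [sq_nonneg (a ^ r - b ^ r), sq_nonneg (b ^ r - c ^ r), sq_nonneg (a ^ r - c ^ r)]
    _ = _ := by ring

theorem half_add_half_rpow_le {r a b : ℝ} (hr : 0 < r) (ha : 0 ≤ a) (hb : 0 ≤ b) :
    (1 / 2 * a + 1 / 2 * b) ^ r ≤ a ^ r + b ^ r := by
  have ha' : 0 ≤ a ^ r := by positivity
  have hb' : 0 ≤ b ^ r := by positivity
  rcases le_total a b with h | h
  · have : (1 / 2 * a + 1 / 2 * b) ^ r ≤ b ^ r :=
      Real.rpow_le_rpow (by positivity) (by linarith) hr.le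
    linarith
  · have : (1 / 2 * a + 1 / 2 * b) ^ r ≤ a ^ r :=
      Real.rpow_le_rpow (by positivity) (by linarith) hr.le
    linarith

namespace Centralizer

variable {𝕜 : Type u} [RCLike 𝕜] {p : ℝ≥0∞} [Fact (0 < p)] [Fact (p < ∞)]

theorem sq_div_le {a b r : ℝ} (hr : 0 < r) (ha : 0 ≤ a) (hab : a ≤ b) (t : ℝ) :
    (a ^ r * t) ^ 2 / b ^ r ≤ a ^ r * t ^ 2 := by
  rcases ha.eq_or_lt with rfl | ha
  · simp [Real.zero_rpow hr.ne']
  · have hb : 0 < b := ha.trans_le hab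
    have h1 : a ^ r ≤ b ^ r := Real.rpow_le_rpow ha.le hab hr.le
    rw [div_le_iff₀ (by positivity)]
    have : 0 ≤ a ^ r * t ^ 2 := by positivity
    nlinarith

/-- Test the approximation on y = u|φ(u) - φ(z)|. Both yφ(u) and yφ(z) are close to Φ(y), with
errors governed by the very sum S to be bounded, while S equals ‖yφ(u) - yφ(z)‖^r. Hence S ≤
const·√(‖z‖^r)·√S, and √S cancels. -/
theorem IsMultiplier.sub_estimate {Φ : Centralizer 𝕜 p} {φ : EllpFin 𝕜 p → ℕ → 𝕜}
    (hφ : IsMultiplier Φ φ) : ∃ D : ℝ, 0 ≤ D ∧ ∀ u z : EllpFin 𝕜 p,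
    (∀ i, ‖u.1 i‖ ≤ ‖z.1 i‖) → ∀ s : Finset ℕ, (∀ i ∉ s, z.1 i = 0) →
    ∑ i ∈ s, ‖u.1 i‖ ^ p.toReal * (‖φ u i - φ z i‖ ^ p.toReal) ^ 2 ≤
      D * ‖z.1‖ ^ p.toReal := by
  obtain ⟨-, C, hC0, hC⟩ := hφ
  have hp := toReal_pos p
  obtain ⟨A, hA1, hA⟩ := exists_add_rpow_le hp
  refine ⟨(A + 3 / 2) ^ 2 * C, by positivity, fun u z huz s hs => ?_⟩
  have hzu : ∀ i, z.1 i = 0 → u.1 i = 0 := fun i hi => by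
    have := huz i
    rw [hi, norm_zero] at this
    exact norm_le_zero_iff.1 this
  have hsu : ∀ i ∉ s, u.1 i = 0 := fun i hi => hzu i (hs i hi)
  set r := p.toReal with hr
  set t : ℕ → ℝ := fun i => ‖φ u i - φ z i‖ with ht
  set S := ∑ i ∈ s, ‖u.1 i‖ ^ r * (t i ^ r) ^ 2 with hS
  have hS0 : 0 ≤ S := Finset.sum_nonneg fun i _ => by positivity
  set y : EllpFin 𝕜 p := ptMul (fun i => (t i : 𝕜)) u with hy
  have hyn : ∀ i, ‖y.1 i‖ ^ r = ‖u.1 i‖ ^ r * t i ^ r := fun i => by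
    rw [hy, ptMul_apply, norm_mul, RCLike.norm_ofReal, abs_of_nonneg (norm_nonneg _),
      Real.mul_rpow (norm_nonneg _) (norm_nonneg _)]
  have hyu : ∀ i, u.1 i = 0 → y.1 i = 0 := fun i hi => by rw [hy, ptMul_apply, hi, zero_mul]
  -- Used for v = u and v = z; |u| ≤ |v| bounds the weighted sum of y by S.
  have gen : ∀ v : EllpFin 𝕜 p, (∀ i, ‖u.1 i‖ ≤ ‖v.1 i‖) → (∀ i, ‖v.1 i‖ ≤ ‖z.1 i‖) →
      ‖Φ.toFun y - (ptMul (φ v) y).1‖ ^ r ≤ √(C * ‖z.1‖ ^ r) * √S := by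
    intro v huv hvz
    have hvs : ∀ i ∉ s, v.1 i = 0 := fun i hi => by
      have := hvz i
      rw [hs i hi, norm_zero] at this
      exact norm_le_zero_iff.1 this
    have h1 := hC v y (fun i hi => hyu i (by
      have := huv i
      rw [hi, norm_zero] at this
      exact norm_le_zero_iff.1 this)) s hvs
    have h2 : ∑ i ∈ s, (‖y.1 i‖ ^ r) ^ 2 / ‖v.1 i‖ ^ r ≤ S :=
      Finset.sum_le_sum fun i _ => by
        rw [hyn]
        exact sq_div_le hp (norm_nonneg _) (huv i) _
    have h3 : ‖v.1‖ ^ r ≤ ‖z.1‖ ^ r := by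
      rw [norm_rpow_eq_sum v.1 s hvs, norm_rpow_eq_sum z.1 s hs]
      refine Finset.sum_le_sum fun i _ => ?_
      have := hvz i
      gcongr
    have hz0 := lp.norm_nonneg' z.1
    have hv0 := lp.norm_nonneg' v.1
    rw [← Real.sqrt_mul (by positivity)]
    refine Real.le_sqrt_of_sq_le (h1.trans ?_)
    rw [mul_assoc]
    gcongr
  have e : S = ‖(ptMul (φ u) y).1 - (ptMul (φ z) y).1‖ ^ r := by
    rw [norm_rpow_eq_sum _ s (fun i hi => by
      change y.1 i * φ u i - y.1 i * φ z i = 0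
      rw [hyu i (hsu i hi)]; simp)]
    refine Finset.sum_congr rfl fun i _ => ?_
    change _ = ‖y.1 i * φ u i - y.1 i * φ z i‖ ^ r
    rw [← mul_sub, norm_mul, Real.mul_rpow (norm_nonneg _) (norm_nonneg _), hyn]
    ring
  have h1 := norm_sub_rpow_le hA hA1 (ptMul (φ u) y).1 (Φ.toFun y) (ptMul (φ z) y).1
  rw [← e, qnorm_sub_comm 𝕜 (ptMul (φ u) y).1] at h1
  have h2 := gen u (fun _ => le_rfl) huz
  have h3 := gen z huz (fun _ => le_rfl)
  have hz0 := lp.norm_nonneg' z.1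
  have hCz : 0 ≤ C * ‖z.1‖ ^ r := by positivity
  set q := √(C * ‖z.1‖ ^ r) with hq
  have hq2 : q ^ 2 = C * ‖z.1‖ ^ r := Real.sq_sqrt hCz
  have h4 : S ≤ (A + 3 / 2) * q * √S := by
    have := mul_le_mul_of_nonneg_left h2 (show 0 ≤ A by linarith)
    nlinarith
  rcases hS0.eq_or_lt with h0 | h0
  · rw [← h0]; positivity
  · have hs' : 0 < √S := Real.sqrt_pos.2 h0
    have h5 : √S ≤ (A + 3 / 2) * q := by
      refine le_of_mul_le_mul_right ?_ hs'
      rw [Real.mul_self_sqrt hS0]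
      exact h4
    calc S = (√S) ^ 2 := (Real.sq_sqrt hS0).symm
      _ ≤ ((A + 3 / 2) * q) ^ 2 := by gcongr
      _ = _ := by rw [mul_pow, hq2]; ring

/-- The failure of additivity of `x ↦ x φ x`. -/
def defect (φ : EllpFin 𝕜 p → ℕ → 𝕜) (x x' : EllpFin 𝕜 p) : EllpFin 𝕜 p :=
  ptMul (φ (x + x')) (x + x') - ptMul (φ x) x - ptMul (φ x') x'

theorem defect_apply (φ : EllpFin 𝕜 p → ℕ → 𝕜) (x x' : EllpFin 𝕜 p) (i : ℕ) :
    (defect φ x x').1 i = (x.1 i + x'.1 i) * φ (x + x') i - x.1 i * φ x i - x'.1 i * φ x' i := rfl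

/-- The majorant `|x| + |x'|`. -/
def absAdd (x x' : EllpFin 𝕜 p) : EllpFin 𝕜 p :=
  finSeq (fun i => ((‖x.1 i‖ + ‖x'.1 i‖ : ℝ) : 𝕜)) ((x.2.union x'.2).subset fun i hi => by
    by_contra h
    simp only [Set.mem_union, Function.mem_support, not_or, not_not] at h
    exact hi (by simp [h.1, h.2]))

theorem norm_absAdd_apply (x x' : EllpFin 𝕜 p) (i : ℕ) :
    ‖(absAdd x x').1 i‖ = ‖x.1 i‖ + ‖x'.1 i‖ := by
  change ‖((‖x.1 i‖ + ‖x'.1 i‖ : ℝ) : 𝕜)‖ = _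
  rw [RCLike.norm_ofReal, abs_of_nonneg (by positivity)]

theorem norm_absAdd_le (x x' : EllpFin 𝕜 p) :
    ‖(absAdd x x').1‖ ≤ 2 * 2 ^ (1 / p.toReal) * (‖x.1‖ + ‖x'.1‖) :=
  norm_le_of_pointwise _ _ _ fun i => (norm_absAdd_apply x x' i).le

theorem le_absAdd (x x' : EllpFin 𝕜 p) (i : ℕ) :
    ‖(x + x').1 i‖ ≤ ‖(absAdd x x').1 i‖ ∧ ‖x.1 i‖ ≤ ‖(absAdd x x').1 i‖ ∧
      ‖x'.1 i‖ ≤ ‖(absAdd x x').1 i‖ := by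
  rw [norm_absAdd_apply]
  exact ⟨norm_add_le _ _, by linarith [norm_nonneg (x'.1 i)], by linarith [norm_nonneg (x.1 i)]⟩

theorem defect_eq_zero (φ : EllpFin 𝕜 p → ℕ → 𝕜) (x x' : EllpFin 𝕜 p) (i : ℕ)
    (h : (absAdd x x').1 i = 0) : (defect φ x x').1 i = 0 := by
  obtain ⟨-, h1, h2⟩ := le_absAdd x x' i
  rw [h, norm_zero] at h1 h2
  rw [defect_apply, norm_le_zero_iff.1 h1, norm_le_zero_iff.1 h2]
  simp

/-- Subtracting φ(z) from all three multipliers, with z = |x| + |x'|, does not change the defect,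
because (x + x') - x - x' = 0. What remains are three differences controlled by
`IsMultiplier.sub_estimate`. -/
theorem IsMultiplier.defect_estimate {Φ : Centralizer 𝕜 p} {φ : EllpFin 𝕜 p → ℕ → 𝕜}
    (hφ : IsMultiplier Φ φ) : ∃ D : ℝ, 0 ≤ D ∧ ∀ x x' : EllpFin 𝕜 p,
    ∀ s : Finset ℕ, (∀ i ∉ s, (absAdd x x').1 i = 0) →
    ∑ i ∈ s, (‖(defect φ x x').1 i‖ ^ p.toReal) ^ 2 / ‖(absAdd x x').1 i‖ ^ p.toReal ≤
      D * ‖(absAdd x x').1‖ ^ p.toReal := by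
  obtain ⟨D, hD0, hD⟩ := hφ.sub_estimate
  have hp := toReal_pos p
  refine ⟨(3 ^ p.toReal) ^ 2 * 3 * (D + D + D), by positivity, fun x x' s hs => ?_⟩
  set r := p.toReal with hr
  set z := absAdd x x' with hz
  have h1 := hD (x + x') z (fun i => (le_absAdd x x' i).1) s hs
  have h2 := hD x z (fun i => (le_absAdd x x' i).2.1) s hs
  have h3 := hD x' z (fun i => (le_absAdd x x' i).2.2) s hs
  set a : ℕ → ℝ := fun i => ‖φ (x + x') i - φ z i‖
  set b : ℕ → ℝ := fun i => ‖φ x i - φ z i‖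
  set c : ℕ → ℝ := fun i => ‖φ x' i - φ z i‖
  calc _ ≤ ∑ i ∈ s, (3 ^ r) ^ 2 * 3 * (‖(x + x').1 i‖ ^ r * (a i ^ r) ^ 2 +
        ‖x.1 i‖ ^ r * (b i ^ r) ^ 2 + ‖x'.1 i‖ ^ r * (c i ^ r) ^ 2) := by
        refine Finset.sum_le_sum fun i _ => ?_
        have e : (defect φ x x').1 i = (x + x').1 i * (φ (x + x') i - φ z i) -
            x.1 i * (φ x i - φ z i) - x'.1 i * (φ x' i - φ z i) := by
          rw [defect_apply]
          have : (x + x').1 i = x.1 i + x'.1 i := rfl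
          rw [this]
          ring
        have hn : ‖(defect φ x x').1 i‖ ≤ ‖(x + x').1 i‖ * a i + ‖x.1 i‖ * b i +
            ‖x'.1 i‖ * c i := by
          rw [e, ← norm_mul, ← norm_mul, ← norm_mul]
          exact (norm_sub_le _ _).trans (add_le_add (norm_sub_le _ _) le_rfl)
        have hn2 : (‖(defect φ x x').1 i‖ ^ r) ^ 2 ≤ (3 ^ r) ^ 2 * 3 *
            ((‖(x + x').1 i‖ ^ r * a i ^ r) ^ 2 + (‖x.1 i‖ ^ r * b i ^ r) ^ 2 +
              (‖x'.1 i‖ ^ r * c i ^ r) ^ 2) := by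
          have h0 := norm_nonneg ((defect φ x x').1 i)
          calc _ ≤ ((‖(x + x').1 i‖ * a i + ‖x.1 i‖ * b i + ‖x'.1 i‖ * c i) ^ r) ^ 2 := by
                gcongr
            _ ≤ _ := by
                have := add_three_rpow_sq_le hp (a := ‖(x + x').1 i‖ * a i)
                  (b := ‖x.1 i‖ * b i) (c := ‖x'.1 i‖ * c i) (by positivity) (by positivity)
                  (by positivity)
                rwa [Real.mul_rpow (norm_nonneg _) (norm_nonneg _),
                  Real.mul_rpow (norm_nonneg _) (norm_nonneg _),
                  Real.mul_rpow (norm_nonneg _) (norm_nonneg _)] at this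
        obtain ⟨m1, m2, m3⟩ := le_absAdd x x' i
        have q1 := sq_div_le hp (norm_nonneg _) m1 (a i ^ r)
        have q2 := sq_div_le hp (norm_nonneg _) m2 (b i ^ r)
        have q3 := sq_div_le hp (norm_nonneg _) m3 (c i ^ r)
        calc _ ≤ (3 ^ r) ^ 2 * 3 *
            ((‖(x + x').1 i‖ ^ r * a i ^ r) ^ 2 + (‖x.1 i‖ ^ r * b i ^ r) ^ 2 +
              (‖x'.1 i‖ ^ r * c i ^ r) ^ 2) / ‖z.1 i‖ ^ r := by gcongr
          _ = (3 ^ r) ^ 2 * 3 *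
            ((‖(x + x').1 i‖ ^ r * a i ^ r) ^ 2 / ‖z.1 i‖ ^ r +
              (‖x.1 i‖ ^ r * b i ^ r) ^ 2 / ‖z.1 i‖ ^ r +
              (‖x'.1 i‖ ^ r * c i ^ r) ^ 2 / ‖z.1 i‖ ^ r) := by ring
          _ ≤ _ := by gcongr
    _ ≤ (3 ^ r) ^ 2 * 3 * (D * ‖z.1‖ ^ r + D * ‖z.1‖ ^ r + D * ‖z.1‖ ^ r) := by
        rw [← Finset.mul_sum, Finset.sum_add_distrib, Finset.sum_add_distrib]
        gcongr
    _ = _ := by ring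

theorem exists_finset_absAdd (x x' : EllpFin 𝕜 p) :
    ∃ s : Finset ℕ, ∀ i ∉ s, (absAdd x x').1 i = 0 := by
  have hfin : (Function.support fun i => (absAdd x x').1 i).Finite := (absAdd x x').2
  refine ⟨hfin.toFinset, fun i hi => ?_⟩
  by_contra h
  exact hi ((Set.Finite.mem_toFinset hfin).2 h)

theorem le_of_rpow_le {r M a b : ℝ} (hr : 0 < r) (hM : 0 ≤ M) (ha : 0 ≤ a) (hb : 0 ≤ b)
    (h : a ^ r ≤ M * b ^ r) : a ≤ M ^ (1 / r) * b := by
  rw [← Real.rpow_le_rpow_iff ha (by positivity) hr, Real.mul_rpow (by positivity) hb,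
    ← Real.rpow_mul hM, one_div_mul_cancel hr.ne', Real.rpow_one]
  exact h

theorem rpow_le_of_sq_le {M a b : ℝ} (hM : 0 ≤ M) (hb : 0 ≤ b)
    (h : a ^ 2 ≤ M * b ^ 2) : a ≤ √M * b := by
  refine le_of_sq_le_sq ?_ (by positivity)
  rwa [mul_pow, Real.sq_sqrt hM]

theorem exists_norm_le_of_rpow_sq_le {M : ℝ} (hM : 0 ≤ M) : ∃ K : ℝ, 0 ≤ K ∧
    ∀ w z : Ellp 𝕜 p, (‖w‖ ^ p.toReal) ^ 2 ≤ M * (‖z‖ ^ p.toReal) ^ 2 → ‖w‖ ≤ K * ‖z‖ := by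
  have hp := toReal_pos p
  refine ⟨(√M) ^ (1 / p.toReal), by positivity, fun w z h => ?_⟩
  have hw := lp.norm_nonneg' w
  have hz := lp.norm_nonneg' z
  exact le_of_rpow_le hp (by positivity) hw hz (rpow_le_of_sq_le hM (by positivity) h)

/-- Take y = x: the weighted sum is then ‖x‖^r. -/
theorem IsMultiplier.norm_sub_le {Φ : Centralizer 𝕜 p} {φ : EllpFin 𝕜 p → ℕ → 𝕜}
    (hφ : IsMultiplier Φ φ) : ∃ K : ℝ, 0 ≤ K ∧ ∀ x : EllpFin 𝕜 p,
    ‖Φ.toFun x - (ptMul (φ x) x).1‖ ≤ K * ‖x.1‖ := by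
  obtain ⟨-, C, hC0, hC⟩ := hφ
  have hp := toReal_pos p
  obtain ⟨K, hK0, hK⟩ := exists_norm_le_of_rpow_sq_le (𝕜 := 𝕜) (p := p) hC0
  refine ⟨K, hK0, fun x => hK _ _ ?_⟩
  have hfin : (Function.support fun i => x.1 i).Finite := x.2
  have hs : ∀ i ∉ hfin.toFinset, x.1 i = 0 := fun i hi => by
    by_contra h
    exact hi ((Set.Finite.mem_toFinset hfin).2 h)
  refine (hC x x (fun _ h => h) _ hs).trans (mul_le_mul_of_nonneg_left ?_ hC0)
  rw [sq]
  have h0 := lp.norm_nonneg' x.1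
  refine mul_le_mul_of_nonneg_left ?_ (by positivity)
  rw [norm_rpow_eq_sum x.1 _ hs]
  refine Finset.sum_le_sum fun i _ => ?_
  have := sq_div_le hp (norm_nonneg (x.1 i)) le_rfl 1
  simpa using this

/-- The weighted ℓ_{2p} attached to z embeds in ℓ_p by Cauchy–Schwarz. -/
theorem IsMultiplier.defect_norm_le {Φ : Centralizer 𝕜 p} {φ : EllpFin 𝕜 p → ℕ → 𝕜}
    (hφ : IsMultiplier Φ φ) : ∃ K : ℝ, 0 ≤ K ∧ ∀ x x' : EllpFin 𝕜 p,
    ‖(defect φ x x').1‖ ≤ K * ‖(absAdd x x').1‖ := by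
  obtain ⟨D, hD0, hD⟩ := hφ.defect_estimate
  have hp := toReal_pos p
  obtain ⟨K, hK0, hK⟩ := exists_norm_le_of_rpow_sq_le (𝕜 := 𝕜) (p := p) hD0
  refine ⟨K, hK0, fun x x' => hK _ _ ?_⟩
  obtain ⟨s, hs⟩ := exists_finset_absAdd x x'
  have h1 := hD x x' s hs
  have h0 := lp.norm_nonneg' (absAdd x x').1
  rw [norm_rpow_eq_sum (defect φ x x').1 s (fun i hi => defect_eq_zero φ x x' i (hs i hi))]
  have hcs := Finset.sum_sq_le_sum_mul_sum_of_sq_le_mul s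
    (r := fun i => ‖(defect φ x x').1 i‖ ^ p.toReal)
    (f := fun i => ‖(absAdd x x').1 i‖ ^ p.toReal)
    (g := fun i => (‖(defect φ x x').1 i‖ ^ p.toReal) ^ 2 / ‖(absAdd x x').1 i‖ ^ p.toReal)
    (fun i _ => by positivity) (fun i _ => by positivity) (fun i _ => le_of_eq <| by
      rcases eq_or_ne ((absAdd x x').1 i) 0 with h | h
      · rw [h, defect_eq_zero φ x x' i h]
        simp [Real.zero_rpow hp.ne']
      · have := norm_pos_iff.2 h
        field_simp)
  refine hcs.trans ?_
  rw [← norm_rpow_eq_sum (absAdd x x').1 s hs]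
  calc _ ≤ ‖(absAdd x x').1‖ ^ p.toReal * (D * ‖(absAdd x x').1‖ ^ p.toReal) := by gcongr
    _ = _ := by ring

/-- The defect of ψ lies in the weighted ℓ_{2p} attached to z = |x| + |x'|, where Φ acts as
multiplication by φ(z). This makes the cocycle explicit. -/
theorem IsMultiplier.defect_comp_le {Φ Ψ : Centralizer 𝕜 p} {φ ψ : EllpFin 𝕜 p → ℕ → 𝕜}
    (hφ : IsMultiplier Φ φ) (hψ : IsMultiplier Ψ ψ) : ∃ K : ℝ, 0 ≤ K ∧ ∀ x x' : EllpFin 𝕜 p,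
    ‖Φ.toFun (defect ψ x x') - (ptMul (φ (absAdd x x')) (defect ψ x x')).1‖ ≤
      K * ‖(absAdd x x').1‖ := by
  obtain ⟨D, hD0, hD⟩ := hψ.defect_estimate
  obtain ⟨-, C, hC0, hC⟩ := hφ
  obtain ⟨K, hK0, hK⟩ := exists_norm_le_of_rpow_sq_le (𝕜 := 𝕜) (p := p) (mul_nonneg hC0 hD0)
  refine ⟨K, hK0, fun x x' => hK _ _ ?_⟩
  obtain ⟨s, hs⟩ := exists_finset_absAdd x x'
  have h0 := lp.norm_nonneg' (absAdd x x').1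
  calc _ ≤ _ := hC (absAdd x x') (defect ψ x x') (defect_eq_zero ψ x x') s hs
    _ ≤ C * (‖(absAdd x x').1‖ ^ p.toReal * (D * ‖(absAdd x x').1‖ ^ p.toReal)) := by
      gcongr
      exact hD x x' s hs
    _ = _ := by ring

end Centralizer

/-! ### The cocycle of a product of centralizers -/

namespace Centralizer

variable {𝕜 : Type u} [RCLike 𝕜] {p : ℝ≥0∞} [Fact (0 < p)] [Fact (p < ∞)]

/-- The multiplier `(ρ γ + ρ' γ') / 2`. -/
def halfProd (ρ γ ρ' γ' : EllpFin 𝕜 p → ℕ → 𝕜) (x : EllpFin 𝕜 p) (i : ℕ) : 𝕜 :=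
  2⁻¹ * (ρ x i * γ x i + ρ' x i * γ' x i)

theorem mul_rpow_half_le {r a b : ℝ} (ha : 0 ≤ a) (hb : 0 ≤ b) :
    (a * b) ^ r ≤ (a ^ r) ^ 2 + (b ^ r) ^ 2 := by
  rw [Real.mul_rpow ha hb]
  nlinarith [sq_nonneg (a ^ r - b ^ r), sq_nonneg (a ^ r), sq_nonneg (b ^ r)]

theorem norm_half_le (a b c d : 𝕜) :
    ‖2⁻¹ * (a * b + c * d)‖ ≤ 1 / 2 * (‖a‖ * ‖b‖) + 1 / 2 * (‖c‖ * ‖d‖) := by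
  rw [norm_mul, norm_inv, RCLike.norm_ofNat, ← norm_mul, ← norm_mul]
  have := norm_add_le (a * b) (c * d)
  linarith

/-- Expand (ργ + ρ'γ')/2 at u around z. The symmetry `hsymp` merges the two kinds of first order
terms into ρ(z)(γ(u) - γ(z)) + ρ'(z)(γ'(u) - γ'(z)), which explains the factor 1/2. The terms
constant in u disappear from the defect, and the second order terms are products of two
2p-integrable differences, hence bounded in ℓ_p. -/
theorem defect_halfProd_le {R C R' C' : Centralizer 𝕜 p} {ρ γ ρ' γ' : EllpFin 𝕜 p → ℕ → 𝕜}
    (hρ : IsMultiplier R ρ) (hγ : IsMultiplier C γ) (hρ' : IsMultiplier R' ρ')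
    (hγ' : IsMultiplier C' γ')
    (hsymp : ∀ u z i, γ z i * ρ u i + γ' z i * ρ' u i = ρ z i * γ u i + ρ' z i * γ' u i) :
    ∃ K : ℝ, 0 ≤ K ∧ ∀ x x' : EllpFin 𝕜 p,
      ‖(defect (halfProd ρ γ ρ' γ') x x').1 - (ptMul (ρ (absAdd x x')) (defect γ x x')).1 -
        (ptMul (ρ' (absAdd x x')) (defect γ' x x')).1‖ ≤ K * ‖(absAdd x x').1‖ := by
  have hp := toReal_pos p
  obtain ⟨D₁, hD₁0, hD₁⟩ := hρ.sub_estimate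
  obtain ⟨D₂, hD₂0, hD₂⟩ := hγ.sub_estimate
  obtain ⟨D₃, hD₃0, hD₃⟩ := hρ'.sub_estimate
  obtain ⟨D₄, hD₄0, hD₄⟩ := hγ'.sub_estimate
  set r := p.toReal with hr
  set E := D₁ + D₂ + (D₃ + D₄) with hE
  refine ⟨(3 ^ r * (E + E + E)) ^ (1 / r), by positivity, fun x x' => ?_⟩
  refine le_of_rpow_le hp (by positivity) (lp.norm_nonneg' _) (lp.norm_nonneg' _) ?_
  obtain ⟨s, hs⟩ := exists_finset_absAdd x x'
  set z := absAdd x x' with hz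
  -- The second order term of the expansion around z.
  let rem : EllpFin 𝕜 p → ℕ → 𝕜 := fun u i =>
    2⁻¹ * ((ρ u i - ρ z i) * (γ u i - γ z i) + (ρ' u i - ρ' z i) * (γ' u i - γ' z i))
  have hrem : ∀ u : EllpFin 𝕜 p, (∀ i, ‖u.1 i‖ ≤ ‖z.1 i‖) →
      ∑ i ∈ s, (‖u.1 i‖ * ‖rem u i‖) ^ r ≤ E * ‖z.1‖ ^ r := by
    intro u hu
    have h1 := hD₁ u z hu s hs
    have h2 := hD₂ u z hu s hs
    have h3 := hD₃ u z hu s hs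
    have h4 := hD₄ u z hu s hs
    calc _ ≤ ∑ i ∈ s, (‖u.1 i‖ ^ r * (‖ρ u i - ρ z i‖ ^ r) ^ 2 +
          ‖u.1 i‖ ^ r * (‖γ u i - γ z i‖ ^ r) ^ 2 +
          (‖u.1 i‖ ^ r * (‖ρ' u i - ρ' z i‖ ^ r) ^ 2 +
          ‖u.1 i‖ ^ r * (‖γ' u i - γ' z i‖ ^ r) ^ 2)) := by
          refine Finset.sum_le_sum fun i _ => ?_
          rw [Real.mul_rpow (norm_nonneg _) (norm_nonneg _), ← mul_add, ← mul_add, ← mul_add]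
          refine mul_le_mul_of_nonneg_left ?_ (by positivity)
          refine (Real.rpow_le_rpow (norm_nonneg _) (norm_half_le _ _ _ _) hp.le).trans ?_
          refine (half_add_half_rpow_le hp (by positivity) (by positivity)).trans ?_
          exact add_le_add (mul_rpow_half_le (norm_nonneg _) (norm_nonneg _))
            (mul_rpow_half_le (norm_nonneg _) (norm_nonneg _))
      _ ≤ _ := by
          rw [Finset.sum_add_distrib, Finset.sum_add_distrib, Finset.sum_add_distrib]
          rw [hE]
          linarith
  set κ : Ellp 𝕜 p := (defect (halfProd ρ γ ρ' γ') x x').1 - (ptMul (ρ z) (defect γ x x')).1 -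
        (ptMul (ρ' z) (defect γ' x x')).1 with hκ
  have hκi : ∀ i, κ i = (x + x').1 i * rem (x + x') i - x.1 i * rem x i - x'.1 i * rem x' i := by
    intro i
    have e : κ i = (x.1 i + x'.1 i) * halfProd ρ γ ρ' γ' (x + x') i -
        x.1 i * halfProd ρ γ ρ' γ' x i - x'.1 i * halfProd ρ γ ρ' γ' x' i -
        ((x.1 i + x'.1 i) * γ (x + x') i - x.1 i * γ x i - x'.1 i * γ x' i) * ρ z i -
        ((x.1 i + x'.1 i) * γ' (x + x') i - x.1 i * γ' x i - x'.1 i * γ' x' i) * ρ' z i := rfl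
    have e2 : (x + x').1 i = x.1 i + x'.1 i := rfl
    rw [e, e2]
    simp only [halfProd, rem]
    have k1 := hsymp (x + x') z i
    have k2 := hsymp x z i
    have k3 := hsymp x' z i
    have h2 : (2 : 𝕜) ≠ 0 := two_ne_zero
    field_simp
    -- The symmetry at u = x + x', x and x', weighted by the coefficient with which each u enters
    -- the defect.
    linear_combination (x.1 i + x'.1 i) * k1 - x.1 i * k2 - x'.1 i * k3
  rw [norm_rpow_eq_sum κ s (fun i hi => by
    obtain ⟨-, m2, m3⟩ := le_absAdd x x' i
    rw [← hz, hs i hi, norm_zero] at m2 m3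
    have e2 : (x + x').1 i = x.1 i + x'.1 i := rfl
    rw [hκi, e2, norm_le_zero_iff.1 m2, norm_le_zero_iff.1 m3]
    simp)]
  calc _ ≤ ∑ i ∈ s, 3 ^ r * ((‖(x + x').1 i‖ * ‖rem (x + x') i‖) ^ r +
        (‖x.1 i‖ * ‖rem x i‖) ^ r + (‖x'.1 i‖ * ‖rem x' i‖) ^ r) := by
        refine Finset.sum_le_sum fun i _ => ?_
        refine le_trans (Real.rpow_le_rpow (norm_nonneg _) ?_ hp.le)
          (add_three_rpow_le hp (by positivity) (by positivity) (by positivity))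
        rw [hκi, ← norm_mul, ← norm_mul, ← norm_mul]
        exact (norm_sub_le _ _).trans (add_le_add (norm_sub_le _ _) le_rfl)
    _ ≤ 3 ^ r * (E * ‖z.1‖ ^ r + E * ‖z.1‖ ^ r + E * ‖z.1‖ ^ r) := by
        rw [← Finset.mul_sum, Finset.sum_add_distrib, Finset.sum_add_distrib]
        gcongr
        · exact hrem _ fun i => (le_absAdd x x' i).1
        · exact hrem _ fun i => (le_absAdd x x' i).2.1
        · exact hrem _ fun i => (le_absAdd x x' i).2.2
    _ = _ := by ring

/-- Under the symplectic condition the cocycle `R ∘ C + R' ∘ C'` is, up to a bounded error, the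
coboundary of `x ↦ x (ρ x γ x + ρ' x γ' x) / 2`. -/
theorem cocycle_estimate {R C R' C' : Centralizer 𝕜 p} {ρ γ ρ' γ' : EllpFin 𝕜 p → ℕ → 𝕜}
    (hρ : IsMultiplier R ρ) (hγ : IsMultiplier C γ) (hρ' : IsMultiplier R' ρ')
    (hγ' : IsMultiplier C' γ')
    (hsymp : ∀ u z i, γ z i * ρ u i + γ' z i * ρ' u i = ρ z i * γ u i + ρ' z i * γ' u i) :
    ∃ K : ℝ, ∀ x x' : EllpFin 𝕜 p,
      ‖(defect (halfProd ρ γ ρ' γ') x x').1 - R.toFun (defect γ x x') -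
        R'.toFun (defect γ' x x')‖ ≤ K * (‖x.1‖ + ‖x'.1‖) := by
  obtain ⟨M, hM1, hM⟩ := exists_modulus 𝕜 (Ellp 𝕜 p)
  obtain ⟨K₀, hK₀0, hK₀⟩ := defect_halfProd_le hρ hγ hρ' hγ' hsymp
  obtain ⟨K₁, hK₁0, hK₁⟩ := hρ.defect_comp_le hγ
  obtain ⟨K₂, hK₂0, hK₂⟩ := hρ'.defect_comp_le hγ'
  refine ⟨M * (M * (K₀ + K₁) + K₂) * (2 * 2 ^ (1 / p.toReal)), fun x x' => ?_⟩
  have h0 := hK₀ x x'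
  have h1 := hK₁ x x'
  have h2 := hK₂ x x'
  have h3 := norm_absAdd_le x x'
  set z := absAdd x x'
  have e : (defect (halfProd ρ γ ρ' γ') x x').1 - R.toFun (defect γ x x') -
        R'.toFun (defect γ' x x') =
      ((defect (halfProd ρ γ ρ' γ') x x').1 - (ptMul (ρ z) (defect γ x x')).1 -
        (ptMul (ρ' z) (defect γ' x x')).1 -
        (R.toFun (defect γ x x') - (ptMul (ρ z) (defect γ x x')).1)) -
      (R'.toFun (defect γ' x x') - (ptMul (ρ' z) (defect γ' x x')).1) := by abel
  rw [e]
  calc _ ≤ M * (M * (K₀ * ‖z.1‖ + K₁ * ‖z.1‖) + K₂ * ‖z.1‖) := by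
        refine (qnorm_sub_le 𝕜 hM _ _).trans ?_
        refine mul_le_mul_of_nonneg_left (add_le_add ?_ h2) (by linarith)
        refine (qnorm_sub_le 𝕜 hM _ _).trans ?_
        exact mul_le_mul_of_nonneg_left (add_le_add h0 h1) (by linarith)
    _ = M * (M * (K₀ + K₁) + K₂) * ‖z.1‖ := by ring
    _ ≤ M * (M * (K₀ + K₁) + K₂) * (2 * 2 ^ (1 / p.toReal) * (‖x.1‖ + ‖x'.1‖)) := by gcongr
    _ = _ := by ring

theorem IsMultiplier.defect_le {Φ : Centralizer 𝕜 p} {φ : EllpFin 𝕜 p → ℕ → 𝕜}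
    (hφ : IsMultiplier Φ φ) : ∃ K : ℝ, ∀ x x' : EllpFin 𝕜 p,
    ‖(defect φ x x').1‖ ≤ K * (‖x.1‖ + ‖x'.1‖) := by
  obtain ⟨K, hK0, hK⟩ := hφ.defect_norm_le
  refine ⟨K * (2 * 2 ^ (1 / p.toReal)), fun x x' => (hK x x').trans ?_⟩
  rw [mul_assoc]
  exact mul_le_mul_of_nonneg_left (norm_absAdd_le x x') hK0

theorem ptMul_smul {φ : EllpFin 𝕜 p → ℕ → 𝕜}
    (hφ : ∀ (c : 𝕜) (x : EllpFin 𝕜 p), c ≠ 0 → φ (c • x) = φ x) (c : 𝕜) (x : EllpFin 𝕜 p) :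
    ptMul (φ (c • x)) (c • x) = c • ptMul (φ x) x := by
  rcases eq_or_ne c 0 with rfl | hc
  · refine Subtype.ext (lp.ext (funext fun i => ?_))
    change (0 * x.1 i) * _ = 0 * (x.1 i * φ x i)
    ring
  · rw [hφ c x hc]
    refine Subtype.ext (lp.ext (funext fun i => ?_))
    change (c * x.1 i) * φ x i = c * (x.1 i * φ x i)
    ring

theorem IsMultiplier.add {Φ Ψ : Centralizer 𝕜 p} {φ ψ : EllpFin 𝕜 p → ℕ → 𝕜}
    (hφ : IsMultiplier Φ φ) (hψ : IsMultiplier Ψ ψ) :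
    IsMultiplier (Φ + Ψ) (fun x i => φ x i + ψ x i) := by
  have hp := toReal_pos p
  obtain ⟨A, hA1, hA⟩ := exists_add_rpow_le hp
  obtain ⟨h1, C, hC0, hC⟩ := hφ
  obtain ⟨h2, D, hD0, hD⟩ := hψ
  refine ⟨fun c x hc => by simp only [h1 c x hc, h2 c x hc], 2 * A ^ 2 * C + 2 * (3 / 2) ^ 2 * D,
    by positivity, fun x y hy s hs => ?_⟩
  have k1 := hC x y hy s hs
  have k2 := hD x y hy s hs
  set r := p.toReal
  set Q := ‖x.1‖ ^ r * ∑ i ∈ s, (‖y.1 i‖ ^ r) ^ 2 / ‖x.1 i‖ ^ r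
  have e : (Φ + Ψ).toFun y - (ptMul (fun i => φ x i + ψ x i) y).1 =
      (Φ.toFun y - (ptMul (φ x) y).1) - ((ptMul (ψ x) y).1 - Ψ.toFun y) := by
    have e1 : (Φ + Ψ).toFun y = Φ.toFun y + Ψ.toFun y := rfl
    have e2 : (ptMul (fun i => φ x i + ψ x i) y).1 = (ptMul (φ x) y).1 + (ptMul (ψ x) y).1 :=
      lp.ext (funext fun i => mul_add _ _ _)
    rw [e1, e2]
    abel
  have h3 := norm_sub_rpow_le hA hA1 (Φ.toFun y - (ptMul (φ x) y).1) 0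
    ((ptMul (ψ x) y).1 - Ψ.toFun y)
  rw [← e, sub_zero, zero_sub, neg_sub] at h3
  set a := ‖Φ.toFun y - (ptMul (φ x) y).1‖ ^ r
  set b := ‖Ψ.toFun y - (ptMul (ψ x) y).1‖ ^ r
  have h0 : 0 ≤ ‖(Φ + Ψ).toFun y - (ptMul (fun i => φ x i + ψ x i) y).1‖ ^ r :=
    Real.rpow_nonneg (lp.norm_nonneg' _) _
  calc _ ≤ (A * a + 3 / 2 * b) ^ 2 := by gcongr
    _ ≤ 2 * A ^ 2 * a ^ 2 + 2 * (3 / 2) ^ 2 * b ^ 2 := by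
      nlinarith [sq_nonneg (A * a - 3 / 2 * b)]
    _ ≤ 2 * A ^ 2 * (C * Q) + 2 * (3 / 2) ^ 2 * (D * Q) := by gcongr
    _ = _ := by ring

theorem IsMultiplier.neg {Φ : Centralizer 𝕜 p} {φ : EllpFin 𝕜 p → ℕ → 𝕜}
    (hφ : IsMultiplier Φ φ) : IsMultiplier (-Φ) (fun x i => -φ x i) := by
  obtain ⟨h1, C, hC0, hC⟩ := hφ
  refine ⟨fun c x hc => by simp only [h1 c x hc], C, hC0, fun x y hy s hs => ?_⟩
  have e : (-Φ).toFun y - (ptMul (fun i => -φ x i) y).1 = -(Φ.toFun y - (ptMul (φ x) y).1) := by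
    have e1 : (-Φ).toFun y = -Φ.toFun y := rfl
    have e2 : (ptMul (fun i => -φ x i) y).1 = -(ptMul (φ x) y).1 :=
      lp.ext (funext fun i => mul_neg _ _)
    rw [e1, e2]
    abel
  rw [e, qnorm_neg 𝕜]
  exact hC x y hy s hs

end Centralizer

/-! ### Operators, products and kernels of quasi Banach spaces -/

section Bounded

variable {𝕜 E F G : Type u} [RCLike 𝕜] [AddCommGroup E] [Module 𝕜 E] [Norm E]
  [AddCommGroup F] [Module 𝕜 F] [Norm F] [AddCommGroup G] [Module 𝕜 G] [Norm G]

theorem IsBdd.exists_nonneg [QuasinormedSpace 𝕜 E] {T : E →ₗ[𝕜] F} (hT : IsBdd T) :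
    ∃ C : ℝ, 0 ≤ C ∧ ∀ x, ‖T x‖ ≤ C * ‖x‖ := by
  obtain ⟨C, hC⟩ := hT
  exact ⟨|C|, abs_nonneg C, fun x => (hC x).trans
    (mul_le_mul_of_nonneg_right (le_abs_self C) (qnorm_nonneg 𝕜 x))⟩

theorem IsBdd.id : IsBdd (LinearMap.id : E →ₗ[𝕜] E) := ⟨1, fun x => by simp⟩

theorem IsBdd.zero [QuasinormedSpace 𝕜 F] : IsBdd (0 : E →ₗ[𝕜] F) :=
  ⟨0, fun x => by simp [qnorm_zero 𝕜]⟩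

theorem IsBdd.smul [QuasinormedSpace 𝕜 F] {T : E →ₗ[𝕜] F} (c : 𝕜) (hT : IsBdd T) :
    IsBdd (c • T) := by
  obtain ⟨C, hC⟩ := hT
  refine ⟨‖c‖ * C, fun x => ?_⟩
  rw [LinearMap.smul_apply, qnorm_smul 𝕜, mul_assoc]
  exact mul_le_mul_of_nonneg_left (hC x) (norm_nonneg c)

theorem IsBdd.neg [QuasinormedSpace 𝕜 F] {T : E →ₗ[𝕜] F} (hT : IsBdd T) : IsBdd (-T) := by
  obtain ⟨C, hC⟩ := hT
  exact ⟨C, fun x => by simpa [qnorm_neg 𝕜] using hC x⟩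

theorem IsBdd.add [QuasinormedSpace 𝕜 F] {T S : E →ₗ[𝕜] F} (hT : IsBdd T) (hS : IsBdd S) :
    IsBdd (T + S) := by
  obtain ⟨C, hC⟩ := hT
  obtain ⟨D, hD⟩ := hS
  obtain ⟨M, hM1, hM⟩ := exists_modulus 𝕜 F
  refine ⟨M * (C + D), fun x => (hM _ _).trans ?_⟩
  rw [mul_assoc, add_mul]
  exact mul_le_mul_of_nonneg_left (add_le_add (hC x) (hD x)) (by linarith)

theorem IsBdd.fst : IsBdd (LinearMap.fst 𝕜 E F) :=
  ⟨1, fun x => by rw [one_mul]; exact le_max_left _ _⟩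

theorem IsBdd.snd : IsBdd (LinearMap.snd 𝕜 E F) :=
  ⟨1, fun x => by rw [one_mul]; exact le_max_right _ _⟩

theorem IsBdd.prod [QuasinormedSpace 𝕜 E] {T : E →ₗ[𝕜] F} {S : E →ₗ[𝕜] G} (hT : IsBdd T)
    (hS : IsBdd S) : IsBdd (T.prod S) := by
  obtain ⟨C, hC⟩ := hT
  obtain ⟨D, hD⟩ := hS
  refine ⟨max C D, fun x => max_le ((hC x).trans ?_) ((hD x).trans ?_)⟩
  · exact mul_le_mul_of_nonneg_right (le_max_left _ _) (qnorm_nonneg 𝕜 x)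
  · exact mul_le_mul_of_nonneg_right (le_max_right _ _) (qnorm_nonneg 𝕜 x)

instance [QuasinormedSpace 𝕜 E] [QuasinormedSpace 𝕜 F] : QuasinormedSpace 𝕜 (E × F) where
  nonneg z := le_max_of_le_left (qnorm_nonneg 𝕜 z.1)
  smul c z := by
    change max ‖c • z.1‖ ‖c • z.2‖ = ‖c‖ * max ‖z.1‖ ‖z.2‖
    rw [qnorm_smul 𝕜, qnorm_smul 𝕜, mul_max_of_nonneg _ _ (norm_nonneg c)]
  eq_zero z hz := by
    have h1 : ‖z.1‖ ≤ 0 := (le_max_left _ _).trans hz.le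
    have h2 : ‖z.2‖ ≤ 0 := (le_max_right _ _).trans hz.le
    exact Prod.ext (QuasinormedSpace.eq_zero (𝕜 := 𝕜) _ (le_antisymm h1 (qnorm_nonneg 𝕜 _)))
      (QuasinormedSpace.eq_zero (𝕜 := 𝕜) _ (le_antisymm h2 (qnorm_nonneg 𝕜 _)))
  add_le := by
    obtain ⟨C, hC1, hC⟩ := exists_modulus 𝕜 E
    obtain ⟨D, hD1, hD⟩ := exists_modulus 𝕜 F
    refine ⟨max C D, fun z w => ?_⟩
    have h1 : ‖z.1‖ + ‖w.1‖ ≤ ‖z‖ + ‖w‖ := add_le_add (le_max_left _ _) (le_max_left _ _)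
    have h2 : ‖z.2‖ + ‖w.2‖ ≤ ‖z‖ + ‖w‖ := add_le_add (le_max_right _ _) (le_max_right _ _)
    have h3 := qnorm_nonneg 𝕜 z.1
    have h4 := qnorm_nonneg 𝕜 w.1
    have h5 := qnorm_nonneg 𝕜 z.2
    have h6 := qnorm_nonneg 𝕜 w.2
    refine max_le ((hC _ _).trans ?_) ((hD _ _).trans ?_)
    · exact mul_le_mul (le_max_left _ _) h1 (by positivity) (by positivity)
    · exact mul_le_mul (le_max_right _ _) h2 (by positivity) (by positivity)

theorem convergesTo_prod {v : ℕ → E × F} {z : E × F} (h1 : ConvergesTo (fun n => (v n).1) z.1)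
    (h2 : ConvergesTo (fun n => (v n).2) z.2) : ConvergesTo v z := by
  have h := Tendsto.max h1 h2
  rw [max_self] at h
  exact h

instance [QuasiBanachSpace 𝕜 E] [QuasiBanachSpace 𝕜 F] : QuasiBanachSpace 𝕜 (E × F) where
  complete v hv := by
    obtain ⟨x, hx⟩ := QuasiBanachSpace.complete (𝕜 := 𝕜) (fun n => (v n).1) fun ε hε => by
      obtain ⟨N, hN⟩ := hv ε hε
      exact ⟨N, fun m hm n hn => (le_max_left _ _).trans_lt (hN m hm n hn)⟩
    obtain ⟨y, hy⟩ := QuasiBanachSpace.complete (𝕜 := 𝕜) (fun n => (v n).2) fun ε hε => by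
      obtain ⟨N, hN⟩ := hv ε hε
      exact ⟨N, fun m hm n hn => (le_max_right _ _).trans_lt (hN m hm n hn)⟩
    exact ⟨(x, y), convergesTo_prod hx hy⟩

/-- The kernel of a linear map, with the induced quasinorm. -/
def Ker (T : E →ₗ[𝕜] F) : Type u := LinearMap.ker T

instance (T : E →ₗ[𝕜] F) : AddCommGroup (Ker T) := inferInstanceAs (AddCommGroup (LinearMap.ker T))

instance (T : E →ₗ[𝕜] F) : Module 𝕜 (Ker T) := inferInstanceAs (Module 𝕜 (LinearMap.ker T))

/-- The inclusion of the kernel. -/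
def Ker.val (T : E →ₗ[𝕜] F) : Ker T →ₗ[𝕜] E := (LinearMap.ker T).subtype

instance (T : E →ₗ[𝕜] F) : Norm (Ker T) := ⟨fun z => ‖Ker.val T z‖⟩

theorem Ker.val_injective (T : E →ₗ[𝕜] F) : Function.Injective (Ker.val T) :=
  Subtype.val_injective

theorem Ker.map_val (T : E →ₗ[𝕜] F) (z : Ker T) : T (Ker.val T z) = 0 := z.2

/-- A linear map with values in the kernel. -/
def Ker.lift (T : E →ₗ[𝕜] F) (S : G →ₗ[𝕜] E) (h : ∀ x, T (S x) = 0) : G →ₗ[𝕜] Ker T :=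
  S.codRestrict (LinearMap.ker T) h

theorem Ker.val_bdd (T : E →ₗ[𝕜] F) : IsBdd (Ker.val T) :=
  ⟨1, fun z => by rw [one_mul]; exact le_rfl⟩

theorem Ker.lift_bdd (T : E →ₗ[𝕜] F) {S : G →ₗ[𝕜] E} (h : ∀ x, T (S x) = 0) (hS : IsBdd S) :
    IsBdd (Ker.lift T S h) := hS

instance [QuasinormedSpace 𝕜 E] (T : E →ₗ[𝕜] F) : QuasinormedSpace 𝕜 (Ker T) where
  nonneg z := qnorm_nonneg 𝕜 (Ker.val T z)
  smul c z := by
    change ‖Ker.val T (c • z)‖ = _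
    rw [map_smul]
    exact qnorm_smul 𝕜 c (Ker.val T z)
  eq_zero z hz := Ker.val_injective T
    ((QuasinormedSpace.eq_zero (𝕜 := 𝕜) (Ker.val T z) hz).trans (map_zero _).symm)
  add_le := by
    obtain ⟨C, hC1, hC⟩ := exists_modulus 𝕜 E
    exact ⟨C, fun z w => hC (Ker.val T z) (Ker.val T w)⟩

theorem ConvergesTo.map [QuasinormedSpace 𝕜 E] [QuasinormedSpace 𝕜 F] {T : E →ₗ[𝕜] F}
    (hT : IsBdd T) {v : ℕ → E} {x : E} (h : ConvergesTo v x) :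
    ConvergesTo (fun n => T (v n)) (T x) := by
  obtain ⟨C, hC⟩ := hT
  have h2 := Tendsto.const_mul C h
  rw [mul_zero] at h2
  refine squeeze_zero (fun n => qnorm_nonneg 𝕜 _) (fun n => ?_) h2
  rw [← map_sub]
  exact hC _

theorem Ker.quasiBanachSpace [QuasiBanachSpace 𝕜 E] [QuasiBanachSpace 𝕜 F] {T : E →ₗ[𝕜] F}
    (hT : IsBdd T) : QuasiBanachSpace 𝕜 (Ker T) where
  complete v hv := by
    obtain ⟨x, hx⟩ := QuasiBanachSpace.complete (𝕜 := 𝕜) (fun n => Ker.val T (v n)) hv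
    have h := hx.map hT
    have h0 : ConvergesTo (fun n => T (Ker.val T (v n))) 0 := by
      simp [ConvergesTo, Ker.map_val, qnorm_zero 𝕜]
    exact ⟨(⟨x, limit_unique 𝕜 h h0⟩ : LinearMap.ker T), hx⟩

end Bounded

/-! ### Operators on twisted sums -/

section ZSpace

variable {𝕜 X Y G : Type u} [RCLike 𝕜] [AddCommGroup X] [Module 𝕜 X] [Norm X]
  [AddCommGroup Y] [Module 𝕜 Y] [Norm Y] [QuasiBanachSpace 𝕜 X] [QuasiBanachSpace 𝕜 Y]
  [AddCommGroup G] [Module 𝕜 G] [Norm G] [QuasiBanachSpace 𝕜 G]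
  {X₀ : Submodule 𝕜 X}

/-- The linear section `x ↦ (0, x)` of the projection of a twisted sum, over `X₀`. -/
def ZSpace.sec (Φ : QuasilinearMap X₀ Y) : X₀ →ₗ[𝕜] ZSpace Φ :=
  Completion.of 𝕜 (Twist Φ) ∘ₗ LinearMap.inr 𝕜 Y X₀

theorem ZSpace.of_eq (Φ : QuasilinearMap X₀ Y) (e : Twist Φ) :
    Completion.of 𝕜 (Twist Φ) e = ZSpace.incl Φ e.1 + ZSpace.sec Φ e.2 := by
  change _ = Completion.of 𝕜 (Twist Φ) _ + Completion.of 𝕜 (Twist Φ) _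
  rw [← map_add]
  exact congrArg _ (Prod.ext (add_zero _).symm (zero_add _).symm)

/-- The vector is the class of (Φx, x), whose quasinorm in the twisted sum is ‖x‖. -/
theorem ZSpace.norm_incl_add_sec_le (Φ : QuasilinearMap X₀ Y) (x : X₀) :
    ‖ZSpace.incl Φ (Φ.toFun x) + ZSpace.sec Φ x‖ ≤ ‖(x : X)‖ := by
  have h := norm_of_le 𝕜 (Twist.lift Φ x)
  rwa [ZSpace.of_eq, norm_lift] at h

theorem ZSpace.proj_incl (Φ : QuasilinearMap X₀ Y) (y : Y) :
    ZSpace.proj Φ (ZSpace.incl Φ y) = 0 := (ZSpace.exact Φ _).2 ⟨y, rfl⟩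

theorem ZSpace.proj_sec (Φ : QuasilinearMap X₀ Y) (x : X₀) :
    ZSpace.proj Φ (ZSpace.sec Φ x) = x := extend_of _ _ _

/-- The linear map `(y, x) ↦ f y + g x` on `Y ⊕_Φ X₀`. -/
def Twist.desc (Φ : QuasilinearMap X₀ Y) (f : Y →ₗ[𝕜] G) (g : X₀ →ₗ[𝕜] G) : Twist Φ →ₗ[𝕜] G :=
  LinearMap.coprod f g

/-- The operator `(y, x) ↦ f y + g x` on a twisted sum. -/
def ZSpace.lift (Φ : QuasilinearMap X₀ Y) (f : Y →ₗ[𝕜] G) (g : X₀ →ₗ[𝕜] G) (hf : IsBdd f)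
    (h : ∃ K : ℝ, ∀ x, ‖f (Φ.toFun x) + g x‖ ≤ K * ‖(x : X)‖) : ZSpace Φ →ₗ[𝕜] G :=
  Completion.extend (Twist.desc Φ f g) (by
    obtain ⟨C, hC⟩ := hf
    obtain ⟨K, hK⟩ := h
    obtain ⟨M, hM1, hM⟩ := exists_modulus 𝕜 G
    refine ⟨M * max C K, fun z => ?_⟩
    -- The splitting (y, x) = (y - Φx, 0) + (Φx, x), in which the two parts have quasinorms adding
    -- up to that of (y, x).
    have h1 : Twist.desc Φ f g z = f (z.1 - Φ.toFun z.2) + (f (Φ.toFun z.2) + g z.2) := by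
      rw [map_sub, ← add_assoc, sub_add_cancel]
      rfl
    rw [h1, norm_twist, mul_assoc]
    refine (hM _ _).trans (mul_le_mul_of_nonneg_left ?_ (by linarith))
    rw [mul_add]
    exact add_le_add
      ((hC _).trans (mul_le_mul_of_nonneg_right (le_max_left _ _) (qnorm_nonneg 𝕜 _)))
      ((hK _).trans (mul_le_mul_of_nonneg_right (le_max_right _ _) (qnorm_nonneg 𝕜 _))))

section

variable (Φ : QuasilinearMap X₀ Y) (f : Y →ₗ[𝕜] G) (g : X₀ →ₗ[𝕜] G) (hf : IsBdd f)
    (h : ∃ K : ℝ, ∀ x, ‖f (Φ.toFun x) + g x‖ ≤ K * ‖(x : X)‖)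

theorem ZSpace.lift_incl (y : Y) : ZSpace.lift Φ f g hf h (ZSpace.incl Φ y) = f y := by
  refine (extend_of _ _ _).trans ?_
  change f y + g 0 = f y
  rw [map_zero, add_zero]

theorem ZSpace.lift_sec (x : X₀) : ZSpace.lift Φ f g hf h (ZSpace.sec Φ x) = g x := by
  refine (extend_of _ _ _).trans ?_
  change f 0 + g x = g x
  rw [map_zero, zero_add]

theorem ZSpace.lift_bdd : IsBdd (ZSpace.lift Φ f g hf h) := extend_bdd _ _

end

theorem Completion.exists_convergesTo {E : Type u} [AddCommGroup E] [Module 𝕜 E] [Norm E]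
    [QuasinormedSpace 𝕜 E] (z : Completion 𝕜 E) :
    ∃ v : ℕ → E, ConvergesTo (fun n => Completion.of 𝕜 E (v n)) z := by
  obtain ⟨v, rfl⟩ := mk_surj 𝕜 z
  refine ⟨v.1, ?_⟩
  rw [ConvergesTo, Metric.tendsto_atTop]
  intro ε hε
  obtain ⟨N, hN⟩ := v.2 (ε / 2) (by positivity)
  refine ⟨N, fun n hn => ?_⟩
  rw [Real.dist_eq, sub_zero, abs_of_nonneg (qnorm_nonneg 𝕜 _)]
  have h : ‖Completion.of 𝕜 E (v.1 n) - Completion.mk 𝕜 E v‖ ≤ ε / 2 := by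
    change ‖Completion.mk 𝕜 E _ - Completion.mk 𝕜 E _‖ ≤ _
    rw [← map_sub]
    refine norm_mk_le_of_eventually 𝕜 ?_
    filter_upwards [eventually_ge_atTop N] with m hm
    exact (hN n hn m hm).le
  linarith

/-- The space Y × X₀ is dense in its completion, and bounded operators preserve limits. -/
theorem ZSpace.hom_ext {Φ : QuasilinearMap X₀ Y} {A B : ZSpace Φ →ₗ[𝕜] G} (hA : IsBdd A)
    (hB : IsBdd B) (h1 : ∀ y, A (ZSpace.incl Φ y) = B (ZSpace.incl Φ y))
    (h2 : ∀ x, A (ZSpace.sec Φ x) = B (ZSpace.sec Φ x)) : A = B := by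
  refine LinearMap.ext fun z => ?_
  obtain ⟨v, hv⟩ := Completion.exists_convergesTo z
  have h3 := hv.map hA
  have h4 := hv.map hB
  refine limit_unique 𝕜 h3 ?_
  have e : ∀ n, A (Completion.of 𝕜 (Twist Φ) (v n)) = B (Completion.of 𝕜 (Twist Φ) (v n)) :=
    fun n => by rw [ZSpace.of_eq, map_add, map_add, h1, h2]
  simp_rw [e]
  exact h4

end ZSpace

/-! ### Equivalence of four-term sequences and scalars -/

namespace FourTerm

variable {𝕜 X Y W : Type u} [RCLike 𝕜] [AddCommGroup X] [Module 𝕜 X] [Norm X]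
  [AddCommGroup Y] [Module 𝕜 Y] [Norm Y] [AddCommGroup W] [Module 𝕜 W] [Norm W]

theorem Arrow.equiv {S T : FourTerm 𝕜 X Y} (h : S.Arrow T) : S.Equiv T := .rel _ _ h

theorem Equiv.symm {S T : FourTerm 𝕜 X Y} (h : S.Equiv T) : T.Equiv S := Relation.EqvGen.symm _ _ h

theorem Equiv.trans {S T U : FourTerm 𝕜 X Y} (h : S.Equiv T) (h' : T.Equiv U) : S.Equiv U :=
  Relation.EqvGen.trans _ _ _ h h'

theorem Equiv.map {X' Y' : Type u} [AddCommGroup X'] [Module 𝕜 X'] [Norm X'] [AddCommGroup Y']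
    [Module 𝕜 Y'] [Norm Y'] (f : FourTerm 𝕜 X Y → FourTerm 𝕜 X' Y')
    (hf : ∀ S T, S.Arrow T → (f S).Arrow (f T)) {S T : FourTerm 𝕜 X Y} (h : S.Equiv T) :
    (f S).Equiv (f T) := by
  induction h with
  | rel _ _ h => exact (hf _ _ h).equiv
  | refl _ => exact .refl _
  | symm _ _ _ ih => exact ih.symm
  | trans _ _ _ _ _ ih1 ih2 => exact ih1.trans ih2

variable [QuasiBanachSpace 𝕜 X] [QuasiBanachSpace 𝕜 Y] [QuasiBanachSpace 𝕜 W]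

theorem Equiv.isTrivial_iff {S T : FourTerm 𝕜 X Y} (h : S.Equiv T) :
    S.IsTrivial ↔ T.IsTrivial := ⟨fun hS => h.symm.trans hS, fun hT => h.trans hT⟩

/-- The sequence with the arrow `Y → E₁` multiplied by a nonzero scalar. -/
def scale (c : 𝕜) (hc : c ≠ 0) (S : FourTerm 𝕜 X Y) : FourTerm 𝕜 X Y where
  E₁ := S.E₁
  E₂ := S.E₂
  i := c • S.i
  d := S.d
  q := S.q
  i_bdd := S.i_bdd.smul c
  d_bdd := S.d_bdd
  q_bdd := S.q_bdd
  injective := fun a b h => S.injective (smul_right_injective _ hc h)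
  exact₁ := fun z => by
    rw [S.exact₁ z]
    constructor
    · rintro ⟨y, rfl⟩
      exact ⟨c⁻¹ • y, by simp [smul_smul, hc]⟩
    · rintro ⟨y, rfl⟩
      exact ⟨c • y, by simp⟩
  exact₂ := S.exact₂
  surjective := S.surjective

theorem Arrow.scale {S T : FourTerm 𝕜 X Y} (c : 𝕜) (hc : c ≠ 0) (h : S.Arrow T) :
    (S.scale c hc).Arrow (T.scale c hc) := by
  obtain ⟨u₁, u₂, h1, h2, h3, h4, h5⟩ := h
  refine ⟨u₁, u₂, h1, h2, ?_, h4, h5⟩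
  change u₁ ∘ₗ (c • S.i) = c • T.i
  rw [LinearMap.comp_smul, h3]

theorem arrow_of_i_eq {S : FourTerm 𝕜 X Y} {c : 𝕜} (hc : c ≠ 0) {c' : 𝕜} (hc' : c' ≠ 0)
    (h : c' * c = 1) : ((S.scale c hc).scale c' hc').Arrow S := by
  refine ⟨LinearMap.id, LinearMap.id, IsBdd.id, IsBdd.id, ?_, rfl, rfl⟩
  change c' • c • S.i = S.i
  rw [smul_smul, h, one_smul]

/-- The class of the zero sequence is fixed by scalars: multiplication by c⁻¹ on Y is an arrow from
its scaled form, as the middle arrow is 0. -/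
theorem IsTrivial.scale {S : FourTerm 𝕜 X Y} (c : 𝕜) (hc : c ≠ 0) (h : S.IsTrivial) :
    (S.scale c hc).IsTrivial := by
  refine (Equiv.map (FourTerm.scale c hc) (fun _ _ => Arrow.scale c hc) h).trans (Arrow.equiv ?_)
  refine ⟨c⁻¹ • LinearMap.id, LinearMap.id, IsBdd.id.smul _, IsBdd.id, ?_, ?_, rfl⟩
  · refine LinearMap.ext fun y => ?_
    change c⁻¹ • c • y = y
    rw [inv_smul_smul₀ hc]
  · refine LinearMap.ext fun y => ?_
    change (0 : Y →ₗ[𝕜] X) y = (0 : Y →ₗ[𝕜] X) _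
    rfl

theorem isTrivial_scale_iff {S : FourTerm 𝕜 X Y} (c : 𝕜) (hc : c ≠ 0) :
    (S.scale c hc).IsTrivial ↔ S.IsTrivial :=
  ⟨fun h => (arrow_of_i_eq hc (inv_ne_zero hc) (inv_mul_cancel₀ hc)).equiv.isTrivial_iff.1
    (h.scale c⁻¹ (inv_ne_zero hc)), fun h => h.scale c hc⟩

theorem neg_eq_scale (S : FourTerm 𝕜 X Y) (h : (-1 : 𝕜) ≠ 0) : S.neg = S.scale (-1) h := by
  simp only [FourTerm.neg, FourTerm.scale, neg_smul, one_smul]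

theorem isTrivial_neg_iff (S : FourTerm 𝕜 X Y) : S.neg.IsTrivial ↔ S.IsTrivial := by
  rw [neg_eq_scale S (by simp), isTrivial_scale_iff]

end FourTerm

section Splice

variable {𝕜 X Y W : Type u} [RCLike 𝕜] [AddCommGroup X] [Module 𝕜 X] [Norm X]
  [AddCommGroup Y] [Module 𝕜 Y] [Norm Y] [AddCommGroup W] [Module 𝕜 W] [Norm W]
  [QuasiBanachSpace 𝕜 X] [QuasiBanachSpace 𝕜 Y] [QuasiBanachSpace 𝕜 W]
  {X₀ : Submodule 𝕜 X} {W₀ : Submodule 𝕜 W} (hX : IsDenseSubspace X₀) (hW : IsDenseSubspace W₀)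

/-- Multiplying the arrow Y → E₁ by c⁻¹ amounts to the push-out along c, so this says (cR)C ∼ c(RC).
On the spaces, (y, w) ↦ (c⁻¹y, w) carries Z(cR) to Z(R). -/
theorem splice_arrow_scale {R R' : QuasilinearMap W₀ Y} (C : QuasilinearMap X₀ W) {c : 𝕜}
    (hc : c ≠ 0) (h : ∀ w, R'.toFun w = c • R.toFun w) :
    (splice hX hW R' C).Arrow ((splice hX hW R C).scale c⁻¹ (inv_ne_zero hc)) := by
  have hf : IsBdd (c⁻¹ • ZSpace.incl R) := (ZSpace.incl_bdd R).smul _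
  have hK : ∃ K : ℝ, ∀ w, ‖(c⁻¹ • ZSpace.incl R) (R'.toFun w) + ZSpace.sec R w‖ ≤
      K * ‖(w : W)‖ := ⟨1, fun w => by
    rw [h, LinearMap.smul_apply, map_smul, inv_smul_smul₀ hc, one_mul]
    exact ZSpace.norm_incl_add_sec_le R w⟩
  have hb := ZSpace.lift_bdd R' (c⁻¹ • ZSpace.incl R) (ZSpace.sec R) hf hK
  have e : ZSpace.proj R' =
      ZSpace.proj R ∘ₗ ZSpace.lift R' (c⁻¹ • ZSpace.incl R) (ZSpace.sec R) hf hK := by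
    refine ZSpace.hom_ext (ZSpace.proj_bdd _) ((ZSpace.proj_bdd _).comp hb) (fun y => ?_) fun w => ?_
    · rw [LinearMap.comp_apply, ZSpace.lift_incl, ZSpace.proj_incl, LinearMap.smul_apply, map_smul,
        ZSpace.proj_incl, smul_zero]
    · rw [LinearMap.comp_apply, ZSpace.lift_sec, ZSpace.proj_sec, ZSpace.proj_sec]
  refine ⟨_, LinearMap.id, hb, IsBdd.id, ?_, ?_, rfl⟩
  · exact LinearMap.ext fun y => ZSpace.lift_incl R' _ _ hf hK y
  · exact congrArg (fun f => ZSpace.incl C ∘ₗ f) e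

end Splice

/-! ### The sequence that joins R C to the opposite of R' C' -/

section Coproduct

variable {𝕜 X Y W : Type u} [RCLike 𝕜] [AddCommGroup X] [Module 𝕜 X] [Norm X]
  [AddCommGroup Y] [Module 𝕜 Y] [Norm Y] [AddCommGroup W] [Module 𝕜 W] [Norm W]
  [QuasiBanachSpace 𝕜 X] [QuasiBanachSpace 𝕜 Y] [QuasiBanachSpace 𝕜 W]
  {X₀ : Submodule 𝕜 X} {W₀ : Submodule 𝕜 W}

/-- The quasilinear map `(w, w') ↦ R w + R' w'`. -/
def QuasilinearMap.coprod (R R' : QuasilinearMap W₀ Y) : QuasilinearMap (W₀.prod W₀) Y where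
  toFun w := R.toFun ⟨w.1.1, w.2.1⟩ + R'.toFun ⟨w.1.2, w.2.2⟩
  map_smul c w := by
    rw [smul_add, ← R.map_smul, ← R'.map_smul]
    rfl
  quasi := by
    obtain ⟨M, hM1, hM⟩ := exists_modulus 𝕜 Y
    obtain ⟨Q, hQ⟩ := R.quasi
    obtain ⟨Q', hQ'⟩ := R'.quasi
    refine ⟨M * (|Q| + |Q'|), fun w v => ?_⟩
    have h1 := hQ ⟨w.1.1, w.2.1⟩ ⟨v.1.1, v.2.1⟩
    have h2 := hQ' ⟨w.1.2, w.2.2⟩ ⟨v.1.2, v.2.2⟩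
    have k1 : ‖w.1.1‖ + ‖v.1.1‖ ≤ ‖w.1‖ + ‖v.1‖ := add_le_add (le_max_left _ _) (le_max_left _ _)
    have k2 : ‖w.1.2‖ + ‖v.1.2‖ ≤ ‖w.1‖ + ‖v.1‖ :=
      add_le_add (le_max_right _ _) (le_max_right _ _)
    have n1 := add_nonneg (qnorm_nonneg 𝕜 w.1.1) (qnorm_nonneg 𝕜 v.1.1)
    have n2 := add_nonneg (qnorm_nonneg 𝕜 w.1.2) (qnorm_nonneg 𝕜 v.1.2)
    have e : ∀ a b c a' b' c' : Y, (a + a') - (b + b') - (c + c') = (a - b - c) + (a' - b' - c') :=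
      fun a b c a' b' c' => by abel
    rw [e, mul_assoc, add_mul]
    refine (hM _ _).trans (mul_le_mul_of_nonneg_left (add_le_add (h1.trans ?_) (h2.trans ?_))
      (by linarith))
    · exact mul_le_mul (le_abs_self Q) k1 n1 (abs_nonneg Q)
    · exact mul_le_mul (le_abs_self Q') k2 n2 (abs_nonneg Q')

/-- The inclusion of a subspace in the first factor of its square. -/
def inlSub (W₀ : Submodule 𝕜 W) : W₀ →ₗ[𝕜] W₀.prod W₀ where
  toFun w := ⟨(w.1, 0), w.2, W₀.zero_mem⟩
  map_add' _ _ := Subtype.ext (Prod.ext rfl (add_zero _).symm)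
  map_smul' c _ := Subtype.ext (Prod.ext rfl (smul_zero c).symm)

/-- The inclusion of a subspace in the second factor of its square. -/
def inrSub (W₀ : Submodule 𝕜 W) : W₀ →ₗ[𝕜] W₀.prod W₀ where
  toFun w := ⟨(0, w.1), W₀.zero_mem, w.2⟩
  map_add' _ _ := Subtype.ext (Prod.ext (add_zero _).symm rfl)
  map_smul' c _ := Subtype.ext (Prod.ext (smul_zero c).symm rfl)

variable (R R' : QuasilinearMap W₀ Y)

theorem coprod_inl (w : W₀) : (R.coprod R').toFun (inlSub W₀ w) = R.toFun w := by
  change R.toFun w + R'.toFun 0 = _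
  rw [R'.map_zero, add_zero]

theorem coprod_inr (w : W₀) : (R.coprod R').toFun (inrSub W₀ w) = R'.toFun w := by
  change R.toFun 0 + R'.toFun w = _
  rw [R.map_zero, zero_add]

theorem norm_inlSub (w : W₀) : ‖(inlSub W₀ w : W × W)‖ = ‖(w : W)‖ := by
  change max ‖(w : W)‖ ‖(0 : W)‖ = _
  rw [qnorm_zero 𝕜, max_eq_left (qnorm_nonneg 𝕜 _)]

theorem norm_inrSub (w : W₀) : ‖(inrSub W₀ w : W × W)‖ = ‖(w : W)‖ := by
  change max ‖(0 : W)‖ ‖(w : W)‖ = _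
  rw [qnorm_zero 𝕜, max_eq_right (qnorm_nonneg 𝕜 _)]

theorem inl_estimate : ∃ K : ℝ, ∀ w : W₀, ‖ZSpace.incl (R.coprod R') (R.toFun w) +
    (ZSpace.sec (R.coprod R') ∘ₗ inlSub W₀) w‖ ≤ K * ‖(w : W)‖ := ⟨1, fun w => by
  rw [← coprod_inl R R', one_mul, ← norm_inlSub w]
  exact ZSpace.norm_incl_add_sec_le (R.coprod R') (inlSub W₀ w)⟩

theorem inr_estimate : ∃ K : ℝ, ∀ w : W₀, ‖ZSpace.incl (R.coprod R') (R'.toFun w) +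
    (ZSpace.sec (R.coprod R') ∘ₗ inrSub W₀) w‖ ≤ K * ‖(w : W)‖ := ⟨1, fun w => by
  rw [← coprod_inr R R', one_mul, ← norm_inrSub w]
  exact ZSpace.norm_incl_add_sec_le (R.coprod R') (inrSub W₀ w)⟩

/-- The operator `Z(R) → Z(R ⊕ R')`. -/
def coprodInl : ZSpace R →ₗ[𝕜] ZSpace (R.coprod R') :=
  ZSpace.lift R (ZSpace.incl (R.coprod R')) (ZSpace.sec (R.coprod R') ∘ₗ inlSub W₀)
    (ZSpace.incl_bdd _) (inl_estimate R R')

/-- The operator `Z(R') → Z(R ⊕ R')`. -/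
def coprodInr : ZSpace R' →ₗ[𝕜] ZSpace (R.coprod R') :=
  ZSpace.lift R' (ZSpace.incl (R.coprod R')) (ZSpace.sec (R.coprod R') ∘ₗ inrSub W₀)
    (ZSpace.incl_bdd _) (inr_estimate R R')

theorem coprodInl_bdd : IsBdd (coprodInl R R') := ZSpace.lift_bdd _ _ _ _ _

theorem coprodInr_bdd : IsBdd (coprodInr R R') := ZSpace.lift_bdd _ _ _ _ _

theorem coprodInl_incl (y : Y) :
    coprodInl R R' (ZSpace.incl R y) = ZSpace.incl (R.coprod R') y := ZSpace.lift_incl _ _ _ _ _ y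

theorem coprodInr_incl (y : Y) :
    coprodInr R R' (ZSpace.incl R' y) = ZSpace.incl (R.coprod R') y := ZSpace.lift_incl _ _ _ _ _ y

theorem proj_comp_coprodInl : ZSpace.proj (R.coprod R') ∘ₗ coprodInl R R' =
    (ZSpace.proj R).prod 0 := by
  refine ZSpace.hom_ext ((ZSpace.proj_bdd _).comp (coprodInl_bdd R R'))
    ((ZSpace.proj_bdd R).prod IsBdd.zero) (fun y => ?_) fun w => ?_
  · rw [LinearMap.comp_apply, coprodInl_incl, ZSpace.proj_incl]
    exact Prod.ext (ZSpace.proj_incl R y).symm rfl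
  · rw [LinearMap.comp_apply, coprodInl, ZSpace.lift_sec, LinearMap.comp_apply, ZSpace.proj_sec]
    exact Prod.ext (ZSpace.proj_sec R w).symm rfl

theorem proj_comp_coprodInr : ZSpace.proj (R.coprod R') ∘ₗ coprodInr R R' =
    (0 : ZSpace R' →ₗ[𝕜] W).prod (ZSpace.proj R') := by
  refine ZSpace.hom_ext ((ZSpace.proj_bdd _).comp (coprodInr_bdd R R'))
    (IsBdd.zero.prod (ZSpace.proj_bdd R')) (fun y => ?_) fun w => ?_
  · rw [LinearMap.comp_apply, coprodInr_incl, ZSpace.proj_incl]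
    exact Prod.ext rfl (ZSpace.proj_incl R' y).symm
  · rw [LinearMap.comp_apply, coprodInr, ZSpace.lift_sec, LinearMap.comp_apply, ZSpace.proj_sec]
    exact Prod.ext rfl (ZSpace.proj_sec R' w).symm

/-- The operator `Z(R) × Z(R') → Z(R ⊕ R')`. -/
def coprodDesc : ZSpace R × ZSpace R' →ₗ[𝕜] ZSpace (R.coprod R') :=
  coprodInl R R' ∘ₗ LinearMap.fst 𝕜 _ _ + coprodInr R R' ∘ₗ LinearMap.snd 𝕜 _ _

theorem coprodDesc_bdd : IsBdd (coprodDesc R R') :=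
  ((coprodInl_bdd R R').comp IsBdd.fst).add ((coprodInr_bdd R R').comp IsBdd.snd)

theorem proj_coprodDesc (z : ZSpace R × ZSpace R') :
    ZSpace.proj (R.coprod R') (coprodDesc R R' z) = (ZSpace.proj R z.1, ZSpace.proj R' z.2) := by
  have h1 := LinearMap.congr_fun (proj_comp_coprodInl R R') z.1
  have h2 := LinearMap.congr_fun (proj_comp_coprodInr R R') z.2
  change ZSpace.proj (R.coprod R') (coprodInl R R' z.1 + coprodInr R R' z.2) = _
  rw [map_add]
  refine (congrArg₂ (· + ·) h1 h2).trans ?_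
  exact Prod.ext (add_zero _) (zero_add _)

/-- Z(R ⊕ R') is the push-out of the two inclusions of Y; together with surjectivity, this presents
it as the quotient of Z(R) × Z(R') by the antidiagonal copy of Y. -/
theorem coprodDesc_exact : Function.Exact
    ((ZSpace.incl R).prod (-ZSpace.incl R') : Y →ₗ[𝕜] ZSpace R × ZSpace R') (coprodDesc R R') := by
  intro z
  constructor
  · intro hz
    have h := proj_coprodDesc R R' z
    rw [hz, map_zero] at h
    obtain ⟨y, hy⟩ := (ZSpace.exact R z.1).1 (congrArg Prod.fst h).symm
    obtain ⟨y', hy'⟩ := (ZSpace.exact R' z.2).1 (congrArg Prod.snd h).symm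
    change coprodInl R R' z.1 + coprodInr R R' z.2 = 0 at hz
    rw [← hy, ← hy', coprodInl_incl, coprodInr_incl, ← map_add] at hz
    have h2 := ZSpace.incl_injective _ (hz.trans (map_zero _).symm)
    refine ⟨y, Prod.ext hy ?_⟩
    change -ZSpace.incl R' y = z.2
    rw [← hy', ← map_neg, eq_neg_of_add_eq_zero_right h2]
  · rintro ⟨y, rfl⟩
    change coprodInl R R' (ZSpace.incl R y) + coprodInr R R' (-ZSpace.incl R' y) = 0
    rw [map_neg, coprodInl_incl, coprodInr_incl, add_neg_cancel]

/-- Lift the two coordinates of the projection separately; the difference comes from Y, which is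
already in the image of Z(R). -/
theorem coprodDesc_surjective (hW : IsDenseSubspace W₀) :
    Function.Surjective (coprodDesc R R') := by
  intro z
  obtain ⟨a, ha⟩ := ZSpace.proj_surjective R hW (ZSpace.proj (R.coprod R') z).1
  obtain ⟨b, hb⟩ := ZSpace.proj_surjective R' hW (ZSpace.proj (R.coprod R') z).2
  have h : ZSpace.proj (R.coprod R') (z - coprodDesc R R' (a, b)) = 0 := by
    rw [map_sub, proj_coprodDesc, ha, hb]
    exact sub_self _
  obtain ⟨y, hy⟩ := (ZSpace.exact _ _).1 h
  refine ⟨(a, b) + (ZSpace.incl R y, 0), ?_⟩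
  rw [map_add, ← sub_add_cancel z (coprodDesc R R' (a, b)), ← hy, add_comm]
  congr 1
  change coprodInl R R' (ZSpace.incl R y) + coprodInr R R' 0 = _
  rw [map_zero, add_zero, coprodInl_incl]

/-- The quasilinear map `x ↦ (L x, (c x, c' x))` with values in `Z(R ⊕ R')`. -/
def cocycleMap (c c' : X₀ → W₀) (L : X₀ → Y) (hc : ∀ (t : 𝕜) x, c (t • x) = t • c x)
    (hc' : ∀ (t : 𝕜) x, c' (t • x) = t • c' x) (hL : ∀ (t : 𝕜) x, L (t • x) = t • L x)
    (hdc : ∃ K : ℝ, ∀ x y, ‖(c (x + y) - c x - c y : W₀).1‖ ≤ K * (‖x.1‖ + ‖y.1‖))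
    (hdc' : ∃ K : ℝ, ∀ x y, ‖(c' (x + y) - c' x - c' y : W₀).1‖ ≤ K * (‖x.1‖ + ‖y.1‖))
    (hdL : ∃ K : ℝ, ∀ x y, ‖L (x + y) - L x - L y - R.toFun (c (x + y) - c x - c y) -
      R'.toFun (c' (x + y) - c' x - c' y)‖ ≤ K * (‖x.1‖ + ‖y.1‖)) :
    QuasilinearMap X₀ (ZSpace (R.coprod R')) where
  toFun x := ZSpace.incl _ (L x) + ZSpace.sec _ (inlSub W₀ (c x) + inrSub W₀ (c' x))
  map_smul t x := by
    rw [hL, hc, hc', map_smul, map_smul (inlSub W₀), map_smul (inrSub W₀), ← smul_add, map_smul,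
      smul_add]
  quasi := by
    obtain ⟨M, hM1, hM⟩ := exists_modulus 𝕜 (ZSpace (R.coprod R'))
    obtain ⟨D, hD⟩ := ZSpace.incl_bdd (R.coprod R')
    obtain ⟨D, hD0, hD⟩ := IsBdd.exists_nonneg ⟨D, hD⟩
    obtain ⟨K₁, hK₁⟩ := hdc
    obtain ⟨K₂, hK₂⟩ := hdc'
    obtain ⟨K₃, hK₃⟩ := hdL
    refine ⟨M * (D * K₃ + max K₁ K₂), fun x y => ?_⟩
    set a := c (x + y) - c x - c y with ha
    set b := c' (x + y) - c' x - c' y with hb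
    set w : W₀.prod W₀ := inlSub W₀ a + inrSub W₀ b with hw
    have hw1 : (w : W × W) = ((a : W), (b : W)) := Prod.ext (add_zero _) (zero_add _)
    have hn : ‖(w : W × W)‖ ≤ max K₁ K₂ * (‖x.1‖ + ‖y.1‖) := by
      rw [hw1]
      have h0 := add_nonneg (qnorm_nonneg 𝕜 x.1) (qnorm_nonneg 𝕜 y.1)
      exact max_le ((hK₁ x y).trans (mul_le_mul_of_nonneg_right (le_max_left _ _) h0))
        ((hK₂ x y).trans (mul_le_mul_of_nonneg_right (le_max_right _ _) h0))
    have hRw : (R.coprod R').toFun w = R.toFun a + R'.toFun b := by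
      change R.toFun ⟨(w : W × W).1, _⟩ + R'.toFun ⟨(w : W × W).2, _⟩ = _
      congr 2
      · exact Subtype.ext (congrArg Prod.fst hw1)
      · exact Subtype.ext (congrArg Prod.snd hw1)
    -- The failure of additivity splits into the class of ((R ⊕ R')w, w), of quasinorm at most ‖w‖
    -- where w is the pair of defects of c and c', and an element of Y which is exactly the quantity
    -- bounded in `hdL`.
    have e : (ZSpace.incl (R.coprod R') (L (x + y)) +
          ZSpace.sec _ (inlSub W₀ (c (x + y)) + inrSub W₀ (c' (x + y)))) -
        (ZSpace.incl _ (L x) + ZSpace.sec _ (inlSub W₀ (c x) + inrSub W₀ (c' x))) -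
        (ZSpace.incl _ (L y) + ZSpace.sec _ (inlSub W₀ (c y) + inrSub W₀ (c' y))) =
        ZSpace.incl _ (L (x + y) - L x - L y - R.toFun a - R'.toFun b) +
        (ZSpace.incl _ ((R.coprod R').toFun w) + ZSpace.sec _ w) := by
      rw [hRw, hw, ha, hb]
      simp only [map_add, map_sub]
      abel
    rw [e, mul_assoc, add_mul, mul_assoc]
    refine (hM _ _).trans (mul_le_mul_of_nonneg_left (add_le_add ?_ ?_) (by linarith))
    · exact (hD _).trans (mul_le_mul_of_nonneg_left (hK₃ x y) hD0)
    · exact (ZSpace.norm_incl_add_sec_le _ w).trans hn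

/-- When the cocycle of R C + R' C' is, up to bounded error, the coboundary of L, the pair (C, C')
lifts to a quasilinear map ω into Z(R ⊕ R'). Splicing Y → Z(R) × Z(R') → Z(R ⊕ R') with the sequence
of ω gives a sequence over X. Projecting to the first factors maps it to R C, and projecting to the
second factors maps it to -R' C', the sign coming from the antidiagonal. The maps c and c' replace C
and C' because R and R' are defined on W₀ only. -/
theorem splice_equiv_neg_splice (hX : IsDenseSubspace X₀) (hW : IsDenseSubspace W₀)
    (C C' : QuasilinearMap X₀ W)
    (c c' : X₀ → W₀) (L : X₀ → Y) (hc : ∀ (t : 𝕜) x, c (t • x) = t • c x)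
    (hc' : ∀ (t : 𝕜) x, c' (t • x) = t • c' x) (hL : ∀ (t : 𝕜) x, L (t • x) = t • L x)
    (hdc : ∃ K : ℝ, ∀ x y, ‖(c (x + y) - c x - c y : W₀).1‖ ≤ K * (‖x.1‖ + ‖y.1‖))
    (hdc' : ∃ K : ℝ, ∀ x y, ‖(c' (x + y) - c' x - c' y : W₀).1‖ ≤ K * (‖x.1‖ + ‖y.1‖))
    (hdL : ∃ K : ℝ, ∀ x y, ‖L (x + y) - L x - L y - R.toFun (c (x + y) - c x - c y) -
      R'.toFun (c' (x + y) - c' x - c' y)‖ ≤ K * (‖x.1‖ + ‖y.1‖))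
    (hC : ∃ K : ℝ, ∀ x, ‖(c x : W) - C.toFun x‖ ≤ K * ‖x.1‖)
    (hC' : ∃ K : ℝ, ∀ x, ‖(c' x : W) - C'.toFun x‖ ≤ K * ‖x.1‖) :
    (splice hX hW R C).Equiv (splice hX hW R' C').neg := by
  let ω := cocycleMap R R' c c' L hc hc' hL hdc hdc' hdL
  let S : FourTerm 𝕜 X Y :=
    { E₁ := ZSpace R × ZSpace R'
      E₂ := ZSpace ω
      i := (ZSpace.incl R).prod (-ZSpace.incl R')
      d := ZSpace.incl ω ∘ₗ coprodDesc R R'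
      q := ZSpace.proj ω
      i_bdd := (ZSpace.incl_bdd R).prod (ZSpace.incl_bdd R').neg
      d_bdd := (ZSpace.incl_bdd ω).comp (coprodDesc_bdd R R')
      q_bdd := ZSpace.proj_bdd ω
      injective := fun a b h => ZSpace.incl_injective R (congrArg Prod.fst h)
      exact₁ := fun z => by
        rw [← coprodDesc_exact R R' z, LinearMap.comp_apply]
        exact map_eq_zero_iff _ (ZSpace.incl_injective ω)
      exact₂ := fun z => by
        rw [ZSpace.exact ω z, LinearMap.coe_comp, (coprodDesc_surjective R R' hW).range_comp]
      surjective := ZSpace.proj_surjective ω hX }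
  -- A coordinate projection f of W × W sends ω to c or c', which is at bounded distance from B, so
  -- it induces an operator Z(ω) → Z(B) over the identity of X.
  have key : ∀ (B : QuasilinearMap X₀ W) (b : X₀ → W₀) (f : W × W →ₗ[𝕜] W),
      (∃ K : ℝ, ∀ x, ‖(b x : W) - B.toFun x‖ ≤ K * ‖x.1‖) → IsBdd f →
      (∀ x, f ((c x : W), (c' x : W)) = b x) →
      ∃ u : ZSpace ω →ₗ[𝕜] ZSpace B, IsBdd u ∧ ZSpace.proj B ∘ₗ u = ZSpace.proj ω ∧
        ∀ z, u (ZSpace.incl ω z) = ZSpace.incl B (f (ZSpace.proj _ z)) := by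
    intro B b f hB hf hfb
    have hF : IsBdd (ZSpace.incl B ∘ₗ f ∘ₗ ZSpace.proj (R.coprod R')) :=
      (ZSpace.incl_bdd B).comp (hf.comp (ZSpace.proj_bdd _))
    have hK : ∃ K : ℝ, ∀ x, ‖(ZSpace.incl B ∘ₗ f ∘ₗ ZSpace.proj (R.coprod R')) (ω.toFun x) +
        ZSpace.sec B x‖ ≤ K * ‖x.1‖ := by
      obtain ⟨K, hK⟩ := hB
      obtain ⟨M, hM1, hM⟩ := exists_modulus 𝕜 (ZSpace B)
      obtain ⟨D, hD0, hD⟩ := (ZSpace.incl_bdd B).exists_nonneg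
      refine ⟨M * (D * K + 1), fun x => ?_⟩
      have e : f (ZSpace.proj (R.coprod R') (ω.toFun x)) = b x := by
        have e1 : ω.toFun x = ZSpace.incl _ (L x) +
          ZSpace.sec _ (inlSub W₀ (c x) + inrSub W₀ (c' x)) := rfl
        rw [e1, map_add, ZSpace.proj_incl, ZSpace.proj_sec, zero_add, ← hfb]
        exact congrArg f (Prod.ext (add_zero _) (zero_add _))
      rw [LinearMap.comp_apply, LinearMap.comp_apply, e]
      have e2 : ZSpace.incl B (b x) + ZSpace.sec B x = ZSpace.incl B (b x - B.toFun x) +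
          (ZSpace.incl B (B.toFun x) + ZSpace.sec B x) := by
        rw [map_sub]
        abel
      rw [e2, mul_assoc, add_mul, mul_assoc]
      refine (hM _ _).trans (mul_le_mul_of_nonneg_left (add_le_add ?_ ?_) (by linarith))
      · exact (hD _).trans (mul_le_mul_of_nonneg_left (hK x) hD0)
      · rw [one_mul]
        exact ZSpace.norm_incl_add_sec_le B x
    have hb := ZSpace.lift_bdd ω _ (ZSpace.sec B) hF hK
    refine ⟨_, hb, ?_, fun z => ZSpace.lift_incl ω _ _ hF hK z⟩
    refine ZSpace.hom_ext ((ZSpace.proj_bdd B).comp hb) (ZSpace.proj_bdd ω) (fun z => ?_) fun x => ?_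
    · rw [LinearMap.comp_apply, ZSpace.lift_incl, ZSpace.proj_incl, LinearMap.comp_apply,
        ZSpace.proj_incl]
    · rw [LinearMap.comp_apply, ZSpace.lift_sec, ZSpace.proj_sec, ZSpace.proj_sec]
  have h1 : S.Arrow (splice hX hW R C) := by
    obtain ⟨u, hu, hu1, hu2⟩ := key C c (LinearMap.fst 𝕜 W W) hC IsBdd.fst fun x => rfl
    have hfst : IsBdd (LinearMap.fst 𝕜 (ZSpace R) (ZSpace R')) := IsBdd.fst
    refine ⟨_, u, hfst, hu, rfl, LinearMap.ext fun z => ?_, hu1⟩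
    refine (hu2 _).trans ?_
    rw [proj_coprodDesc]
    rfl
  have h2 : S.Arrow (splice hX hW R' C').neg := by
    obtain ⟨u, hu, hu1, hu2⟩ := key C' c' (LinearMap.snd 𝕜 W W) hC' IsBdd.snd fun x => rfl
    have hsnd : IsBdd (LinearMap.snd 𝕜 (ZSpace R) (ZSpace R')) := IsBdd.snd
    refine ⟨_, u, hsnd, hu, rfl, LinearMap.ext fun z => ?_, hu1⟩
    refine (hu2 _).trans ?_
    rw [proj_coprodDesc]
    rfl
  exact h1.equiv.symm.trans h2.equiv

end Coproduct

/-! ### Baer sums with a spliced sequence -/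

section AddSplice

variable {𝕜 X Y W : Type u} [RCLike 𝕜] [AddCommGroup X] [Module 𝕜 X] [Norm X]
  [AddCommGroup Y] [Module 𝕜 Y] [Norm Y] [AddCommGroup W] [Module 𝕜 W] [Norm W]
  [QuasiBanachSpace 𝕜 X] [QuasiBanachSpace 𝕜 Y] [QuasiBanachSpace 𝕜 W]
  {X₀ : Submodule 𝕜 X} {W₀ : Submodule 𝕜 W}

/-- The composition of a quasilinear map with an operator. -/
def QuasilinearMap.postcomp {E : Type u} [AddCommGroup E] [Module 𝕜 E] [Norm E]
    (Φ : QuasilinearMap W₀ Y) (i : Y →ₗ[𝕜] E) (hi : IsBdd i) : QuasilinearMap W₀ E where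
  toFun w := i (Φ.toFun w)
  map_smul c w := by rw [Φ.map_smul, i.map_smul]
  quasi := by
    obtain ⟨C, hC0, hC⟩ := hi.exists_nonneg
    obtain ⟨Q, hQ⟩ := Φ.quasi
    refine ⟨C * Q, fun x y => ?_⟩
    rw [← map_sub, ← map_sub, mul_assoc]
    exact (hC _).trans (mul_le_mul_of_nonneg_left (hQ x y) hC0)

variable (hX : IsDenseSubspace X₀) (hW : IsDenseSubspace W₀)
  (Φ : QuasilinearMap W₀ Y) (Ψ : QuasilinearMap X₀ W)

namespace FourTerm

section

variable (T : FourTerm 𝕜 X Y)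

/-- The operator that `T.d` induces on the push-out of `T.E₁` and `Z(Φ)`. -/
def pushD : ZSpace (Φ.postcomp T.i T.i_bdd) →ₗ[𝕜] T.E₂ :=
  ZSpace.lift (Φ.postcomp T.i T.i_bdd) T.d 0 T.d_bdd ⟨0, fun w => by
    have h : T.d (T.i (Φ.toFun w)) = 0 := (T.exact₁ _).2 ⟨_, rfl⟩
    have h2 : T.d ((Φ.postcomp T.i T.i_bdd).toFun w) = 0 := h
    rw [h2, LinearMap.zero_apply, add_zero, qnorm_zero 𝕜, zero_mul]⟩

theorem pushD_bdd : IsBdd (pushD Φ T) := ZSpace.lift_bdd _ _ _ _ _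

theorem pushD_incl (e : T.E₁) : pushD Φ T (ZSpace.incl _ e) = T.d e := ZSpace.lift_incl _ _ _ _ _ e

theorem pushD_sec (w : W₀) : pushD Φ T (ZSpace.sec _ w) = 0 := ZSpace.lift_sec _ _ _ _ _ w

theorem q_pushD (z : ZSpace (Φ.postcomp T.i T.i_bdd)) : T.q (pushD Φ T z) = 0 := by
  have h : T.q ∘ₗ pushD Φ T = 0 := by
    refine ZSpace.hom_ext (T.q_bdd.comp (pushD_bdd Φ T)) IsBdd.zero (fun e => ?_) fun w => ?_
    · rw [LinearMap.comp_apply, pushD_incl]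
      exact (T.exact₂ _).2 ⟨e, rfl⟩
    · rw [LinearMap.comp_apply, pushD_sec, map_zero]
      rfl
  exact LinearMap.congr_fun h z

/-- The difference of the arrows `T.E₂ → X` and `Z(Ψ) → X`, whose kernel is their pull-back. -/
def pullDiff : T.E₂ × ZSpace Ψ →ₗ[𝕜] X :=
  T.q ∘ₗ LinearMap.fst 𝕜 _ _ - ZSpace.proj Ψ ∘ₗ LinearMap.snd 𝕜 _ _

theorem pullDiff_apply (z : T.E₂ × ZSpace Ψ) :
    pullDiff Ψ T z = T.q z.1 - ZSpace.proj Ψ z.2 := rfl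

theorem pullDiff_bdd : IsBdd (pullDiff Ψ T) := by
  rw [pullDiff, sub_eq_add_neg]
  exact (T.q_bdd.comp IsBdd.fst).add ((ZSpace.proj_bdd Ψ).comp IsBdd.snd).neg

/-- The middle arrow of the sum of `T` and `Φ Ψ`. -/
def addD : ZSpace (Φ.postcomp T.i T.i_bdd) →ₗ[𝕜] Ker (pullDiff Ψ T) :=
  Ker.lift _ ((pushD Φ T).prod (ZSpace.incl Ψ ∘ₗ ZSpace.proj _)) fun z => by
    rw [pullDiff_apply]
    change T.q (pushD Φ T z) - ZSpace.proj Ψ (ZSpace.incl Ψ _) = 0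
    rw [q_pushD, ZSpace.proj_incl, sub_zero]

theorem val_addD (z : ZSpace (Φ.postcomp T.i T.i_bdd)) :
    Ker.val _ (addD Φ Ψ T z) = (pushD Φ T z, ZSpace.incl Ψ (ZSpace.proj _ z)) := rfl

theorem addD_bdd : IsBdd (addD Φ Ψ T) :=
  Ker.lift_bdd _ _ ((pushD_bdd Φ T).prod ((ZSpace.incl_bdd Ψ).comp (ZSpace.proj_bdd _)))

/-- The Baer sum of the sequences `T` and `Φ Ψ`. -/
def addSplice : FourTerm 𝕜 X Y where
  E₁ := ZSpace (Φ.postcomp T.i T.i_bdd)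
  E₂ := Ker (pullDiff Ψ T)
  quasiBanach₂ := Ker.quasiBanachSpace (pullDiff_bdd Ψ T)
  i := ZSpace.incl _ ∘ₗ T.i
  d := addD Φ Ψ T
  q := T.q ∘ₗ LinearMap.fst 𝕜 _ _ ∘ₗ Ker.val _
  i_bdd := (ZSpace.incl_bdd _).comp T.i_bdd
  d_bdd := addD_bdd Φ Ψ T
  q_bdd := T.q_bdd.comp (IsBdd.fst.comp (Ker.val_bdd _))
  injective := (ZSpace.incl_injective _).comp T.injective
  exact₁ := fun z => by
    constructor
    · intro hz
      have h : Ker.val _ (addD Φ Ψ T z) = 0 := by rw [hz, map_zero]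
      rw [val_addD] at h
      have h2 : ZSpace.proj _ z = 0 :=
        ZSpace.incl_injective Ψ ((congrArg Prod.snd h).trans (map_zero _).symm)
      obtain ⟨e, rfl⟩ := (ZSpace.exact _ z).1 h2
      have h3 := congrArg Prod.fst h
      rw [pushD_incl] at h3
      obtain ⟨y, rfl⟩ := (T.exact₁ e).1 h3
      exact ⟨y, rfl⟩
    · rintro ⟨y, rfl⟩
      refine Ker.val_injective _ ?_
      rw [val_addD, map_zero, LinearMap.comp_apply, pushD_incl, ZSpace.proj_incl, map_zero,
        (T.exact₁ _).2 ⟨y, rfl⟩]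
      rfl
  exact₂ := fun z => by
    constructor
    · intro hz
      have hz1 : T.q (Ker.val _ z).1 = 0 := hz
      have hz2 := Ker.map_val _ z
      rw [pullDiff_apply, hz1, zero_sub, neg_eq_zero] at hz2
      obtain ⟨w, hw⟩ := (ZSpace.exact Ψ _).1 hz2
      obtain ⟨ζ, rfl⟩ := ZSpace.proj_surjective (Φ.postcomp T.i T.i_bdd) hW w
      -- Once ζ accounts for the Z(Ψ)-component, the remainder in `T.E₂` is killed by `T.q` and so
      -- comes from `T.E₁`.
      obtain ⟨b, hb⟩ := (T.exact₂ ((Ker.val _ z).1 - pushD Φ T ζ)).1 (by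
        rw [map_sub, hz1, q_pushD, sub_zero])
      refine ⟨ζ + ZSpace.incl _ b, Ker.val_injective _ ?_⟩
      rw [val_addD, map_add, map_add, pushD_incl, hb, ZSpace.proj_incl, add_zero, hw,
        add_sub_cancel]
    · rintro ⟨ζ, rfl⟩
      exact q_pushD Φ T ζ
  surjective := fun x => by
    obtain ⟨e, rfl⟩ := T.surjective x
    obtain ⟨z, hz⟩ := ZSpace.proj_surjective Ψ hX (T.q e)
    have h : pullDiff Ψ T (e, z) = 0 := by rw [pullDiff_apply, hz, sub_self]
    exact ⟨(⟨(e, z), h⟩ : LinearMap.ker (pullDiff Ψ T)), rfl⟩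

end

/-- Functoriality of the push-out and the pull-back; with `Equiv.map` it follows that adding Φ Ψ
respects equivalence. -/
theorem Arrow.addSplice {S T : FourTerm 𝕜 X Y} (h : S.Arrow T) :
    (addSplice hX hW Φ Ψ S).Arrow (addSplice hX hW Φ Ψ T) := by
  obtain ⟨u₁, u₂, h1, h2, h3, h4, h5⟩ := h
  have hf : IsBdd (ZSpace.incl (Φ.postcomp T.i T.i_bdd) ∘ₗ u₁) := (ZSpace.incl_bdd _).comp h1
  have hK : ∃ K : ℝ, ∀ w, ‖(ZSpace.incl (Φ.postcomp T.i T.i_bdd) ∘ₗ u₁)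
      ((Φ.postcomp S.i S.i_bdd).toFun w) + ZSpace.sec (Φ.postcomp T.i T.i_bdd) w‖ ≤
      K * ‖(w : W)‖ := ⟨1, fun w => by
    have e : u₁ ((Φ.postcomp S.i S.i_bdd).toFun w) = (Φ.postcomp T.i T.i_bdd).toFun w :=
      LinearMap.congr_fun h3 (Φ.toFun w)
    rw [LinearMap.comp_apply, e, one_mul]
    exact ZSpace.norm_incl_add_sec_le _ w⟩
  have hv := ZSpace.lift_bdd _ _ (ZSpace.sec (Φ.postcomp T.i T.i_bdd)) hf hK
  have hv1 := ZSpace.lift_incl _ _ (ZSpace.sec (Φ.postcomp T.i T.i_bdd)) hf hK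
  have hv2 := ZSpace.lift_sec _ _ (ZSpace.sec (Φ.postcomp T.i T.i_bdd)) hf hK
  set v := ZSpace.lift _ _ (ZSpace.sec (Φ.postcomp T.i T.i_bdd)) hf hK
  let U : Ker (pullDiff Ψ S) →ₗ[𝕜] T.E₂ × ZSpace Ψ :=
    (u₂ ∘ₗ LinearMap.fst 𝕜 _ _ ∘ₗ Ker.val _).prod (LinearMap.snd 𝕜 _ _ ∘ₗ Ker.val _)
  have hU : IsBdd U := (h2.comp (IsBdd.fst.comp (Ker.val_bdd _))).prod
    (IsBdd.snd.comp (Ker.val_bdd _))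
  have hU0 : ∀ z, pullDiff Ψ T (U z) = 0 := fun z => by
    have e : T.q (u₂ (Ker.val _ z).1) = S.q (Ker.val _ z).1 := LinearMap.congr_fun h5 _
    exact (congrArg (· - ZSpace.proj Ψ (Ker.val _ z).2) e).trans (Ker.map_val _ z)
  have e1 : u₂ ∘ₗ pushD Φ S = pushD Φ T ∘ₗ v := by
    refine ZSpace.hom_ext (h2.comp (pushD_bdd Φ S)) ((pushD_bdd Φ T).comp hv) (fun e => ?_)
      fun w => ?_
    · rw [LinearMap.comp_apply, LinearMap.comp_apply, hv1, pushD_incl, LinearMap.comp_apply,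
        pushD_incl]
      exact LinearMap.congr_fun h4 e
    · rw [LinearMap.comp_apply, LinearMap.comp_apply, hv2, pushD_sec, pushD_sec, map_zero]
  have e2 : ZSpace.proj (Φ.postcomp S.i S.i_bdd) = ZSpace.proj (Φ.postcomp T.i T.i_bdd) ∘ₗ v := by
    refine ZSpace.hom_ext (ZSpace.proj_bdd _) ((ZSpace.proj_bdd _).comp hv) (fun e => ?_)
      fun w => ?_
    · rw [LinearMap.comp_apply, hv1, LinearMap.comp_apply, ZSpace.proj_incl, ZSpace.proj_incl]
    · rw [LinearMap.comp_apply, hv2, ZSpace.proj_sec, ZSpace.proj_sec]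
  refine ⟨v, Ker.lift _ U hU0, hv, Ker.lift_bdd _ hU0 hU, LinearMap.ext fun y => ?_,
    LinearMap.ext fun z => ?_, LinearMap.ext fun z => ?_⟩
  · exact (hv1 (S.i y)).trans (congrArg (ZSpace.incl _) (LinearMap.congr_fun h3 y))
  · refine Ker.val_injective _ (Prod.ext ?_ ?_)
    · exact LinearMap.congr_fun e1 z
    · exact congrArg (ZSpace.incl Ψ) (LinearMap.congr_fun e2 z)
  · exact LinearMap.congr_fun h5 _

/-- ΦΨ + ΦΨ = 2(ΦΨ): scaling the arrow from Y by 1/2 doubles the class. The operators take half the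
sum on the pull-back, and the corresponding half of the folding map on the push-out. -/
theorem addSplice_splice_arrow (h2 : (2⁻¹ : 𝕜) ≠ 0) :
    (addSplice hX hW Φ Ψ (splice hX hW Φ Ψ)).Arrow ((splice hX hW Φ Ψ).scale 2⁻¹ h2) := by
  set Φ' := Φ.postcomp (ZSpace.incl Φ) (ZSpace.incl_bdd Φ) with hΦ'
  have hf : IsBdd ((2⁻¹ : 𝕜) • (LinearMap.id : ZSpace Φ →ₗ[𝕜] ZSpace Φ)) := IsBdd.id.smul _
  have hK : ∃ K : ℝ, ∀ w, ‖((2⁻¹ : 𝕜) • (LinearMap.id : ZSpace Φ →ₗ[𝕜] ZSpace Φ)) (Φ'.toFun w) +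
      ((2⁻¹ : 𝕜) • ZSpace.sec Φ) w‖ ≤ K * ‖(w : W)‖ := ⟨‖(2⁻¹ : 𝕜)‖ * 1, fun w => by
    have e : Φ'.toFun w = ZSpace.incl Φ (Φ.toFun w) := rfl
    rw [e, LinearMap.smul_apply, LinearMap.smul_apply, LinearMap.id_apply, ← smul_add,
      qnorm_smul 𝕜, mul_one]
    exact mul_le_mul_of_nonneg_left (ZSpace.norm_incl_add_sec_le Φ w) (norm_nonneg _)⟩
  have hv := ZSpace.lift_bdd _ _ _ hf hK
  have hv1 := ZSpace.lift_incl _ _ _ hf hK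
  have hv2 := ZSpace.lift_sec _ _ _ hf hK
  set v := ZSpace.lift _ _ _ hf hK
  let T := splice hX hW Φ Ψ
  let P : ZSpace Ψ × ZSpace Ψ →ₗ[𝕜] X :=
    ZSpace.proj Ψ ∘ₗ LinearMap.fst 𝕜 _ _ - ZSpace.proj Ψ ∘ₗ LinearMap.snd 𝕜 _ _
  let U : Ker P →ₗ[𝕜] ZSpace Ψ := (2⁻¹ : 𝕜) •
    (LinearMap.fst 𝕜 _ _ ∘ₗ Ker.val P + LinearMap.snd 𝕜 _ _ ∘ₗ Ker.val P)
  have hU : IsBdd U := ((IsBdd.fst.comp (Ker.val_bdd _)).add (IsBdd.snd.comp (Ker.val_bdd _))).smul _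
  let D : ZSpace Φ' →ₗ[𝕜] ZSpace Ψ := pushD Φ T
  have hD : IsBdd D := pushD_bdd Φ T
  have e1 : (2⁻¹ : 𝕜) • (D + ZSpace.incl Ψ ∘ₗ ZSpace.proj Φ') =
      ZSpace.incl Ψ ∘ₗ ZSpace.proj Φ ∘ₗ v := by
    refine ZSpace.hom_ext ((hD.add ((ZSpace.incl_bdd Ψ).comp (ZSpace.proj_bdd Φ'))).smul _)
      ((ZSpace.incl_bdd Ψ).comp ((ZSpace.proj_bdd Φ).comp hv)) (fun z => ?_) fun w => ?_
    · have hDz : D (ZSpace.incl Φ' z) = ZSpace.incl Ψ (ZSpace.proj Φ z) := pushD_incl Φ T z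
      rw [LinearMap.smul_apply, LinearMap.add_apply, hDz, LinearMap.comp_apply,
        LinearMap.comp_apply, LinearMap.comp_apply, hv1, ZSpace.proj_incl, map_zero, add_zero,
        LinearMap.smul_apply, map_smul, map_smul, LinearMap.id_apply]
    · have hDw : D (ZSpace.sec Φ' w) = 0 := pushD_sec Φ T w
      rw [LinearMap.smul_apply, LinearMap.add_apply, hDw, LinearMap.comp_apply,
        LinearMap.comp_apply, LinearMap.comp_apply, hv2, ZSpace.proj_sec, zero_add,
        LinearMap.smul_apply, map_smul, map_smul, ZSpace.proj_sec]
  refine ⟨v, U, hv, hU, LinearMap.ext fun y => hv1 _, LinearMap.ext fun z => ?_,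
    LinearMap.ext fun z => ?_⟩
  · exact LinearMap.congr_fun e1 z
  · have h := Ker.map_val P z
    have h' : ZSpace.proj Ψ (Ker.val P z).1 = ZSpace.proj Ψ (Ker.val P z).2 := sub_eq_zero.1 h
    change ZSpace.proj Ψ ((2⁻¹ : 𝕜) • ((Ker.val P z).1 + (Ker.val P z).2)) =
      ZSpace.proj Ψ (Ker.val P z).1
    rw [map_smul, map_add, ← h', ← two_smul 𝕜, smul_smul, inv_mul_cancel₀ two_ne_zero, one_smul]

variable (Y W₀) in
/-- The zero map, as a quasilinear map. -/
def _root_.TwistedSum.QuasilinearMap.zero : QuasilinearMap W₀ Y where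
  toFun _ := 0
  map_smul c _ := (smul_zero c).symm
  quasi := ⟨0, fun x y => by rw [sub_zero, sub_zero, qnorm_zero 𝕜, zero_mul]⟩

/-- The zero map gives Z(0) a bounded retraction onto Y; with the projection Z(Ψ) → X it forms an
arrow to the zero sequence. -/
theorem splice_zero_isTrivial : (splice hX hW (QuasilinearMap.zero Y W₀) Ψ).IsTrivial := by
  set O := QuasilinearMap.zero Y W₀
  have hK : ∃ K : ℝ, ∀ w, ‖(LinearMap.id : Y →ₗ[𝕜] Y) (O.toFun w) +
      (0 : W₀ →ₗ[𝕜] Y) w‖ ≤ K * ‖(w : W)‖ := ⟨0, fun w => by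
    have e : O.toFun w = 0 := rfl
    rw [e, map_zero, LinearMap.zero_apply, add_zero, qnorm_zero 𝕜, zero_mul]⟩
  have hb := ZSpace.lift_bdd O _ _ IsBdd.id hK
  refine Arrow.equiv ⟨_, ZSpace.proj Ψ, hb, ZSpace.proj_bdd Ψ, LinearMap.ext fun y => ZSpace.lift_incl O _ _ IsBdd.id hK y,
    LinearMap.ext fun z => ?_, rfl⟩
  exact ZSpace.proj_incl Ψ _

/-- -ΦΨ + ΦΨ ∼ 0. In the push-out of -ι and Φ the two nonlinear terms cancel, so w ↦ (sec w, w) is a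
bounded linear section over W₀ and Z(0) maps into it; the diagonal maps Z(Ψ) into the pull-back. -/
theorem splice_zero_arrow : (splice hX hW (QuasilinearMap.zero Y W₀) Ψ).Arrow
    (addSplice hX hW Φ Ψ (splice hX hW Φ Ψ).neg) := by
  set O := QuasilinearMap.zero Y W₀
  let T := (splice hX hW Φ Ψ).neg
  set Φ' : QuasilinearMap W₀ (ZSpace Φ) := Φ.postcomp T.i T.i_bdd with hΦ'
  have hf : IsBdd (-(ZSpace.incl Φ' ∘ₗ ZSpace.incl Φ)) :=
    ((ZSpace.incl_bdd Φ').comp (ZSpace.incl_bdd Φ)).neg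
  have hK : ∃ K : ℝ, ∀ w, ‖(-(ZSpace.incl Φ' ∘ₗ ZSpace.incl Φ)) (O.toFun w) +
      (ZSpace.incl Φ' ∘ₗ ZSpace.sec Φ + ZSpace.sec Φ') w‖ ≤ K * ‖(w : W)‖ := by
    obtain ⟨M, hM1, hM⟩ := exists_modulus 𝕜 (ZSpace Φ')
    obtain ⟨D, hD0, hD⟩ := (ZSpace.incl_bdd Φ').exists_nonneg
    refine ⟨M * (D + 1), fun w => ?_⟩
    have e0 : O.toFun w = 0 := rfl
    have e1 : Φ'.toFun w = -ZSpace.incl Φ (Φ.toFun w) := rfl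
    have e : (-(ZSpace.incl Φ' ∘ₗ ZSpace.incl Φ)) (O.toFun w) +
        (ZSpace.incl Φ' ∘ₗ ZSpace.sec Φ + ZSpace.sec Φ') w =
        ZSpace.incl Φ' (ZSpace.incl Φ (Φ.toFun w) + ZSpace.sec Φ w) +
        (ZSpace.incl Φ' (Φ'.toFun w) + ZSpace.sec Φ' w) := by
      rw [e0, e1, map_zero, LinearMap.add_apply, LinearMap.comp_apply, map_add, map_neg]
      abel
    rw [e, mul_assoc, add_mul, one_mul]
    refine (hM _ _).trans (mul_le_mul_of_nonneg_left (add_le_add ?_ ?_) (by linarith))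
    · exact (hD _).trans (mul_le_mul_of_nonneg_left (ZSpace.norm_incl_add_sec_le Φ w) hD0)
    · exact ZSpace.norm_incl_add_sec_le Φ' w
  have hv := ZSpace.lift_bdd _ _ _ hf hK
  have hv1 := ZSpace.lift_incl _ _ _ hf hK
  have hv2 := ZSpace.lift_sec _ _ _ hf hK
  set v := ZSpace.lift _ _ _ hf hK
  let P : ZSpace Ψ × ZSpace Ψ →ₗ[𝕜] X :=
    ZSpace.proj Ψ ∘ₗ LinearMap.fst 𝕜 _ _ - ZSpace.proj Ψ ∘ₗ LinearMap.snd 𝕜 _ _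
  let U : ZSpace Ψ →ₗ[𝕜] ZSpace Ψ × ZSpace Ψ := LinearMap.prod LinearMap.id LinearMap.id
  have hU0 : ∀ z, P (U z) = 0 := fun z => sub_self (ZSpace.proj Ψ z)
  let D : ZSpace Φ' →ₗ[𝕜] ZSpace Ψ := pushD Φ T
  have hD : IsBdd D := pushD_bdd Φ T
  have hD1 : ∀ z, D (ZSpace.incl Φ' z) = ZSpace.incl Ψ (ZSpace.proj Φ z) := pushD_incl Φ T
  have hD2 : ∀ w, D (ZSpace.sec Φ' w) = 0 := pushD_sec Φ T
  have e1 : ZSpace.incl Ψ ∘ₗ ZSpace.proj O = D ∘ₗ v := by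
    refine ZSpace.hom_ext ((ZSpace.incl_bdd Ψ).comp (ZSpace.proj_bdd O)) (hD.comp hv)
      (fun y => ?_) fun w => ?_
    · rw [LinearMap.comp_apply, LinearMap.comp_apply, hv1, ZSpace.proj_incl, LinearMap.neg_apply,
        LinearMap.comp_apply, map_neg, hD1, ZSpace.proj_incl, map_zero, neg_zero]
    · rw [LinearMap.comp_apply, LinearMap.comp_apply, hv2, ZSpace.proj_sec, LinearMap.add_apply,
        map_add, hD2, LinearMap.comp_apply, hD1, ZSpace.proj_sec, add_zero]
  have e2 : ZSpace.proj O = ZSpace.proj Φ' ∘ₗ v := by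
    refine ZSpace.hom_ext (ZSpace.proj_bdd O) ((ZSpace.proj_bdd Φ').comp hv)
      (fun y => ?_) fun w => ?_
    · rw [LinearMap.comp_apply, hv1, ZSpace.proj_incl, LinearMap.neg_apply, LinearMap.comp_apply,
        map_neg, ZSpace.proj_incl, neg_zero]
    · rw [LinearMap.comp_apply, hv2, ZSpace.proj_sec, LinearMap.add_apply, map_add,
        LinearMap.comp_apply, ZSpace.proj_incl, ZSpace.proj_sec, zero_add]
  refine ⟨v, Ker.lift P U hU0, hv, Ker.lift_bdd P hU0 (IsBdd.id.prod IsBdd.id),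
    LinearMap.ext fun y => ?_, LinearMap.ext fun z => ?_, rfl⟩
  · exact (hv1 y).trans (map_neg (ZSpace.incl Φ') _).symm
  · refine Ker.val_injective P (Prod.ext ?_ ?_)
    · exact LinearMap.congr_fun e1 z
    · exact congrArg (ZSpace.incl Ψ) (LinearMap.congr_fun e2 z)

/-- A spliced sequence that is equivalent to its additive inverse is trivial. -/
theorem isTrivial_of_equiv_neg (h : (splice hX hW Φ Ψ).Equiv (splice hX hW Φ Ψ).neg) :
    (splice hX hW Φ Ψ).IsTrivial := by
  have h2 : (2⁻¹ : 𝕜) ≠ 0 := inv_ne_zero two_ne_zero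
  -- With S = ΦΨ, triviality is transported along 2S ∼ S + S ∼ -S + S ∼ 0Ψ ∼ 0; doubling is
  -- reversible.
  rw [← isTrivial_scale_iff 2⁻¹ h2, ← (addSplice_splice_arrow hX hW Φ Ψ h2).equiv.isTrivial_iff,
    (h.map (addSplice hX hW Φ Ψ) fun _ _ => Arrow.addSplice hX hW Φ Ψ).isTrivial_iff,
    ← (splice_zero_arrow hX hW Φ Ψ).equiv.isTrivial_iff]
  exact splice_zero_isTrivial hX hW Ψ

end FourTerm

end AddSplice

/-! ### The relations between concatenations -/

namespace Centralizer

variable {𝕜 : Type u} [RCLike 𝕜] {p : ℝ≥0∞} [Fact (0 < p)] [Fact (p < ∞)]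

/-- If the multipliers of the pairs `(R, R')` and `(C, C')` are symplectically orthogonal, then
`R C + R' C' ∼ 0`. -/
theorem concat_equiv_neg_concat {R C R' C' : Centralizer 𝕜 p} {ρ γ ρ' γ' : EllpFin 𝕜 p → ℕ → 𝕜}
    (hρ : IsMultiplier R ρ) (hγ : IsMultiplier C γ) (hρ' : IsMultiplier R' ρ')
    (hγ' : IsMultiplier C' γ')
    (hsymp : ∀ u z i, γ z i * ρ u i + γ' z i * ρ' u i = ρ z i * γ u i + ρ' z i * γ' u i) :
    (R.concat C).Equiv (R'.concat C').neg := by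
  have hsub : ∀ {Φ : Centralizer 𝕜 p} {φ : EllpFin 𝕜 p → ℕ → 𝕜}, IsMultiplier Φ φ →
      ∃ K : ℝ, ∀ x : EllpFin 𝕜 p, ‖(ptMul (φ x) x : Ellp 𝕜 p) - Φ.toFun x‖ ≤ K * ‖x.1‖ := by
    intro Φ φ h
    obtain ⟨K, hK0, hK⟩ := h.norm_sub_le
    refine ⟨K, fun x => ?_⟩
    rw [qnorm_sub_comm 𝕜]
    exact hK x
  refine splice_equiv_neg_splice R.toQuasilinearMap R'.toQuasilinearMap ellpFin_dense ellpFin_dense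
    C.toQuasilinearMap C'.toQuasilinearMap (fun x => ptMul (γ x) x) (fun x => ptMul (γ' x) x)
    (fun x => (ptMul (halfProd ρ γ ρ' γ' x) x).1) (ptMul_smul hγ.1) (ptMul_smul hγ'.1)
    (fun c x => ?_) hγ.defect_le hγ'.defect_le (cocycle_estimate hρ hγ hρ' hγ' hsymp)
    (hsub hγ) (hsub hγ')
  refine congrArg Subtype.val (ptMul_smul (φ := halfProd ρ γ ρ' γ') (fun c x hc => ?_) c x)
  funext i
  simp only [halfProd, hρ.1 c x hc, hγ.1 c x hc, hρ'.1 c x hc, hγ'.1 c x hc]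

/-- Here (ρ, γ) = (φ, ψ) and (ρ', γ') = (ψ, φ), so the symmetry is just the commutativity of
multiplication and the cobounding map is x ↦ xφ(x)ψ(x). -/
theorem concat_equiv_neg (Φ Ψ : Centralizer 𝕜 p) : (Φ.concat Ψ).Equiv (Ψ.concat Φ).neg := by
  obtain ⟨φ, hφ⟩ := exists_isMultiplier Φ
  obtain ⟨ψ, hψ⟩ := exists_isMultiplier Ψ
  exact concat_equiv_neg_concat hφ hψ hψ hφ fun u z i => by ring

theorem neg_concat_equiv (Φ Ψ : Centralizer 𝕜 p) :
    ((-Φ).concat Ψ).Equiv (Φ.concat Ψ).neg := by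
  have h1 : (-1 : 𝕜) ≠ 0 := by simp
  have h := splice_arrow_scale (R := Φ.toQuasilinearMap) (R' := (-Φ).toQuasilinearMap)
    ellpFin_dense ellpFin_dense Ψ.toQuasilinearMap h1 fun w => by
      rw [neg_one_smul]
      rfl
  rw [FourTerm.neg_eq_scale _ h1]
  simp only [inv_neg, inv_one] at h
  exact h.equiv

/-- Formally ΦΦ - ΦΨ + ΨΦ - ΨΨ ∼ -2ΦΨ by anticommutation. No bilinearity is needed: with (Φ + Φ, Ψ)
as second pair the form is φφ + φψ + ψφ - ψψ, symmetric in u and z. -/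
theorem add_concat_sub_equiv (Φ Ψ : Centralizer 𝕜 p) :
    ((Φ + Ψ).concat (Φ - Ψ)).Equiv ((Φ + Φ).concat Ψ).neg := by
  obtain ⟨φ, hφ⟩ := exists_isMultiplier Φ
  obtain ⟨ψ, hψ⟩ := exists_isMultiplier Ψ
  exact concat_equiv_neg_concat (hφ.add hψ) (hφ.add hψ.neg) (hφ.add hφ) hψ fun u z i => by ring

theorem add_self_concat_isTrivial_iff (Φ Ψ : Centralizer 𝕜 p) :
    ((Φ + Φ).concat Ψ).IsTrivial ↔ (Φ.concat Ψ).IsTrivial := by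
  have h := splice_arrow_scale (R := Φ.toQuasilinearMap) (R' := (Φ + Φ).toQuasilinearMap)
    ellpFin_dense ellpFin_dense Ψ.toQuasilinearMap (two_ne_zero (α := 𝕜)) fun w => by
      rw [two_smul]
      rfl
  exact h.equiv.isTrivial_iff.trans (FourTerm.isTrivial_scale_iff _ _)

theorem concat_isTrivial_comm (Φ Ψ : Centralizer 𝕜 p) :
    (Φ.concat Ψ).IsTrivial ↔ (Ψ.concat Φ).IsTrivial :=
  (concat_equiv_neg Φ Ψ).isTrivial_iff.trans (FourTerm.isTrivial_neg_iff _)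

theorem concat_isTrivial_iff_commutes (Φ Ψ : Centralizer 𝕜 p) :
    (Ψ.concat Φ).IsTrivial ↔ Φ.Commutes Ψ := by
  constructor
  · intro h
    exact FourTerm.Equiv.trans ((concat_isTrivial_comm Φ Ψ).2 h) (FourTerm.Equiv.symm h)
  · intro h
    -- Commuting and anticommuting together give ΨΦ ∼ ΦΨ ∼ -ΨΦ.
    exact FourTerm.isTrivial_of_equiv_neg _ _ _ _ (h.symm.trans (concat_equiv_neg Φ Ψ))

end Centralizer

end TwistedSum

theorem mainTheorem7 {𝕜 : Type u} [RCLike 𝕜] (p : ℝ≥0∞) [Fact (0 < p)] [Fact (p < ∞)]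
    (Φ Ψ : TwistedSum.Centralizer 𝕜 p) :
    ((Φ.concat Ψ).Equiv (Ψ.concat Φ).neg ∧ (Φ.concat Ψ).Equiv ((-Ψ).concat Φ)) ∧
    (((Φ.concat Ψ).IsTrivial ↔ (Ψ.concat Φ).IsTrivial) ∧
      ((Ψ.concat Φ).IsTrivial ↔ Φ.Commutes Ψ)) ∧
    ((Φ.concat Ψ).IsTrivial ↔ ((Φ + Ψ).concat (Φ - Ψ)).IsTrivial) :=
  ⟨⟨Φ.concat_equiv_neg Ψ, (Φ.concat_equiv_neg Ψ).trans (Ψ.neg_concat_equiv Φ).symm⟩,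
    ⟨Φ.concat_isTrivial_comm Ψ, Φ.concat_isTrivial_iff_commutes Ψ⟩,
    -- Neither the factor 2 nor the sign in (Φ + Ψ)(Φ - Ψ) ∼ -(2Φ)Ψ affects triviality.
    ((Φ.add_self_concat_isTrivial_iff Ψ).symm.trans (TwistedSum.FourTerm.isTrivial_neg_iff _).symm).trans
      (Φ.add_concat_sub_equiv Ψ).isTrivial_iff.symm⟩
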